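/- Let $u_0(x)=\sin(\log|\log|x||)$, $x\in\mathbb{R}$ (defined a.e.). There exist bounded entropy solutions $u_1$ of $\partial_t w+\partial_x(w^2/2)=0$ and $u_2$ of $\partial_t w-\partial_x(w^2/2)=0$ in $(0,\infty)\times\mathbb{R}$, both in $C([0,\infty);L^1_{\mathrm{loc}}(\mathbb{R}))$ and with initial datum $u_0$. For any such $u_1,u_2$ put $$u(t,x)=\begin{cases}u_1(t,x)& t\ge 0,\\ u_2(-t,x)& t<0,\end{cases}\qquad (t,x)\in\mathbb{R}^2 .$$ Let $f(v)=(v,v^2/2)$. Then: 1. $u$ is a bounded quasi-solution of Burgers' equation on $\mathbb{R}^2$: for every continuous $q:\mathbb{R}\to\mathbb{R}^2$ with $q'=\eta' f'$ for some convex $\eta$, the distribution $-\operatorname{div}_{t,x}q(u)$ is a locally finite signed Radon measure. Moreover $u$ solves $\partial_t u+\partial_x(u^2/2)=0$ on $\mathbb{R}^2$ in the sense of distributions. 2. Let $\chi(v,(t,x))$ be $1$ if $0<v\le u(t,x)$, $-1$ if $u(t,x)<v\le 0$, and $0$ otherwise. There is a (necessarily unique) locally finite signed Radon measure $\mu$ on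 $\mathbb{R}_v\times\mathbb{R}^2$ with $f'(v)\cdot\nabla_{t,x}\chi=\partial_v\mu$ in the sense of distributions and whose marginal $\nu(A)=|\mu|(\mathbb{R}\times A)$ is locally finite on $\mathbb{R}^2$. 3. Let $J^c$ be the set of points $z\in\mathbb{R}^2$ such that $\nu(B_r(z))=o(r)$ as $r\to0$, and let $R$ be the set of Lebesgue points of $u$, i.e. of those $z$ for which there is $c\in\mathbb{R}$ with $\frac{1}{|B_r(z)|}\int_{B_r(z)}|u-c|\to0$ as $r\to 0$. Then the origin does not belong to $J$ and is not a Lebesgue point of $u$. For this $u$ the inclusion $R\subset J^c$ holds and is strict; in particular the property that every point outside $J$ is a Lebesgue point fails. -/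

import Mathlib

open Set Filter Topology MeasureTheory Asymptotics
open scoped ContDiff

noncomputable section

/-- The space of points `ℝⁿ` with its Euclidean norm. In dimension two the coordinate `0` is the
time `t` and the coordinate `1` is the space variable `x`. -/
abbrev Pt (n : ℕ) : Type := EuclideanSpace ℝ (Fin n)

/-- A signed, locally finite Radon measure, given by its Jordan decomposition: two mutually
singular, locally finite positive measures. It may have infinite total mass. -/
structure SignedRadonMeasure (X : Type*) [TopologicalSpace X] [MeasurableSpace X] where
  pos : Measure X
  neg : Measure X
  pos_locallyFinite : IsLocallyFiniteMeasure pos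
  neg_locallyFinite : IsLocallyFiniteMeasure neg
  mutuallySingular : pos ⟂ₘ neg

namespace SignedRadonMeasure

variable {X : Type*} [TopologicalSpace X] [MeasurableSpace X]

/-- The total variation `|μ|`. -/
def totalVariation (μ : SignedRadonMeasure X) : Measure X := μ.pos + μ.neg

/-- The pairing `∫ φ dμ` (used for continuous compactly supported `φ` only). -/
def pairing (μ : SignedRadonMeasure X) (φ : X → ℝ) : ℝ :=
  (∫ x, φ x ∂μ.pos) - ∫ x, φ x ∂μ.neg

end SignedRadonMeasure

/-- Test functions: smooth with compact support. -/
def IsTestFunction {E : Type*} [NormedAddCommGroup E] [NormedSpace ℝ E] (φ : E → ℝ) : Prop :=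
  ContDiff ℝ ∞ φ ∧ HasCompactSupport φ

/-- The class `𝓔₊` of the flux `f`: the continuous `q` with `q' = η' f'` for some convex `η`.
The right derivative of `η` represents the distribution `η'`. -/
def IsEntropyFlux {n : ℕ} (f q : ℝ → Pt n) : Prop :=
  Continuous q ∧ ∃ η : ℝ → ℝ, ConvexOn ℝ univ η ∧
    ∀ a b : ℝ, q b - q a = ∫ v in a..b, derivWithin η (Ioi v) v • deriv f v

/-- Bounded quasi-solutions of the flux `f`: for every `q ∈ 𝓔₊` the distribution `-div q(u)` is
a locally finite signed measure. Note that `fderiv ℝ φ x (q (u x))` is `∇φ(x) · q(u(x))`. -/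
def IsQuasiSolution {n : ℕ} (f : ℝ → Pt n) (u : Pt n → ℝ) : Prop :=
  Measurable u ∧ (∃ M : ℝ, ∀ x, |u x| ≤ M) ∧
    ∀ q : ℝ → Pt n, IsEntropyFlux f q →
      ∃ m : SignedRadonMeasure (Pt n), ∀ φ : Pt n → ℝ, IsTestFunction φ →
        ∫ x, fderiv ℝ φ x (q (u x)) = m.pairing φ

/-- `div f(u) = 0` in the sense of distributions. -/
def IsDivFree {n : ℕ} (f : ℝ → Pt n) (u : Pt n → ℝ) : Prop :=
  ∀ φ : Pt n → ℝ, IsTestFunction φ → ∫ x, fderiv ℝ φ x (f (u x)) = 0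

/-- The kinetic function of `u`: it is `1` if `0 < v ≤ u(x)`, it is `-1` if `u(x) < v ≤ 0`
(which cannot happen for nonnegative `u`), and `0` otherwise. -/
def kineticFn {n : ℕ} (u : Pt n → ℝ) (v : ℝ) (x : Pt n) : ℝ :=
  if 0 < v ∧ v ≤ u x then 1 else if u x < v ∧ v ≤ 0 then -1 else 0

/-- The `x`-marginal `ν(A) = |μ|(ℝ × A)` of the total variation of a measure on `ℝ_v × ℝⁿ_x`. -/
def dissipation {n : ℕ} (μ : SignedRadonMeasure (ℝ × Pt n)) : Measure (Pt n) :=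
  μ.totalVariation.map Prod.snd

/-- `μ` is the kinetic measure of `u`: `f'(v) · ∇ₓ χ = ∂ᵥ μ` in the sense of distributions in
`(v, x)`. The equation determines `μ` up to a term `𝓛¹ ⊗ σ`, which is excluded by
asking that the marginal `ν` be locally finite. -/
def IsKineticMeasure {n : ℕ} (f : ℝ → Pt n) (u : Pt n → ℝ)
    (μ : SignedRadonMeasure (ℝ × Pt n)) : Prop :=
  IsLocallyFiniteMeasure (dissipation μ) ∧
    ∀ φ : ℝ × Pt n → ℝ, IsTestFunction φ →
      ∫ p : ℝ × Pt n, kineticFn u p.1 p.2 * fderiv ℝ φ p (0, deriv f p.1) =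
        μ.pairing (fun p => fderiv ℝ φ p (1, 0))

/-- The set `J`: the points `x` at which `ν(B_r(x)) = o(r^{n-1})` as `r → 0` fails. -/
def jumpSet {n : ℕ} (ν : Measure (Pt n)) : Set (Pt n) :=
  {x | ¬ (fun r : ℝ => ν.real (Metric.ball x r)) =o[𝓝[>] (0 : ℝ)]
      (fun r : ℝ => r ^ ((n : ℤ) - 1))}

/-- The set `R` of Lebesgue points of (the a.e. class of) `u`. -/
def lebesguePoints {n : ℕ} (u : Pt n → ℝ) : Set (Pt n) :=
  {x | ∃ c : ℝ, Tendsto (fun r : ℝ => ⨍ y in Metric.ball x r, |u y - c|)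
      (𝓝[>] (0 : ℝ)) (𝓝 0)}

/-- `u` (restricted to `t ≥ 0`) is a bounded entropy solution of `∂ₜ u + ∂ₓ F(u) = 0` in
`(0,∞) × ℝ` with initial datum `u₀`, in the class `C([0,∞); L¹_loc(ℝ))`: for all convex
entropies `η` with flux `Q' = η' F'` one has `∂ₜ η(u) + ∂ₓ Q(u) ≤ 0` in the sense of
distributions. -/
structure IsEntropySolution (F : ℝ → ℝ) (u₀ : ℝ → ℝ) (u : ℝ → ℝ → ℝ) : Prop where
  measurable : Measurable (Function.uncurry u)
  bounded : ∃ M : ℝ, ∀ t x : ℝ, 0 ≤ t → |u t x| ≤ M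
  continuous_L1loc : ∀ R s : ℝ, 0 < R → 0 ≤ s →
    Tendsto (fun t : ℝ => ∫ x in Icc (-R) R, |u t x - u s x|) (𝓝[Ici 0] s) (𝓝 0)
  initial : ∀ᵐ x : ℝ, u 0 x = u₀ x
  entropy : ∀ η Q : ℝ → ℝ, ContDiff ℝ 2 η → ConvexOn ℝ univ η →
    (∀ v, HasDerivAt Q (deriv η v * deriv F v) v) →
    ∀ φ : ℝ × ℝ → ℝ, IsTestFunction φ → (∀ p, 0 ≤ φ p) → tsupport φ ⊆ Ioi 0 ×ˢ univ →
      0 ≤ ∫ p : ℝ × ℝ, (η (u p.1 p.2) * fderiv ℝ φ p (1, 0) +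
        Q (u p.1 p.2) * fderiv ℝ φ p (0, 1))

/-- The flux `v ↦ (v, v²/2)` of the Burgers equation `∂ₜ u + ∂ₓ (u²/2) = 0` on `ℝ²`. -/
def burgersFlux (v : ℝ) : Pt 2 := !₂[v, v ^ 2 / 2]

/-- The function that is `u₁(t,x)` for `t ≥ 0` and `u₂(-t,x)` for `t < 0`. -/
def glue (u₁ u₂ : ℝ → ℝ → ℝ) (p : Pt 2) : ℝ :=
  if 0 ≤ p 0 then u₁ (p 0) (p 1) else u₂ (-(p 0)) (p 1)

/-- The initial datum `sin (log |log |x||)`. -/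
def oscDatum (x : ℝ) : ℝ := Real.sin (Real.log (abs (Real.log (abs x))))

end

/-! Since the datum is even, `v(t,x) = u₂(t,-x)` is again an entropy solution of Burgers' equation
with the same datum, and the glued function satisfies `u(-z) = v(z)` for `t > 0`. So everything
reduces to two entropy solutions on one half plane, joined by the point reflection `z ↦ -z`. The
entropy production on the half plane, taken together with its initial trace (`entropyFunctional`),
is a nonnegative functional and hence a Radon measure. On the whole plane the traces cancel and the
production of `u` is a difference of two such measures (`integral_planeGlue_entropy`). Integrating
over `w` the productions of entropies with second derivative `δ_w` yields the kinetic measure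
(`IsEntropySolution.exists_kinetic_measure`).

Constants produce no entropy. Hence the production in `B_r` is bounded by `r⁻¹ ∫ |u - c|` over a
comparable half ball plus `∫ |u₀ - c|` over its trace
(`IsEntropySolution.kinetic_measure_closedBall_le`), and at points of the axis `t = 0` Kružkov's
comparison with `c` in a cone bounds the first term by one of the second kind
(`IsEntropySolution.cone_estimate`). The iterated logarithm varies so slowly that at scale `r`
around the origin the datum is close in mean to the constant `c(r) = sin(log|log r|)`; thus `ν(B_r)
= o(r)`. But `c(r)` has no limit as `r → 0`, so the origin is not a Lebesgue point.

For the inclusion `R ⊂ Jᶜ`, the oscillation bound with a fixed `c` settles the points off the axis.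
On the axis, every point with `x ≠ ±1` is outside `J` by the argument above. At `x = ±1` the
function `log|x|` has a simple zero, the datum behaves like `sin(log|x ∓ 1|)`, and its rescalings
along geometric sequences converge to nonconstant profiles; a Lebesgue point would force a constant
weak limit (`IsEntropySolution.tendsto_weak_trace`), so these two points are not in `R`.

Existence comes from the Lax–Oleinik value function `V`, with `u = ∂ₓV`. After mollification of `V`,
Jensen's inequality makes the residual of the Hamilton–Jacobi equation nonpositive and semiconcavity
bounds `∂ₓ²V` from above; these two signs give the entropy inequality in the limit
(`laxSolution_entropy`). -/

namespace IsTestFunction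

/-! ### Test functions -/

variable {E F : Type*} [NormedAddCommGroup E] [NormedSpace ℝ E] [NormedAddCommGroup F]
  [NormedSpace ℝ F] {φ ψ : E → ℝ}

theorem continuous (h : IsTestFunction φ) : Continuous φ := h.1.continuous

theorem differentiable (h : IsTestFunction φ) : Differentiable ℝ φ := h.1.differentiable (by simp)

theorem add (h : IsTestFunction φ) (h' : IsTestFunction ψ) :
    IsTestFunction (fun x => φ x + ψ x) := ⟨h.1.add h'.1, h.2.add h'.2⟩

theorem const_mul (h : IsTestFunction φ) (c : ℝ) : IsTestFunction (fun x => c * φ x) :=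
  ⟨contDiff_const.mul h.1, h.2.mul_left⟩

theorem mul_left (h : IsTestFunction φ) (hψ : ContDiff ℝ ∞ ψ) :
    IsTestFunction (fun x => ψ x * φ x) := ⟨hψ.mul h.1, h.2.mul_left⟩

theorem fderiv_apply (h : IsTestFunction φ) (v : E) : IsTestFunction (fun x => fderiv ℝ φ x v) :=
  ⟨(h.1.fderiv_right (m := ∞) (by simp)).clm_apply contDiff_const,
    (h.2.fderiv ℝ).comp_left (g := fun L : E →L[ℝ] ℝ => L v) rfl⟩

theorem comp_isClosedEmbedding (h : IsTestFunction φ) {g : F → E} (hg : ContDiff ℝ ∞ g)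
    (hc : IsClosedEmbedding g) : IsTestFunction (fun x => φ (g x)) :=
  ⟨h.1.comp hg, h.2.comp_isClosedEmbedding hc⟩

theorem comp_equiv (h : IsTestFunction φ) (e : F ≃L[ℝ] E) : IsTestFunction (fun x => φ (e x)) :=
  h.comp_isClosedEmbedding e.contDiff e.toHomeomorph.isClosedEmbedding

theorem slice {φ : E × F → ℝ} (h : IsTestFunction φ) (w : E) :
    IsTestFunction (fun z => φ (w, z)) := by
  refine h.comp_isClosedEmbedding (contDiff_const.prodMk contDiff_id) ?_
  refine ⟨isEmbedding_prodMkRight w, ?_⟩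
  have : range (Prod.mk w : F → E × F) = Prod.fst ⁻¹' {w} := by
    ext ⟨a, b⟩
    simp [eq_comm]
  rw [this]
  exact isClosed_singleton.preimage continuous_fst

theorem slice_right {φ : E × F → ℝ} (h : IsTestFunction φ) (z : F) :
    IsTestFunction (fun w => φ (w, z)) := by
  refine h.comp_isClosedEmbedding (contDiff_id.prodMk contDiff_const) ?_
  refine ⟨isEmbedding_prodMkLeft z, ?_⟩
  have : range (fun w : E => (w, z)) = Prod.snd ⁻¹' {z} := by
    ext ⟨a, b⟩
    simp [eq_comm]
  rw [this]
  exact isClosed_singleton.preimage continuous_snd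

theorem mul_prod {φ : E → ℝ} {ψ : F → ℝ} (h : IsTestFunction φ) (h' : IsTestFunction ψ) :
    IsTestFunction (fun p : E × F => φ p.1 * ψ p.2) := by
  refine ⟨(h.1.comp contDiff_fst).mul (h'.1.comp contDiff_snd), ?_⟩
  refine HasCompactSupport.intro (h.2.isCompact.prod h'.2.isCompact) ?_
  rintro ⟨a, b⟩ hab
  by_cases ha : a ∈ tsupport φ
  · have : ψ b = 0 := image_eq_zero_of_notMem_tsupport fun hb => hab ⟨ha, hb⟩
    simp [this]
  · simp [image_eq_zero_of_notMem_tsupport ha]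

theorem exists_bound (h : IsTestFunction φ) : ∃ C, 0 ≤ C ∧ ∀ x, |φ x| ≤ C := by
  obtain ⟨C, hC⟩ := h.2.exists_bound_of_continuous h.continuous
  exact ⟨C, (norm_nonneg _).trans (hC 0), fun x => hC x⟩

theorem integrable [MeasurableSpace E] [BorelSpace E] (h : IsTestFunction φ) (μ : Measure E)
    [IsFiniteMeasureOnCompacts μ] : Integrable φ μ :=
  h.continuous.integrable_of_hasCompactSupport h.2

end IsTestFunction

/-! ### Radon measures from positive functionals and their differences -/

/-- A cut-off function of a compact set. -/
theorem exists_isTestFunction_eq_one {E : Type*} [NormedAddCommGroup E] [NormedSpace ℝ E]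
    [FiniteDimensional ℝ E] {K : Set E} (hK : IsCompact K) :
    ∃ φ : E → ℝ, IsTestFunction φ ∧ (∀ x, 0 ≤ φ x) ∧ (∀ x, φ x ≤ 1) ∧ ∀ x ∈ K, φ x = 1 := by
  obtain ⟨R, hR, hKR⟩ := hK.isBounded.subset_closedBall_lt 0 0
  let f : ContDiffBump (0 : E) := ⟨R, R + 1, hR, by linarith⟩
  exact ⟨f, ⟨f.contDiff, f.hasCompactSupport⟩, f.nonneg', fun x => f.le_one,
    fun x hx => f.one_of_mem_closedBall (hKR hx)⟩

open CompactlySupported in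
/-- A positive linear functional on test functions is a Radon measure. -/
theorem exists_measure_of_positive {E : Type*} [NormedAddCommGroup E] [NormedSpace ℝ E]
    [FiniteDimensional ℝ E] [MeasurableSpace E] [BorelSpace E] (L : (E → ℝ) → ℝ)
    (hadd : ∀ φ ψ, IsTestFunction φ → IsTestFunction ψ →
      L (fun x => φ x + ψ x) = L φ + L ψ)
    (hsmul : ∀ (c : ℝ) φ, IsTestFunction φ → L (fun x => c * φ x) = c * L φ)
    (hpos : ∀ φ, IsTestFunction φ → (∀ x, 0 ≤ φ x) → 0 ≤ L φ) :
    ∃ m : Measure E, IsLocallyFiniteMeasure m ∧ ∀ φ, IsTestFunction φ → ∫ x, φ x ∂m = L φ := by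
  let D : Submodule ℝ C_c(E, ℝ) :=
    { carrier := {f | ContDiff ℝ ∞ f}
      add_mem' := fun {f g} hf hg => mem_ofPred.2 ((mem_ofPred.1 hf).add (mem_ofPred.1 hg))
      zero_mem' := mem_ofPred.2 contDiff_const
      smul_mem' := fun c f hf => mem_ofPred.2 ((mem_ofPred.1 hf).const_smul c) }
  have hD : ∀ f : D, IsTestFunction (f : C_c(E, ℝ)) := fun f => ⟨f.2, f.1.hasCompactSupport⟩
  let g : C_c(E, ℝ) →ₗ.[ℝ] ℝ :=
    { domain := D
      toFun :=
        { toFun := fun f => L (f : C_c(E, ℝ))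
          map_add' := fun f f' => hadd _ _ (hD f) (hD f')
          map_smul' := fun c f => hsmul c _ (hD f) } }
  let s : PointedCone ℝ C_c(E, ℝ) :=
    { carrier := {f | ∀ x, 0 ≤ f x}
      add_mem' := fun {f f'} hf hf' x => add_nonneg (hf x) (hf' x)
      zero_mem' := fun x => le_rfl
      smul_mem' := fun c f hf x => mul_nonneg c.2 (hf x) }
  -- M. Riesz extension from smooth to continuous compactly supported functions. Its cofinality
  -- condition holds because a large multiple of a smooth cut-off dominates any `f` in `C_c`; the
  -- extension is positive, so the Riesz–Markov theorem applies to it.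
  obtain ⟨G, hG, hGs⟩ := riesz_extension s g (fun f hf => hpos _ (hD f) hf) (by
    intro f
    obtain ⟨φ, hφ, h0, -, h1⟩ := exists_isTestFunction_eq_one (E := E) f.hasCompactSupport.isCompact
    obtain ⟨C, hC⟩ := f.hasCompactSupport.exists_bound_of_continuous f.continuous
    have hC0 : 0 ≤ C := (norm_nonneg _).trans (hC 0)
    refine ⟨⟨⟨⟨fun x => C * φ x, (hφ.const_mul C).continuous⟩, (hφ.const_mul C).2⟩,
      (hφ.const_mul C).1⟩, fun x => ?_⟩
    change 0 ≤ C * φ x + f x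
    by_cases hx : x ∈ tsupport f
    · rw [h1 x hx]
      have := neg_le_of_abs_le (hC x)
      linarith
    · rw [image_eq_zero_of_notMem_tsupport hx]
      have := mul_nonneg hC0 (h0 x)
      linarith)
  let Λ : C_c(E, ℝ) →ₚ[ℝ] ℝ := PositiveLinearMap.mk₀ G (fun f hf => hGs f fun x => hf x)
  refine ⟨RealRMK.rieszMeasure Λ, inferInstance, fun φ hφ => ?_⟩
  have := RealRMK.integral_rieszMeasure Λ ⟨⟨φ, hφ.continuous⟩, hφ.2⟩
  exact this.trans (hG ⟨⟨⟨φ, hφ.continuous⟩, hφ.2⟩, hφ.1⟩)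

/-- The difference of two locally finite measures, as a signed Radon measure. -/
theorem exists_signedRadonMeasure {X : Type*} [TopologicalSpace X] [SecondCountableTopology X]
    [MeasurableSpace X] [BorelSpace X] (m₁ m₂ : Measure X)
    [IsLocallyFiniteMeasure m₁] [IsLocallyFiniteMeasure m₂] :
    ∃ μ : SignedRadonMeasure X, μ.totalVariation ≤ m₁ + m₂ ∧
      ∀ φ : X → ℝ, Integrable φ m₁ → Integrable φ m₂ →
        μ.pairing φ = ∫ x, φ x ∂m₁ - ∫ x, φ x ∂m₂ := by
  let l := m₁ + m₂
  let f := m₁.rnDeriv l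
  let g := m₂.rnDeriv l
  have hf : Measurable f := Measure.measurable_rnDeriv _ _
  have hg : Measurable g := Measure.measurable_rnDeriv _ _
  have h1 : l.withDensity f = m₁ := Measure.withDensity_rnDeriv_eq _ _
    (Measure.absolutelyContinuous_of_le (Measure.le_add_right le_rfl))
  have h2 : l.withDensity g = m₂ := Measure.withDensity_rnDeriv_eq _ _
    (Measure.absolutelyContinuous_of_le (Measure.le_add_left le_rfl))
  let P := l.withDensity (f - g)
  let N := l.withDensity (g - f)
  have hP : P ≤ m₁ := (withDensity_mono (ae_of_all _ fun x => tsub_le_self)).trans h1.le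
  have hN : N ≤ m₂ := (withDensity_mono (ae_of_all _ fun x => tsub_le_self)).trans h2.le
  have hs : MeasurableSet {x | g x < f x} := measurableSet_lt hg hf
  have hPl : IsLocallyFiniteMeasure P := Measure.isLocallyFiniteMeasure_of_le hP
  have hNl : IsLocallyFiniteMeasure N := Measure.isLocallyFiniteMeasure_of_le hN
  -- The subtractions of densities are truncated, so both sides have density `max f g`. Phrasing the
  -- decomposition as an equality of sums avoids subtracting possibly infinite measures.
  have hPN : P + m₂ = N + m₁ := by
    rw [← h1, ← h2]
    change l.withDensity (f - g) + l.withDensity g = l.withDensity (g - f) + l.withDensity f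
    rw [← withDensity_add_right _ hg, ← withDensity_add_right _ hf]
    congr 1
    funext x
    simp only [Pi.add_apply, Pi.sub_apply]
    rw [tsub_add_eq_max, tsub_add_eq_max, max_comm]
  have hms : P ⟂ₘ N := by
    refine ⟨{x | g x < f x}ᶜ, hs.compl, ?_, ?_⟩
    · change l.withDensity (f - g) _ = 0
      rw [withDensity_apply _ hs.compl, setLIntegral_eq_zero_iff hs.compl (hf.sub hg)]
      refine ae_of_all _ fun x hx => tsub_eq_zero_of_le (not_lt.1 hx)
    · change l.withDensity (g - f) _ = 0
      rw [withDensity_apply _ hs.compl.compl,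
        setLIntegral_eq_zero_iff hs.compl.compl (hg.sub hf)]
      refine ae_of_all _ fun x hx => tsub_eq_zero_of_le ?_
      have : g x < f x := by simpa using hx
      exact this.le
  refine ⟨⟨P, N, hPl, hNl, hms⟩, add_le_add hP hN, fun φ i1 i2 => ?_⟩
  have e : ∫ x, φ x ∂(P + m₂) = ∫ x, φ x ∂(N + m₁) := by rw [hPN]
  rw [integral_add_measure (i1.mono_measure hP) i2,
    integral_add_measure (i2.mono_measure hN) i1] at e
  change (∫ x, φ x ∂P) - ∫ x, φ x ∂N = _
  linarith

/-! ### Entropy pairs and entropy production on the half plane -/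

/-- An entropy pair of the Burgers equation: `η` is convex and `Q' = v η'` in integrated form. -/
def IsEntropyPair (η Q : ℝ → ℝ) : Prop :=
  ConvexOn ℝ univ η ∧ ∃ a, ∀ v, Q v - Q a = v * η v - a * η a - ∫ s in a..v, η s

/-- The entropy production on the half plane `t > 0`, including the initial trace. -/
noncomputable def entropyFunctional (u : ℝ → ℝ → ℝ) (η Q : ℝ → ℝ) (φ : ℝ × ℝ → ℝ) : ℝ :=
  (∫ p in Ioi (0 : ℝ) ×ˢ (univ : Set ℝ), (η (u p.1 p.2) * fderiv ℝ φ p (1, 0) +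
    Q (u p.1 p.2) * fderiv ℝ φ p (0, 1))) + ∫ x, η (u 0 x) * φ (0, x)

theorem ConvexOn.continuous_real {η : ℝ → ℝ} (h : ConvexOn ℝ univ η) : Continuous η :=
  continuousOn_univ.1 (h.continuousOn isOpen_univ)

theorem IsEntropyPair.continuous_left {η Q : ℝ → ℝ} (h : IsEntropyPair η Q) : Continuous η :=
  h.1.continuous_real

theorem IsEntropyPair.continuous_right {η Q : ℝ → ℝ} (h : IsEntropyPair η Q) : Continuous Q := by
  obtain ⟨a, ha⟩ := h.2
  have hη := h.continuous_left
  have : Q = fun v => v * η v - a * η a - (∫ s in a..v, η s) + Q a := by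
    funext v
    linarith [ha v]
  rw [this]
  have := intervalIntegral.continuous_primitive (μ := volume)
    (fun x y => hη.intervalIntegrable x y) a
  fun_prop

theorem measurableSet_upper : MeasurableSet (Ioi (0 : ℝ) ×ˢ (univ : Set ℝ)) :=
  measurableSet_Ioi.prod MeasurableSet.univ

theorem MeasureTheory.IntegrableOn.mul_of_bound {α : Type*} [MeasurableSpace α] {μ : Measure α}
    {s : Set α} (hs : MeasurableSet s) {f g : α → ℝ} {C : ℝ} (hf : IntegrableOn f s μ)
    (hg : Measurable g) (hC : ∀ x ∈ s, |g x| ≤ C) : IntegrableOn (fun x => g x * f x) s μ :=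
  Integrable.bdd_mul hf hg.aestronglyMeasurable
    ((ae_restrict_iff' hs).2 (ae_of_all _ hC))

theorem exists_bound_of_continuous {η : ℝ → ℝ} (hη : Continuous η) (M : ℝ) :
    ∃ C, 0 ≤ C ∧ ∀ v, |v| ≤ M → |η v| ≤ C := by
  obtain ⟨C, hC⟩ := (isCompact_Icc (a := -M) (b := M)).exists_bound_of_continuousOn hη.continuousOn
  exact ⟨max C 0, le_max_right _ _, fun v hv => (hC v (abs_le.1 hv)).trans (le_max_left _ _)⟩

section

variable {u₀ : ℝ → ℝ} {u : ℝ → ℝ → ℝ} {F : ℝ → ℝ}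

theorem IsEntropySolution.exists_bound (hu : IsEntropySolution F u₀ u) :
    ∃ M, 1 ≤ M ∧ ∀ t x, 0 ≤ t → |u t x| ≤ M := by
  obtain ⟨M, hM⟩ := hu.bounded
  exact ⟨max M 1, le_max_right _ _, fun t x ht => (hM t x ht).trans (le_max_left _ _)⟩

theorem IsEntropySolution.measurable_slice (hu : IsEntropySolution F u₀ u) (t : ℝ) :
    Measurable (u t) := hu.measurable.comp measurable_prodMk_left

theorem IsEntropySolution.integrableOn_mul (hu : IsEntropySolution F u₀ u) {η : ℝ → ℝ}
    (hη : Continuous η) {ψ : ℝ × ℝ → ℝ} (hψ : IsTestFunction ψ) :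
    IntegrableOn (fun p : ℝ × ℝ => η (u p.1 p.2) * ψ p) (Ioi (0 : ℝ) ×ˢ (univ : Set ℝ)) := by
  obtain ⟨M, -, hM⟩ := hu.exists_bound
  obtain ⟨C, -, hC⟩ := exists_bound_of_continuous hη M
  exact (hψ.integrable volume).integrableOn.mul_of_bound measurableSet_upper
    (hη.measurable.comp hu.measurable) (fun p hp => hC _ (hM _ _ (le_of_lt hp.1)))

theorem IsEntropySolution.integrable_slice_mul (hu : IsEntropySolution F u₀ u) {η : ℝ → ℝ}
    (hη : Continuous η) {ψ : ℝ → ℝ} (hψ : IsTestFunction ψ) {t : ℝ} (ht : 0 ≤ t) :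
    Integrable (fun x : ℝ => η (u t x) * ψ x) := by
  obtain ⟨M, -, hM⟩ := hu.exists_bound
  obtain ⟨C, -, hC⟩ := exists_bound_of_continuous hη M
  rw [← integrableOn_univ]
  exact (hψ.integrable volume).integrableOn.mul_of_bound MeasurableSet.univ
    (hη.measurable.comp (hu.measurable_slice t)) (fun x _ => hC _ (hM _ _ ht))

theorem IsEntropySolution.integrableOn_integrand (hu : IsEntropySolution F u₀ u) {η Q : ℝ → ℝ}
    (hη : Continuous η) (hQ : Continuous Q) {φ : ℝ × ℝ → ℝ} (hφ : IsTestFunction φ) :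
    IntegrableOn (fun p : ℝ × ℝ => η (u p.1 p.2) * fderiv ℝ φ p (1, 0) +
      Q (u p.1 p.2) * fderiv ℝ φ p (0, 1)) (Ioi (0 : ℝ) ×ˢ (univ : Set ℝ)) :=
  Integrable.add (hu.integrableOn_mul hη (hφ.fderiv_apply _))
    (hu.integrableOn_mul hQ (hφ.fderiv_apply _))

theorem entropyFunctional_add (hu : IsEntropySolution F u₀ u) {η Q : ℝ → ℝ} (hη : Continuous η)
    (hQ : Continuous Q) {φ ψ : ℝ × ℝ → ℝ} (hφ : IsTestFunction φ) (hψ : IsTestFunction ψ) :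
    entropyFunctional u η Q (fun p => φ p + ψ p) =
      entropyFunctional u η Q φ + entropyFunctional u η Q ψ := by
  unfold entropyFunctional
  have i1 := hu.integrableOn_integrand hη hQ hφ
  have i2 := hu.integrableOn_integrand hη hQ hψ
  have j1 := hu.integrable_slice_mul hη (hφ.slice (0 : ℝ)) le_rfl
  have j2 := hu.integrable_slice_mul hη (hψ.slice (0 : ℝ)) le_rfl
  have e1 : ∀ p v, fderiv ℝ (fun p => φ p + ψ p) p v = fderiv ℝ φ p v + fderiv ℝ ψ p v := by
    intro p v
    rw [fderiv_fun_add (hφ.differentiable p) (hψ.differentiable p)]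
    rfl
  have e2 : ∀ p : ℝ × ℝ, η (u p.1 p.2) * fderiv ℝ (fun p => φ p + ψ p) p (1, 0) +
      Q (u p.1 p.2) * fderiv ℝ (fun p => φ p + ψ p) p (0, 1) =
      (η (u p.1 p.2) * fderiv ℝ φ p (1, 0) + Q (u p.1 p.2) * fderiv ℝ φ p (0, 1)) +
      (η (u p.1 p.2) * fderiv ℝ ψ p (1, 0) + Q (u p.1 p.2) * fderiv ℝ ψ p (0, 1)) := by
    intro p
    rw [e1, e1]
    ring
  simp_rw [e2, mul_add]
  rw [integral_add i1 i2, integral_add j1 j2]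
  ring

theorem entropyFunctional_const_mul (u : ℝ → ℝ → ℝ) (η Q : ℝ → ℝ) (c : ℝ)
    {φ : ℝ × ℝ → ℝ} (hφ : IsTestFunction φ) :
    entropyFunctional u η Q (fun p => c * φ p) = c * entropyFunctional u η Q φ := by
  unfold entropyFunctional
  have e1 : ∀ p v, fderiv ℝ (fun p => c * φ p) p v = c * fderiv ℝ φ p v := by
    intro p v
    rw [fderiv_const_mul (hφ.differentiable p)]
    rfl
  simp_rw [e1]
  rw [mul_add, ← integral_const_mul, ← integral_const_mul]
  congr 1 <;> congr 1 <;> funext p <;> ring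

/-- The functional is linear in the pair. -/
theorem entropyFunctional_linear_pair (hu : IsEntropySolution F u₀ u) {η Q η' Q' : ℝ → ℝ}
    (hη : Continuous η) (hQ : Continuous Q) (hη' : Continuous η') (hQ' : Continuous Q') (c : ℝ)
    {φ : ℝ × ℝ → ℝ} (hφ : IsTestFunction φ) :
    entropyFunctional u (fun v => η v + c * η' v) (fun v => Q v + c * Q' v) φ =
      entropyFunctional u η Q φ + c * entropyFunctional u η' Q' φ := by
  unfold entropyFunctional
  have i1 := hu.integrableOn_integrand hη hQ hφ
  have i2 := hu.integrableOn_integrand hη' hQ' hφ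
  have j1 := hu.integrable_slice_mul hη (hφ.slice (0 : ℝ)) le_rfl
  have j2 := hu.integrable_slice_mul hη' (hφ.slice (0 : ℝ)) le_rfl
  rw [mul_add, ← integral_const_mul, ← integral_const_mul,
    add_add_add_comm, ← integral_add i1 (i2.const_mul c),
    ← integral_add j1 (j2.const_mul c)]
  congr 1 <;> congr 1 <;> funext p <;> ring

end

/-! ### The entropy inequality up to the initial time -/

section

variable {u₀ : ℝ → ℝ} {u : ℝ → ℝ → ℝ} {F : ℝ → ℝ}

/-- Provides the dominating constant for the limit in the initial layer: slices of `φ` are supported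
in one fixed interval. -/
theorem IsEntropySolution.abs_slice_integral_le (hu : IsEntropySolution F u₀ u) {η : ℝ → ℝ}
    (hη : Continuous η) {φ : ℝ × ℝ → ℝ} (hφ : IsTestFunction φ) :
    ∃ C, ∀ t, 0 ≤ t → |∫ x, η (u t x) * φ (t, x)| ≤ C := by
  obtain ⟨M, -, hM⟩ := hu.exists_bound
  obtain ⟨C, hC0, hC⟩ := exists_bound_of_continuous hη M
  obtain ⟨D, hD0, hD⟩ := hφ.exists_bound
  obtain ⟨R, hR0, hR⟩ := hφ.2.isCompact.isBounded.subset_closedBall_lt 0 0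
  have hsupp : ∀ t x, x ∉ Icc (-R) R → φ (t, x) = 0 := by
    intro t x hx
    refine image_eq_zero_of_notMem_tsupport fun h => hx ?_
    have := hR h
    rw [mem_closedBall_zero_iff, Prod.norm_def] at this
    exact abs_le.1 ((le_max_right _ _).trans this)
  refine ⟨C * D * (2 * R), fun t ht => ?_⟩
  rw [← setIntegral_eq_integral_of_forall_compl_eq_zero (s := Icc (-R) R)
    (fun x hx => by rw [hsupp t x hx, mul_zero])]
  have := norm_setIntegral_le_of_norm_le_const (μ := volume) (s := Icc (-R) R)
    (f := fun x => η (u t x) * φ (t, x)) (C := C * D) (by simp) (fun x _ => by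
      rw [norm_mul]
      exact mul_le_mul (hC _ (hM _ _ ht)) (hD _) (norm_nonneg _) hC0)
  refine this.trans (le_of_eq ?_)
  rw [Real.volume_real_Icc_of_le (by linarith)]
  ring

/-- A `C¹` entropy is Lipschitz on the bounded range of `u`, so continuity in `L¹_loc` passes from
`u` to `η(u)`; the variation of `φ` in time is handled by dominated convergence. -/
theorem IsEntropySolution.tendsto_slice_integral (hu : IsEntropySolution F u₀ u) {η : ℝ → ℝ}
    (hη : ContDiff ℝ 1 η) {φ : ℝ × ℝ → ℝ} (hφ : IsTestFunction φ) :
    Tendsto (fun t => ∫ x, η (u t x) * φ (t, x)) (𝓝[>] 0) (𝓝 (∫ x, η (u 0 x) * φ (0, x))) := by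
  obtain ⟨M, -, hM⟩ := hu.exists_bound
  obtain ⟨C, hC0, hC⟩ := exists_bound_of_continuous hη.continuous M
  obtain ⟨D, hD0, hD⟩ := hφ.exists_bound
  obtain ⟨R, hR0, hR⟩ := hφ.2.isCompact.isBounded.subset_closedBall_lt 0 0
  have hsupp : ∀ t x, x ∉ Icc (-R) R → φ (t, x) = 0 := by
    intro t x hx
    refine image_eq_zero_of_notMem_tsupport fun h => hx ?_
    have := hR h
    rw [mem_closedBall_zero_iff, Prod.norm_def] at this
    exact abs_le.1 ((le_max_right _ _).trans this)
  obtain ⟨K, hK⟩ := hη.contDiffOn.exists_lipschitzOnWith (s := Icc (-M) M) (by simp)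
    (convex_Icc _ _) isCompact_Icc
  have hKu : ∀ t x, 0 ≤ t → |η (u t x) - η (u 0 x)| ≤ K * |u t x - u 0 x| := fun t x ht =>
    hK.dist_le_mul _ (abs_le.1 (hM _ _ ht)) _ (abs_le.1 (hM _ _ le_rfl))
  have hint : ∀ t, 0 ≤ t → IntegrableOn (fun x => |u t x - u 0 x|) (Icc (-R) R) := by
    intro t ht
    refine Measure.integrableOn_of_bounded (M := M + M) (by simp)
      ((hu.measurable_slice t).sub (hu.measurable_slice 0)).abs.aestronglyMeasurable
      (ae_of_all _ fun x => ?_)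
    rw [Real.norm_eq_abs, abs_abs]
    exact (abs_sub _ _).trans (add_le_add (hM _ _ ht) (hM _ _ le_rfl))
  have h1 : Tendsto (fun t => ∫ x, (η (u t x) - η (u 0 x)) * φ (t, x)) (𝓝[>] 0) (𝓝 0) := by
    have h := ((hu.continuous_L1loc R 0 hR0 le_rfl).mono_left
      (nhdsWithin_mono _ Ioi_subset_Ici_self)).const_mul (K * D)
    rw [mul_zero] at h
    refine squeeze_zero_norm' ?_ h
    filter_upwards [self_mem_nhdsWithin] with t ht
    have ht0 : 0 ≤ t := le_of_lt ht
    rw [← setIntegral_eq_integral_of_forall_compl_eq_zero (s := Icc (-R) R)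
      (fun x hx => by rw [hsupp t x hx, mul_zero]), ← integral_const_mul]
    refine norm_integral_le_of_norm_le ((hint t ht0).const_mul _) (ae_of_all _ fun x => ?_)
    rw [norm_mul]
    calc ‖η (u t x) - η (u 0 x)‖ * ‖φ (t, x)‖ ≤ (K * |u t x - u 0 x|) * D :=
          mul_le_mul (hKu t x ht0) (hD _) (norm_nonneg _) (by positivity)
      _ = K * D * |u t x - u 0 x| := by ring
  have h2 : Tendsto (fun t => ∫ x, η (u 0 x) * φ (t, x)) (𝓝[>] 0)
      (𝓝 (∫ x, η (u 0 x) * φ (0, x))) := by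
    refine tendsto_integral_filter_of_dominated_convergence
      ((Icc (-R) R).indicator fun _ => C * D) ?_ ?_ ?_ ?_
    · refine Eventually.of_forall fun t => ?_
      exact ((hη.continuous.measurable.comp (hu.measurable_slice 0)).mul
        (hφ.continuous.measurable.comp measurable_prodMk_left)).aestronglyMeasurable
    · refine Eventually.of_forall fun t => ae_of_all _ fun x => ?_
      by_cases hx : x ∈ Icc (-R) R
      · rw [indicator_of_mem hx, norm_mul]
        exact mul_le_mul (hC _ (hM _ _ le_rfl)) (hD _) (norm_nonneg _) hC0
      · rw [indicator_of_notMem hx, hsupp t x hx, mul_zero, norm_zero]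
    · rw [integrable_indicator_iff measurableSet_Icc]
      exact integrableOn_const (by simp)
    · refine ae_of_all _ fun x => Tendsto.mono_left ?_ nhdsWithin_le_nhds
      have : Continuous fun t => η (u 0 x) * φ (t, x) :=
        continuous_const.mul (hφ.continuous.comp (by fun_prop))
      exact this.tendsto 0
  have h3 := h1.add h2
  rw [zero_add] at h3
  refine h3.congr' ?_
  filter_upwards [self_mem_nhdsWithin] with t ht
  have ht0 : 0 ≤ t := le_of_lt ht
  have j1 := hu.integrable_slice_mul hη.continuous (hφ.slice t) ht0
  have j2 := hu.integrable_slice_mul hη.continuous (hφ.slice t) le_rfl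
  simp_rw [sub_mul]
  rw [integral_sub j1 j2]
  ring

/-- A smooth function which vanishes for `t ≤ 1` and equals one for `t ≥ 2`. -/
noncomputable def smoothStep (t : ℝ) : ℝ := Real.smoothTransition (t - 1)

theorem smoothStep_contDiff : ContDiff ℝ ∞ smoothStep :=
  Real.smoothTransition.contDiff.comp (contDiff_id.sub contDiff_const)

theorem smoothStep_eq_zero {t : ℝ} (ht : t ≤ 1) : smoothStep t = 0 :=
  Real.smoothTransition.zero_of_nonpos (by linarith)

theorem smoothStep_eq_one {t : ℝ} (ht : 2 ≤ t) : smoothStep t = 1 :=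
  Real.smoothTransition.one_of_one_le (by linarith)

theorem smoothStep_nonneg (t : ℝ) : 0 ≤ smoothStep t := Real.smoothTransition.nonneg _

theorem smoothStep_le_one (t : ℝ) : smoothStep t ≤ 1 := Real.smoothTransition.le_one _

theorem smoothStep_monotone : Monotone smoothStep := fun _ _ h =>
  Real.smoothTransition.monotone (by linarith)

theorem continuous_deriv_smoothStep : Continuous (deriv smoothStep) :=
  smoothStep_contDiff.continuous_deriv (by simp)

theorem hasCompactSupport_deriv_smoothStep : HasCompactSupport (deriv smoothStep) := by
  refine HasCompactSupport.intro (K := Icc 1 2) isCompact_Icc fun x hx => ?_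
  rcases not_and_or.1 hx with h | h
  · have : smoothStep =ᶠ[𝓝 x] fun _ => 0 := by
      filter_upwards [Iio_mem_nhds (not_le.1 h)] with y hy using smoothStep_eq_zero (le_of_lt hy)
    rw [this.deriv_eq, deriv_const]
  · have : smoothStep =ᶠ[𝓝 x] fun _ => 1 := by
      filter_upwards [Ioi_mem_nhds (not_le.1 h)] with y hy using smoothStep_eq_one (le_of_lt hy)
    rw [this.deriv_eq, deriv_const]

theorem integral_deriv_smoothStep : ∫ s in Ioi (0 : ℝ), deriv smoothStep s = 1 := by
  have := integral_Ioi_of_hasDerivAt_of_tendsto (f := smoothStep) (f' := deriv smoothStep)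
    (a := 0) (m := 1) smoothStep_contDiff.continuous.continuousWithinAt
    (fun x _ => (smoothStep_contDiff.differentiable (by simp) x).hasDerivAt)
    (continuous_deriv_smoothStep.integrable_of_hasCompactSupport
      hasCompactSupport_deriv_smoothStep).integrableOn
    (tendsto_const_nhds.congr' (by
      filter_upwards [eventually_ge_atTop 2] with y hy using (smoothStep_eq_one hy).symm))
  rw [this, smoothStep_eq_zero (by norm_num), sub_zero]

theorem tendsto_smoothStep_div {t : ℝ} (ht : 0 < t) :
    Tendsto (fun δ : ℝ => smoothStep (t / δ)) (𝓝[>] 0) (𝓝 1) := by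
  refine tendsto_const_nhds.congr' ?_
  filter_upwards [Ioo_mem_nhdsGT (show (0 : ℝ) < t / 2 by positivity)] with δ hδ
  refine (smoothStep_eq_one ?_).symm
  rw [le_div_iff₀ hδ.1]
  linarith [hδ.2]

/-- A cut-off near `t = 0` concentrates on the initial trace. -/
theorem IsEntropySolution.tendsto_layer (hu : IsEntropySolution F u₀ u) {η : ℝ → ℝ}
    (hη : ContDiff ℝ 1 η) {φ : ℝ × ℝ → ℝ} (hφ : IsTestFunction φ) :
    Tendsto (fun δ : ℝ => ∫ p in Ioi (0 : ℝ) ×ˢ (univ : Set ℝ),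
      (δ⁻¹ * deriv smoothStep (p.1 / δ)) * (η (u p.1 p.2) * φ p)) (𝓝[>] 0)
      (𝓝 (∫ x, η (u 0 x) * φ (0, x))) := by
  set G : ℝ → ℝ := fun t => ∫ x, η (u t x) * φ (t, x) with hG
  obtain ⟨C, hC⟩ := hu.abs_slice_integral_le hη.continuous hφ
  have hGm : Measurable G := by
    have : Measurable (Function.uncurry fun t x => η (u t x) * φ (t, x)) :=
      (hη.continuous.measurable.comp hu.measurable).mul hφ.continuous.measurable
    exact this.stronglyMeasurable.integral_prod_right.measurable
  -- The substitution `t = δ s` turns the layer integral into an average of `G (δ s)` against `deriv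
  -- smoothStep`, which has total mass one.
  have h1 : Tendsto (fun δ : ℝ => ∫ s in Ioi (0 : ℝ), deriv smoothStep s * G (δ * s)) (𝓝[>] 0)
      (𝓝 (∫ s in Ioi (0 : ℝ), deriv smoothStep s * G 0)) := by
    have hi := continuous_deriv_smoothStep.integrable_of_hasCompactSupport (μ := volume)
      hasCompactSupport_deriv_smoothStep
    refine tendsto_integral_filter_of_dominated_convergence
      (fun s => |deriv smoothStep s| * C) ?_ ?_ ?_ ?_
    · refine Eventually.of_forall fun δ => ?_
      exact (continuous_deriv_smoothStep.measurable.mul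
        (hGm.comp (measurable_const.mul measurable_id))).aestronglyMeasurable
    · filter_upwards [self_mem_nhdsWithin] with δ hδ
      refine (ae_restrict_iff' measurableSet_Ioi).2 (ae_of_all _ fun s hs => ?_)
      rw [norm_mul]
      exact mul_le_mul_of_nonneg_left (hC _ (mul_pos (mem_Ioi.1 hδ) (mem_Ioi.1 hs)).le) (norm_nonneg _)
    · exact (hi.abs.mul_const C).integrableOn
    · refine (ae_restrict_iff' measurableSet_Ioi).2 (ae_of_all _ fun s hs => ?_)
      refine Tendsto.const_mul _ ?_
      refine (hu.tendsto_slice_integral hη hφ).comp ?_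
      refine tendsto_nhdsWithin_iff.2 ⟨?_, ?_⟩
      · have : Tendsto (fun δ : ℝ => δ * s) (𝓝 0) (𝓝 (0 * s)) :=
          (continuous_id.mul continuous_const).tendsto 0
        rw [zero_mul] at this
        exact this.mono_left nhdsWithin_le_nhds
      · filter_upwards [self_mem_nhdsWithin] with δ hδ using mul_pos (mem_Ioi.1 hδ) (mem_Ioi.1 hs)
  rw [integral_mul_const, integral_deriv_smoothStep, one_mul] at h1
  refine h1.congr' ?_
  filter_upwards [self_mem_nhdsWithin] with δ hδ
  have hδ0 : (0 : ℝ) < δ := hδ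
  have hbd : ∃ B, ∀ s, |deriv smoothStep s| ≤ B := by
    obtain ⟨B, hB⟩ := hasCompactSupport_deriv_smoothStep.exists_bound_of_continuous
      continuous_deriv_smoothStep
    exact ⟨B, hB⟩
  obtain ⟨B, hB⟩ := hbd
  have hi : IntegrableOn (fun p : ℝ × ℝ =>
      (δ⁻¹ * deriv smoothStep (p.1 / δ)) * (η (u p.1 p.2) * φ p)) (Ioi (0 : ℝ) ×ˢ univ) := by
    refine (hu.integrableOn_mul hη.continuous hφ).mul_of_bound (C := |δ⁻¹| * B)
      measurableSet_upper ?_ fun p _ => ?_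
    · exact measurable_const.mul (continuous_deriv_smoothStep.measurable.comp
        (measurable_fst.div_const _))
    · rw [abs_mul]
      exact mul_le_mul_of_nonneg_left (hB _) (abs_nonneg _)
  rw [Measure.volume_eq_prod] at hi ⊢
  rw [setIntegral_prod _ hi]
  have := integral_comp_mul_left_Ioi (fun t => deriv smoothStep (t / δ) * G t) 0 hδ0
  simp only [mul_zero, smul_eq_mul] at this
  rw [← integral_const_mul] at this
  have e : ∀ s : ℝ, δ * s / δ = s := fun s => by field_simp
  simp_rw [e] at this
  rw [this]
  refine setIntegral_congr_fun measurableSet_Ioi fun t _ => ?_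
  simp only [setIntegral_univ]
  rw [integral_const_mul, mul_assoc]

/-- The entropy inequality up to the initial time. -/
theorem IsEntropySolution.entropyFunctional_nonneg_of_contDiff (hu : IsEntropySolution F u₀ u)
    {η Q : ℝ → ℝ} (hη : ContDiff ℝ 2 η) (hconv : ConvexOn ℝ univ η)
    (hQ : ∀ v, HasDerivAt Q (deriv η v * deriv F v) v) {φ : ℝ × ℝ → ℝ} (hφ : IsTestFunction φ)
    (h0 : ∀ p, 0 ≤ φ p) : 0 ≤ entropyFunctional u η Q φ := by
  have hη1 : ContDiff ℝ 1 η := hη.of_le (by norm_num)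
  -- The test function is multiplied by `smoothStep (t / δ)`, which is supported in `t ≥ δ`. As `δ →
  -- 0` the factor tends to one, while its time derivative produces the initial trace.
  have hQc : Continuous Q := continuous_iff_continuousAt.2 fun v => (hQ v).continuousAt
  have hi := hu.integrableOn_integrand hη.continuous hQc hφ
  have h1 : Tendsto (fun δ : ℝ => ∫ p in Ioi (0 : ℝ) ×ˢ (univ : Set ℝ), smoothStep (p.1 / δ) *
      (η (u p.1 p.2) * fderiv ℝ φ p (1, 0) + Q (u p.1 p.2) * fderiv ℝ φ p (0, 1))) (𝓝[>] 0)
      (𝓝 (∫ p in Ioi (0 : ℝ) ×ˢ (univ : Set ℝ),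
        (η (u p.1 p.2) * fderiv ℝ φ p (1, 0) + Q (u p.1 p.2) * fderiv ℝ φ p (0, 1)))) := by
    refine tendsto_integral_filter_of_dominated_convergence _ ?_ ?_ hi.norm ?_
    · refine Eventually.of_forall fun δ => ?_
      exact (smoothStep_contDiff.continuous.measurable.comp
        (measurable_fst.div_const _)).aestronglyMeasurable.mul hi.aestronglyMeasurable
    · refine Eventually.of_forall fun δ => ae_of_all _ fun p => ?_
      rw [norm_mul]
      refine mul_le_of_le_one_left (norm_nonneg _) ?_
      rw [Real.norm_eq_abs, abs_of_nonneg (smoothStep_nonneg _)]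
      exact smoothStep_le_one _
    · refine (ae_restrict_iff' measurableSet_upper).2 (ae_of_all _ fun p hp => ?_)
      have := (tendsto_smoothStep_div hp.1).mul_const
        (η (u p.1 p.2) * fderiv ℝ φ p (1, 0) + Q (u p.1 p.2) * fderiv ℝ φ p (0, 1))
      rwa [one_mul] at this
  have h2 := h1.add (hu.tendsto_layer hη1 hφ)
  refine ge_of_tendsto h2 ?_
  filter_upwards [self_mem_nhdsWithin] with δ hδ
  have hδ0 : (0 : ℝ) < δ := hδ
  have hA : ContDiff ℝ ∞ fun p : ℝ × ℝ => smoothStep (p.1 / δ) :=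
    smoothStep_contDiff.comp (contDiff_fst.div_const δ)
  have hφδ := hφ.mul_left hA
  have hsupp : tsupport (fun p : ℝ × ℝ => smoothStep (p.1 / δ) * φ p) ⊆ Ioi 0 ×ˢ univ := by
    have : tsupport (fun p : ℝ × ℝ => smoothStep (p.1 / δ) * φ p) ⊆ {p | δ ≤ p.1} := by
      refine closure_minimal (fun p hp => ?_) (isClosed_le continuous_const continuous_fst)
      refine mem_ofPred.2 ?_
      by_contra hlt
      refine hp ?_
      have : smoothStep (p.1 / δ) = 0 :=
        smoothStep_eq_zero ((div_le_one hδ0).2 (not_le.1 hlt).le)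
      simp [this]
    exact this.trans fun p hp => ⟨lt_of_lt_of_le hδ0 (mem_ofPred.1 hp), mem_univ _⟩
  have hent := hu.entropy η Q hη hconv hQ _ hφδ
    (fun p => mul_nonneg (smoothStep_nonneg _) (h0 p)) hsupp
  have hd : ∀ (p v : ℝ × ℝ), fderiv ℝ (fun p : ℝ × ℝ => smoothStep (p.1 / δ) * φ p) p v =
      smoothStep (p.1 / δ) * fderiv ℝ φ p v + (δ⁻¹ * deriv smoothStep (p.1 / δ)) * v.1 * φ p := by
    intro p v
    have a1 : HasFDerivAt (fun p : ℝ × ℝ => smoothStep (p.1 / δ))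
        ((deriv smoothStep (p.1 / δ)) • (δ⁻¹ • ContinuousLinearMap.fst ℝ ℝ ℝ)) p := by
      have b : HasFDerivAt (fun p : ℝ × ℝ => p.1 / δ) (δ⁻¹ • ContinuousLinearMap.fst ℝ ℝ ℝ) p := by
        simp_rw [div_eq_inv_mul]
        exact hasFDerivAt_fst.const_mul _
      exact HasDerivAt.comp_hasFDerivAt (h₂ := smoothStep) p
        (smoothStep_contDiff.differentiable (by simp) (p.1 / δ)).hasDerivAt b
    rw [(a1.fun_mul (hφ.differentiable p).hasFDerivAt).fderiv]
    simp
    ring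
  rw [← setIntegral_eq_integral_of_forall_compl_eq_zero (s := Ioi (0 : ℝ) ×ˢ (univ : Set ℝ))
    (fun p hp => by
      have hz : ∀ v, fderiv ℝ (fun p : ℝ × ℝ => smoothStep (p.1 / δ) * φ p) p v = 0 := by
        intro v
        have : p ∉ tsupport (fun p : ℝ × ℝ => smoothStep (p.1 / δ) * φ p) := fun h => hp (hsupp h)
        rw [image_eq_zero_of_notMem_tsupport fun h => this (tsupport_fderiv_subset ℝ h)]
        rfl
      rw [hz, hz, mul_zero, mul_zero, add_zero])] at hent
  have i1 : IntegrableOn (fun p : ℝ × ℝ => smoothStep (p.1 / δ) *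
      (η (u p.1 p.2) * fderiv ℝ φ p (1, 0) + Q (u p.1 p.2) * fderiv ℝ φ p (0, 1)))
      (Ioi (0 : ℝ) ×ˢ univ) := by
    refine hi.mul_of_bound (C := 1) measurableSet_upper hA.continuous.measurable fun p _ => ?_
    rw [abs_of_nonneg (smoothStep_nonneg _)]
    exact smoothStep_le_one _
  have i2 : IntegrableOn (fun p : ℝ × ℝ =>
      (δ⁻¹ * deriv smoothStep (p.1 / δ)) * (η (u p.1 p.2) * φ p)) (Ioi (0 : ℝ) ×ˢ univ) := by
    obtain ⟨B, hB⟩ := hasCompactSupport_deriv_smoothStep.exists_bound_of_continuous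
      continuous_deriv_smoothStep
    refine (hu.integrableOn_mul hη.continuous hφ).mul_of_bound (C := |δ⁻¹| * B)
      measurableSet_upper ?_ fun p _ => ?_
    · exact measurable_const.mul (continuous_deriv_smoothStep.measurable.comp
        (measurable_fst.div_const _))
    · rw [abs_mul]
      exact mul_le_mul_of_nonneg_left (hB _) (abs_nonneg _)
  rw [← integral_add i1 i2]
  refine hent.trans (le_of_eq (integral_congr_ae (ae_of_all _ fun p => ?_)))
  simp only [hd]
  ring

end

/-! ### Mollification of convex entropies -/

section Mollification

open scoped Convolution

/-- Mollification of a function on a normed space by a smooth bump function. -/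
noncomputable def mollify {E : Type*} [NormedAddCommGroup E] [NormedSpace ℝ E]
    [FiniteDimensional ℝ E] [MeasureSpace E] [BorelSpace E] (ρ : ContDiffBump (0 : E))
    (g : E → ℝ) : E → ℝ :=
  ρ.normed volume ⋆[ContinuousLinearMap.lsmul ℝ ℝ, volume] g

/-- A standard sequence of bump functions. -/
noncomputable def bumpSeq (E : Type*) [NormedAddCommGroup E] (n : ℕ) : ContDiffBump (0 : E) :=
  ⟨1 / (2 * ((n : ℝ) + 1)), 1 / ((n : ℝ) + 1), by positivity, by
    rw [div_lt_div_iff₀ (by positivity) (by positivity)]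
    have : (0 : ℝ) ≤ n := n.cast_nonneg
    linarith⟩

theorem bumpSeq_rOut {E : Type*} [NormedAddCommGroup E] (n : ℕ) :
    (bumpSeq E n).rOut = 1 / ((n : ℝ) + 1) := rfl

theorem tendsto_bumpSeq_rOut (E : Type*) [NormedAddCommGroup E] :
    Tendsto (fun n => (bumpSeq E n).rOut) atTop (𝓝 0) :=
  tendsto_one_div_add_atTop_nhds_zero_nat

theorem mollify_apply {E : Type*} [NormedAddCommGroup E] [NormedSpace ℝ E]
    [FiniteDimensional ℝ E] [MeasureSpace E] [BorelSpace E] (ρ : ContDiffBump (0 : E))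
    (g : E → ℝ) (x : E) : mollify ρ g x = ∫ s, ρ.normed volume s * g (x - s) := rfl

variable {η : ℝ → ℝ}

theorem integrable_mollify (hη : Continuous η) (ρ : ContDiffBump (0 : ℝ)) (x : ℝ) :
    Integrable (fun s => ρ.normed volume s * η (x - s)) := by
  refine Continuous.integrable_of_hasCompactSupport ?_ ?_
  · exact ρ.continuous_normed.mul (hη.comp (by fun_prop))
  · exact ρ.hasCompactSupport_normed.mul_right

theorem mollify_contDiff (hη : Continuous η) (ρ : ContDiffBump (0 : ℝ)) :
    ContDiff ℝ 2 (mollify ρ η) :=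
  ρ.hasCompactSupport_normed.contDiff_convolution_left _ ρ.contDiff_normed hη.locallyIntegrable

theorem mollify_convexOn (hη : ConvexOn ℝ univ η) (ρ : ContDiffBump (0 : ℝ)) :
    ConvexOn ℝ univ (mollify ρ η) := by
  have hc := hη.continuous_real
  refine ⟨convex_univ, fun x _ y _ a b ha hb hab => ?_⟩
  simp only [mollify_apply, smul_eq_mul]
  rw [← integral_const_mul, ← integral_const_mul,
    ← integral_add ((integrable_mollify hc ρ x).const_mul a)
      ((integrable_mollify hc ρ y).const_mul b)]
  refine integral_mono (integrable_mollify hc ρ _)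
    (((integrable_mollify hc ρ x).const_mul a).add ((integrable_mollify hc ρ y).const_mul b))
    fun s => ?_
  have h := hη.2 (mem_univ (x - s)) (mem_univ (y - s)) ha hb hab
  simp only [smul_eq_mul] at h
  have e : a * (x - s) + b * (y - s) = a * x + b * y - s := by linear_combination (-s) * hab
  rw [e] at h
  have := mul_le_mul_of_nonneg_left h (ρ.nonneg_normed (μ := volume) s)
  linarith

theorem mollify_bumpSeq_tendsto (hη : Continuous η) (x : ℝ) :
    Tendsto (fun n => mollify (bumpSeq ℝ n) η x) atTop (𝓝 (η x)) :=
  ContDiffBump.convolution_tendsto_right_of_continuous (tendsto_bumpSeq_rOut ℝ) hη x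

theorem mollify_bumpSeq_bound (hη : Continuous η) (M : ℝ) :
    ∃ C, 0 ≤ C ∧ ∀ n x, |x| ≤ M → |mollify (bumpSeq ℝ n) η x| ≤ C := by
  -- All mollification radii are at most one, so only values on `[-(M+1), M+1]` enter.
  obtain ⟨C, hC0, hC⟩ := exists_bound_of_continuous hη (M + 1)
  refine ⟨3 * C, by positivity, fun n x hx => ?_⟩
  have hr : (bumpSeq ℝ n).rOut ≤ 1 := by
    rw [bumpSeq_rOut, div_le_one (by positivity)]
    have : (0 : ℝ) ≤ n := n.cast_nonneg
    linarith
  have h := ContDiffBump.dist_normed_convolution_le (φ := bumpSeq ℝ n) (μ := volume) (x₀ := x)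
    (ε := 2 * C) hη.aestronglyMeasurable (fun y hy => by
      have hy1 : |y - x| < 1 := (mem_ball_iff_norm.1 hy).trans_le hr
      have hy2 : |y| ≤ M + 1 := by
        have := abs_add_le (y - x) x
        rw [sub_add_cancel] at this
        linarith
      have h1 := hC y hy2
      have h2 := hC x (by linarith)
      rw [Real.dist_eq]
      have := abs_sub (η y) (η x)
      linarith)
  rw [Real.dist_eq] at h
  have h3 := hC x (by linarith)
  have h4 := abs_add_le (mollify (bumpSeq ℝ n) η x - η x) (η x)
  rw [sub_add_cancel] at h4
  have h5 : |mollify (bumpSeq ℝ n) η x - η x| ≤ 2 * C := h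
  linarith

end Mollification

/-! ### Entropy inequalities for arbitrary convex entropies -/

section

variable {u₀ : ℝ → ℝ} {u : ℝ → ℝ → ℝ}

/-- The entropy functional is stable under bounded pointwise convergence of the pair. -/
theorem tendsto_entropyFunctional {F : ℝ → ℝ} (hu : IsEntropySolution F u₀ u) {η Q : ℝ → ℝ}
    {ηn Qn : ℕ → ℝ → ℝ} (hη : ∀ n, Continuous (ηn n)) (hQ : ∀ n, Continuous (Qn n))
    (hηt : ∀ v, Tendsto (fun n => ηn n v) atTop (𝓝 (η v)))
    (hQt : ∀ v, Tendsto (fun n => Qn n v) atTop (𝓝 (Q v)))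
    (hb : ∀ M, ∃ C, ∀ n v, |v| ≤ M → |ηn n v| ≤ C ∧ |Qn n v| ≤ C)
    {φ : ℝ × ℝ → ℝ} (hφ : IsTestFunction φ) :
    Tendsto (fun n => entropyFunctional u (ηn n) (Qn n) φ) atTop
      (𝓝 (entropyFunctional u η Q φ)) := by
  obtain ⟨M, hM1, hM⟩ := hu.exists_bound
  obtain ⟨C, hC⟩ := hb M
  refine Tendsto.add ?_ ?_
  · refine tendsto_integral_of_dominated_convergence
      (fun p => C * |fderiv ℝ φ p (1, 0)| + C * |fderiv ℝ φ p (0, 1)|) ?_ ?_ ?_ ?_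
    · exact fun n => (hu.integrableOn_integrand (hη n) (hQ n) hφ).aestronglyMeasurable
    · have i := fun v => ((hφ.fderiv_apply v).integrable volume).abs.const_mul C
      exact ((i _).add (i _)).integrableOn
    · refine fun n => (ae_restrict_iff' measurableSet_upper).2 (ae_of_all _ fun p hp => ?_)
      have h := hC n _ (hM p.1 p.2 (le_of_lt hp.1))
      refine (norm_add_le _ _).trans ?_
      rw [norm_mul, norm_mul]
      exact add_le_add (mul_le_mul_of_nonneg_right h.1 (abs_nonneg _))
        (mul_le_mul_of_nonneg_right h.2 (abs_nonneg _))
    · exact ae_of_all _ fun p => ((hηt _).mul_const _).add ((hQt _).mul_const _)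
  · have hs := hφ.slice (0 : ℝ)
    refine tendsto_integral_of_dominated_convergence (fun x => C * |φ (0, x)|) ?_ ?_ ?_ ?_
    · exact fun n => (hu.integrable_slice_mul (hη n) hs le_rfl).aestronglyMeasurable
    · exact (hs.integrable volume).abs.const_mul C
    · refine fun n => ae_of_all _ fun x => ?_
      rw [norm_mul]
      exact mul_le_mul_of_nonneg_right (hC n _ (hM 0 x le_rfl)).1 (abs_nonneg _)
    · exact ae_of_all _ fun x => (hηt _).mul_const _

/-- The entropy inequality for all convex entropies. -/
theorem IsEntropySolution.entropyFunctional_nonneg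
    (hu : IsEntropySolution (fun v => v ^ 2 / 2) u₀ u) {η Q : ℝ → ℝ} (h : IsEntropyPair η Q)
    {φ : ℝ × ℝ → ℝ} (hφ : IsTestFunction φ) (h0 : ∀ p, 0 ≤ φ p) :
    0 ≤ entropyFunctional u η Q φ := by
  obtain ⟨a, ha⟩ := h.2
  have hη := h.continuous_left
  let ηn : ℕ → ℝ → ℝ := fun n => mollify (bumpSeq ℝ n) η
  have hηn : ∀ n, ContDiff ℝ 2 (ηn n) := fun n => mollify_contDiff hη _
  let Qn : ℕ → ℝ → ℝ := fun n v => Q a + v * ηn n v - a * ηn n a - ∫ s in a..v, ηn n s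
  have hQn : ∀ n v, HasDerivAt (Qn n) (deriv (ηn n) v * v) v := by
    intro n v
    have h1 : HasDerivAt (ηn n) (deriv (ηn n) v) v :=
      ((hηn n).differentiable (by norm_num) v).hasDerivAt
    have h2 : HasDerivAt (fun x => ∫ s in a..x, ηn n s) (ηn n v) v :=
      intervalIntegral.integral_hasDerivAt_right ((hηn n).continuous.intervalIntegrable _ _)
        ((hηn n).continuous.stronglyMeasurableAtFilter _ _) (hηn n).continuous.continuousAt
    have h3 : HasDerivAt (Qn n) (1 * ηn n v + v * deriv (ηn n) v - ηn n v) v :=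
      ((((hasDerivAt_id v).mul h1).const_add (Q a)).sub_const (a * ηn n a)).sub h2
    exact h3.congr_deriv (by ring)
  have hF : ∀ v : ℝ, deriv (fun v : ℝ => v ^ 2 / 2) v = v := by
    intro v
    have := ((hasDerivAt_pow 2 v).div_const 2).deriv
    rw [this]
    simp
  have hlim : Tendsto (fun n => entropyFunctional u (ηn n) (Qn n) φ) atTop
      (𝓝 (entropyFunctional u η Q φ)) := by
    refine tendsto_entropyFunctional hu (fun n => (hηn n).continuous)
      (fun n => continuous_iff_continuousAt.2 fun v => (hQn n v).continuousAt)
      (mollify_bumpSeq_tendsto hη) ?_ ?_ hφ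
    · intro v
      have e : Q v = Q a + v * η v - a * η a - ∫ s in a..v, η s := by linarith [ha v]
      rw [e]
      obtain ⟨C, hC0, hC⟩ := mollify_bumpSeq_bound hη (max |a| |v|)
      have hi : Tendsto (fun n => ∫ s in a..v, ηn n s) atTop (𝓝 (∫ s in a..v, η s)) := by
        refine intervalIntegral.tendsto_integral_filter_of_dominated_convergence (fun _ => C)
          (Eventually.of_forall fun n => (hηn n).continuous.aestronglyMeasurable)
          (Eventually.of_forall fun n => ae_of_all _ fun s hs => hC n s ?_) (by simp)
          (ae_of_all _ fun s _ => mollify_bumpSeq_tendsto hη s)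
        have := abs_le_max_abs_abs (uIoc_subset_uIcc hs).1 (uIoc_subset_uIcc hs).2
        refine this.trans (max_le ?_ ?_)
        · rcases min_choice a v with h | h <;> rw [h]
          exacts [le_max_left _ _, le_max_right _ _]
        · rcases max_choice a v with h | h <;> rw [h]
          exacts [le_max_left _ _, le_max_right _ _]
      exact ((tendsto_const_nhds.add ((mollify_bumpSeq_tendsto hη v).const_mul v)).sub
        ((mollify_bumpSeq_tendsto hη a).const_mul a)).sub hi
    · intro M
      obtain ⟨C, hC0, hC⟩ := mollify_bumpSeq_bound hη (max |a| M)
      have key : ∀ n v, |v| ≤ M → |Qn n v| ≤ |Q a| + M * C + |a| * C + C * (M + |a|) := by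
        intro n v hv
        have hM0 : 0 ≤ M := (abs_nonneg v).trans hv
        have b1 := hC n v (hv.trans (le_max_right _ _))
        have b2 := hC n a (le_max_left _ _)
        have b3 : ‖∫ s in a..v, ηn n s‖ ≤ C * |v - a| := by
          refine intervalIntegral.norm_integral_le_of_norm_le_const fun s hs => ?_
          refine hC n s ?_
          have := abs_le_max_abs_abs (uIoc_subset_uIcc hs).1 (uIoc_subset_uIcc hs).2
          refine this.trans (max_le ?_ ?_)
          · rcases min_choice a v with h | h <;> rw [h]
            exacts [le_max_left _ _, hv.trans (le_max_right _ _)]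
          · rcases max_choice a v with h | h <;> rw [h]
            exacts [le_max_left _ _, hv.trans (le_max_right _ _)]
        rw [Real.norm_eq_abs] at b3
        have b4 : C * |v - a| ≤ C * (M + |a|) :=
          mul_le_mul_of_nonneg_left ((abs_sub _ _).trans (by linarith)) hC0
        have b5 : |v * ηn n v| ≤ M * C := by
          rw [abs_mul]
          exact mul_le_mul hv b1 (abs_nonneg _) hM0
        have b6 : |a * ηn n a| ≤ |a| * C := by
          rw [abs_mul]
          exact mul_le_mul_of_nonneg_left b2 (abs_nonneg _)
        have c1 := abs_sub (Q a + v * ηn n v - a * ηn n a) (∫ s in a..v, ηn n s)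
        have c2 := abs_sub (Q a + v * ηn n v) (a * ηn n a)
        have c3 := abs_add_le (Q a) (v * ηn n v)
        have : Qn n v = Q a + v * ηn n v - a * ηn n a - ∫ s in a..v, ηn n s := rfl
        rw [this]
        linarith
      refine ⟨max C (|Q a| + M * C + |a| * C + C * (M + |a|)), fun n v hv => ⟨?_, ?_⟩⟩
      · exact (hC n v (hv.trans (le_max_right _ _))).trans (le_max_left _ _)
      · exact (key n v hv).trans (le_max_right _ _)
  refine ge_of_tendsto' hlim fun n => hu.entropyFunctional_nonneg_of_contDiff (hηn n)
    (mollify_convexOn h.1 _) (fun v => ?_) hφ h0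
  rw [hF]
  exact hQn n v

/-- Carries identities known for nonnegative test functions over to all of them; the summand is a
large multiple of a cut-off. -/
theorem IsTestFunction.exists_sub_nonneg {E : Type*} [NormedAddCommGroup E] [NormedSpace ℝ E]
    [FiniteDimensional ℝ E] {φ : E → ℝ} (hφ : IsTestFunction φ) :
    ∃ ψ χ : E → ℝ, IsTestFunction ψ ∧ IsTestFunction χ ∧ (∀ p, 0 ≤ ψ p) ∧ (∀ p, 0 ≤ χ p) ∧
      ∀ p, ψ p = φ p + χ p := by
  obtain ⟨θ, hθ, h0, -, h1⟩ := exists_isTestFunction_eq_one hφ.2.isCompact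
  obtain ⟨C, hC0, hC⟩ := hφ.exists_bound
  refine ⟨_, _, hφ.add (hθ.const_mul C), hθ.const_mul C, fun p => ?_,
    fun p => mul_nonneg hC0 (h0 p), fun p => rfl⟩
  by_cases hp : p ∈ tsupport φ
  · rw [h1 p hp]
    linarith [neg_le_of_abs_le (hC p)]
  · rw [image_eq_zero_of_notMem_tsupport hp, zero_add]
    exact mul_nonneg hC0 (h0 p)

theorem entropyFunctional_neg_pair (u : ℝ → ℝ → ℝ) (η Q : ℝ → ℝ) (φ : ℝ × ℝ → ℝ) :
    entropyFunctional u (fun v => -η v) (fun v => -Q v) φ = -entropyFunctional u η Q φ := by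
  unfold entropyFunctional
  simp_rw [neg_mul, ← neg_add, integral_neg]
  ring

/-- If both `(η, Q)` and `(-η, -Q)` are entropy pairs, there is no entropy production. -/
theorem IsEntropySolution.entropyFunctional_eq_zero
    (hu : IsEntropySolution (fun v => v ^ 2 / 2) u₀ u) {η Q : ℝ → ℝ} (h : IsEntropyPair η Q)
    (h' : IsEntropyPair (fun v => -η v) (fun v => -Q v))
    {φ : ℝ × ℝ → ℝ} (hφ : IsTestFunction φ) : entropyFunctional u η Q φ = 0 := by
  have key : ∀ ψ, IsTestFunction ψ → (∀ p, 0 ≤ ψ p) → entropyFunctional u η Q ψ = 0 := by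
    intro ψ hψ h0
    refine le_antisymm ?_ (hu.entropyFunctional_nonneg h hψ h0)
    have := hu.entropyFunctional_nonneg h' hψ h0
    rw [entropyFunctional_neg_pair] at this
    linarith
  obtain ⟨ψ, χ, hψ, hχ, hψ0, hχ0, e⟩ := hφ.exists_sub_nonneg
  have h1 := key ψ hψ hψ0
  rw [funext e, entropyFunctional_add hu h.continuous_left h.continuous_right hφ hχ,
    key χ hχ hχ0, add_zero] at h1
  exact h1

end

/-! ### Kružkov half entropies and the kinetic entropies -/

theorem IsEntropyPair.sub_eq {η Q : ℝ → ℝ} (h : IsEntropyPair η Q) (b c : ℝ) :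
    Q c - Q b = c * η c - b * η b - ∫ s in b..c, η s := by
  obtain ⟨a, ha⟩ := h.2
  have hi := fun x y => h.continuous_left.intervalIntegrable (μ := volume) x y
  have := intervalIntegral.integral_add_adjacent_intervals (hi a b) (hi b c)
  linarith [ha b, ha c]

theorem IsEntropyPair.add {η Q η' Q' : ℝ → ℝ} (h : IsEntropyPair η Q) (h' : IsEntropyPair η' Q') :
    IsEntropyPair (fun v => η v + η' v) (fun v => Q v + Q' v) := by
  refine ⟨h.1.add h'.1, 0, fun v => ?_⟩
  rw [intervalIntegral.integral_add (h.continuous_left.intervalIntegrable _ _)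
    (h'.continuous_left.intervalIntegrable _ _)]
  linarith [h.sub_eq 0 v, h'.sub_eq 0 v]

theorem isEntropyPair_linear (c d : ℝ) :
    IsEntropyPair (fun v => c * v) (fun v => c * (v ^ 2 / 2) + d) := by
  refine ⟨((LinearMap.mul ℝ ℝ c).convexOn convex_univ), 0, fun v => ?_⟩
  rw [intervalIntegral.integral_const_mul, integral_id]
  ring

theorem isEntropyPair_posPart (w : ℝ) :
    IsEntropyPair (fun v => max (v - w) 0) (fun v => if w ≤ v then (v ^ 2 - w ^ 2) / 2 else 0) := by
  refine ⟨((convexOn_id convex_univ).sub (concaveOn_const w convex_univ)).sup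
    (convexOn_const 0 convex_univ), w, fun v => ?_⟩
  rcases le_total w v with h | h
  · have : ∫ s in w..v, max (s - w) 0 = ∫ s in w..v, (s - w) := by
      refine intervalIntegral.integral_congr fun s hs => ?_
      rw [uIcc_of_le h] at hs
      exact max_eq_left (by linarith [hs.1])
    rw [this, intervalIntegral.integral_sub intervalIntegral.intervalIntegrable_id (by simp),
      integral_id]
    simp [h]
    ring
  · have : ∫ s in w..v, max (s - w) 0 = ∫ s in w..v, (0 : ℝ) := by
      refine intervalIntegral.integral_congr fun s hs => ?_
      rw [uIcc_of_ge h] at hs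
      exact max_eq_right (by linarith [hs.2])
    rw [this]
    rcases h.eq_or_lt with rfl | h'
    · simp
    · simp [h, not_le.2 h']

theorem isEntropyPair_negPart (w : ℝ) :
    IsEntropyPair (fun v => max (w - v) 0) (fun v => if v < w then (w ^ 2 - v ^ 2) / 2 else 0) := by
  refine ⟨((convexOn_const w convex_univ).sub (concaveOn_id convex_univ)).sup
    (convexOn_const 0 convex_univ), w, fun v => ?_⟩
  rcases le_or_gt w v with h | h
  · have : ∫ s in w..v, max (w - s) 0 = ∫ s in w..v, (0 : ℝ) := by
      refine intervalIntegral.integral_congr fun s hs => ?_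
      rw [uIcc_of_le h] at hs
      exact max_eq_right (by linarith [hs.1])
    rw [this]
    simp [h, not_lt.2 h]
  · have : ∫ s in w..v, max (w - s) 0 = ∫ s in w..v, (w - s) := by
      refine intervalIntegral.integral_congr fun s hs => ?_
      rw [uIcc_of_ge h.le] at hs
      exact max_eq_left (by linarith [hs.2])
    rw [this, intervalIntegral.integral_sub (by simp) intervalIntegral.intervalIntegrable_id,
      integral_id]
    simp [h, h.le]
    ring

/-- The indicator of the hypograph, as in the kinetic formulation. -/
noncomputable def signedIndicator (w v : ℝ) : ℝ :=
  if 0 < w ∧ w ≤ v then 1 else if v < w ∧ w ≤ 0 then -1 else 0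

theorem kineticFn_eq {n : ℕ} (u : Pt n → ℝ) (w : ℝ) (z : Pt n) :
    kineticFn u w z = signedIndicator w (u z) := rfl

theorem measurable_signedIndicator : Measurable (Function.uncurry signedIndicator) := by
  refine Measurable.ite ?_ measurable_const (Measurable.ite ?_ measurable_const measurable_const)
  · exact (measurableSet_lt measurable_const measurable_fst).inter
      (measurableSet_le measurable_fst measurable_snd)
  · exact (measurableSet_lt measurable_snd measurable_fst).inter
      (measurableSet_le measurable_fst measurable_const)

theorem abs_signedIndicator_le (w v : ℝ) : |signedIndicator w v| ≤ 1 := by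
  unfold signedIndicator
  split_ifs <;> simp

theorem signedIndicator_eq_zero {w v : ℝ} (h : |v| < |w|) : signedIndicator w v = 0 := by
  unfold signedIndicator
  rw [if_neg, if_neg]
  · rintro ⟨h1, h2⟩
    rw [abs_of_nonpos h2, abs_of_neg (h1.trans_le h2)] at h
    linarith
  · rintro ⟨h1, h2⟩
    rw [abs_of_pos h1, abs_of_pos (h1.trans_le h2)] at h
    linarith

theorem integral_signedIndicator_mul (v : ℝ) (G : ℝ → ℝ) :
    ∫ w, signedIndicator w v * G w = ∫ w in (0 : ℝ)..v, G w := by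
  rcases le_or_gt 0 v with hv | hv
  · rw [intervalIntegral.integral_of_le hv, ← integral_indicator measurableSet_Ioc]
    congr 1
    funext w
    unfold signedIndicator
    by_cases h : w ∈ Ioc 0 v
    · rw [indicator_of_mem h, if_pos (mem_Ioc.1 h), one_mul]
    · rw [indicator_of_notMem h, if_neg (fun h' => h (mem_Ioc.2 h')), if_neg, zero_mul]
      rintro ⟨h1, h2⟩
      linarith
  · rw [intervalIntegral.integral_of_ge hv.le, ← integral_indicator measurableSet_Ioc,
      ← integral_neg]
    congr 1
    funext w
    unfold signedIndicator
    rw [if_neg (by rintro ⟨h1, h2⟩; linarith)]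
    by_cases h : w ∈ Ioc v 0
    · rw [indicator_of_mem h, if_pos (mem_Ioc.1 h), neg_one_mul]
    · rw [indicator_of_notMem h, if_neg (fun h' => h (mem_Ioc.2 h')), zero_mul, neg_zero]

/-- The entropy with second derivative `δ_w`, normalised at `0`, and its flux. -/
noncomputable def kinEntropy (w v : ℝ) : ℝ := signedIndicator w v * (v - w)

noncomputable def kinFlux (w v : ℝ) : ℝ := signedIndicator w v * ((v ^ 2 - w ^ 2) / 2)

/-- For `w > 0` this is the pair of `max (v - w) 0`, for `w ≤ 0` that of `max (w - v) 0`. The two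
entropies differ by an affine function, and switching at `w = 0` makes them vanish for `|w| > |v|`,
so that only a bounded range of `w` contributes for a bounded solution. -/
theorem isEntropyPair_kin (w : ℝ) : IsEntropyPair (kinEntropy w) (kinFlux w) := by
  rcases lt_or_ge 0 w with hw | hw
  · convert isEntropyPair_posPart w using 1
    · funext v
      unfold kinEntropy signedIndicator
      by_cases h : w ≤ v
      · simp [hw, h]
      · rw [if_neg (fun h' => h h'.2), if_neg (fun h' => by linarith [h'.2])]
        simp [(not_le.1 h).le]
    · funext v
      unfold kinFlux signedIndicator
      by_cases h : w ≤ v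
      · simp [hw, h]
      · rw [if_neg (fun h' => h h'.2), if_neg (fun h' => by linarith [h'.2])]
        simp [h]
  · convert isEntropyPair_negPart w using 1
    · funext v
      unfold kinEntropy signedIndicator
      rw [if_neg (fun h' => by linarith [h'.1])]
      by_cases h : v < w
      · simp [hw, h, h.le]
      · rw [if_neg (fun h' => h h'.1)]
        simp [not_lt.1 h]
    · funext v
      unfold kinFlux signedIndicator
      rw [if_neg (fun h' => by linarith [h'.1])]
      by_cases h : v < w
      · simp [hw, h]
        ring
      · rw [if_neg (fun h' => h h'.1)]
        simp [h]

theorem measurable_kinEntropy : Measurable (Function.uncurry kinEntropy) :=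
  measurable_signedIndicator.mul (measurable_snd.sub measurable_fst)

theorem measurable_kinFlux : Measurable (Function.uncurry kinFlux) :=
  measurable_signedIndicator.mul
    (((measurable_snd.pow_const 2).sub (measurable_fst.pow_const 2)).div_const 2)

theorem abs_kinEntropy_le {w v M : ℝ} (hv : |v| ≤ M) : |kinEntropy w v| ≤ 2 * M := by
  unfold kinEntropy
  rcases lt_or_ge |v| |w| with h | h
  · rw [signedIndicator_eq_zero h, zero_mul, abs_zero]
    linarith [abs_nonneg v]
  · rw [abs_mul]
    have h1 := abs_signedIndicator_le w v
    have h2 : |v - w| ≤ 2 * M := (abs_sub _ _).trans (by linarith)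
    calc _ ≤ 1 * (2 * M) := mul_le_mul h1 h2 (abs_nonneg _) zero_le_one
      _ = 2 * M := one_mul _

theorem abs_kinFlux_le {w v M : ℝ} (hv : |v| ≤ M) : |kinFlux w v| ≤ M ^ 2 := by
  unfold kinFlux
  rcases lt_or_ge |v| |w| with h | h
  · rw [signedIndicator_eq_zero h, zero_mul, abs_zero]
    positivity
  · rw [abs_mul]
    have h1 := abs_signedIndicator_le w v
    have h3 : v ^ 2 ≤ M ^ 2 := sq_le_sq' (by linarith [(abs_le.1 hv).1]) (abs_le.1 hv).2
    have h4 : w ^ 2 ≤ v ^ 2 := sq_le_sq.2 h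
    have h2 : |(v ^ 2 - w ^ 2) / 2| ≤ M ^ 2 := by
      rw [abs_le]
      constructor <;> nlinarith [sq_nonneg w, sq_nonneg v]
    calc _ ≤ 1 * M ^ 2 := mul_le_mul h1 h2 (abs_nonneg _) zero_le_one
      _ = M ^ 2 := one_mul _

theorem kinEntropy_eq_zero {w v : ℝ} (h : |v| < |w|) : kinEntropy w v = 0 := by
  rw [kinEntropy, signedIndicator_eq_zero h, zero_mul]

theorem kinFlux_eq_zero {w v : ℝ} (h : |v| < |w|) : kinFlux w v = 0 := by
  rw [kinFlux, signedIndicator_eq_zero h, zero_mul]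

/-- Integration by parts between `0` and `v`. The boundary term at `w = v` drops out because `k v =
0`; the one at `w = 0` remains. -/
theorem integral_signedIndicator_mul_deriv {k k' g : ℝ → ℝ} {v : ℝ}
    (hk : ∀ w, HasDerivAt k (k' w) w) (hk' : Continuous k') (hv : k v = 0)
    (hg : IsTestFunction g) :
    ∫ w, signedIndicator w v * k w * deriv g w =
      -(k 0 * g 0) - ∫ w, signedIndicator w v * (k' w * g w) := by
  simp_rw [mul_assoc]
  rw [integral_signedIndicator_mul v (fun w => k w * deriv g w),
    integral_signedIndicator_mul v (fun w => k' w * g w)]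
  have hgd : Continuous (deriv g) := hg.1.continuous_deriv (by simp)
  rw [intervalIntegral.integral_mul_deriv_eq_deriv_mul (fun w _ => hk w)
    (fun w _ => (hg.differentiable w).hasDerivAt) (hk'.intervalIntegrable _ _)
    (hgd.intervalIntegrable _ _), hv]
  ring

theorem integral_kinEntropy_mul_deriv (v : ℝ) {g : ℝ → ℝ} (hg : IsTestFunction g) :
    ∫ w, kinEntropy w v * deriv g w = -(v * g 0) + ∫ w, signedIndicator w v * g w := by
  have := integral_signedIndicator_mul_deriv (k := fun w => v - w) (k' := fun _ => -1) (v := v)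
    (fun w => (hasDerivAt_id w).const_sub v) continuous_const (sub_self v) hg
  simp only [neg_mul, one_mul, mul_neg, integral_neg, sub_zero, sub_neg_eq_add] at this
  exact this

theorem integral_kinFlux_mul_deriv (v : ℝ) {g : ℝ → ℝ} (hg : IsTestFunction g) :
    ∫ w, kinFlux w v * deriv g w =
      -(v ^ 2 / 2 * g 0) + ∫ w, signedIndicator w v * (w * g w) := by
  have := integral_signedIndicator_mul_deriv (k := fun w => (v ^ 2 - w ^ 2) / 2)
    (k' := fun w => -w) (v := v) (fun w => by
      refine (((hasDerivAt_pow 2 w).const_sub (v ^ 2)).div_const 2).congr_deriv ?_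
      simp
      ring) continuous_neg (by simp) hg
  simp only [neg_mul, mul_neg, integral_neg, sub_neg_eq_add] at this
  have e : (v ^ 2 - 0 ^ 2) / 2 = v ^ 2 / 2 := by ring
  rw [e] at this
  exact this

/-- The bound on `v` is only required almost everywhere, since an entropy solution is controlled for
`t ≥ 0` alone and the measure is a restricted one. -/
theorem integrable_prod_mul {α : Type*} [MeasurableSpace α] {μ : Measure α} [SFinite μ]
    {v : α → ℝ} (hv : Measurable v) {M C : ℝ} (hM : ∀ᵐ z ∂μ, |v z| ≤ M) {k : ℝ → ℝ → ℝ}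
    (hk : Measurable (Function.uncurry k)) (hC : ∀ w a, |a| ≤ M → |k w a| ≤ C) {ψ : ℝ × α → ℝ}
    (hψ : Integrable ψ (volume.prod μ)) :
    Integrable (fun p : ℝ × α => k p.1 (v p.2) * ψ p) (volume.prod μ) := by
  refine hψ.bdd_mul (c := C)
    (hk.comp (measurable_fst.prodMk (hv.comp measurable_snd))).aestronglyMeasurable ?_
  have : ∀ᵐ p ∂((volume : Measure ℝ).prod μ), |v p.2| ≤ M :=
    Measure.quasiMeasurePreserving_snd.ae hM
  filter_upwards [this] with p hp using hC _ _ hp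

theorem fderiv_slice {E F : Type*} [NormedAddCommGroup E] [NormedSpace ℝ E]
    [NormedAddCommGroup F] [NormedSpace ℝ F] {φ : E × F → ℝ} (hφ : IsTestFunction φ) (w : E)
    (z v : F) : fderiv ℝ (fun z => φ (w, z)) z v = fderiv ℝ φ (w, z) (0, v) := by
  have h : HasFDerivAt (fun z : F => (w, z)) (ContinuousLinearMap.inr ℝ E F) z :=
    hasFDerivAt_prodMk_right w z
  have := ((hφ.differentiable (w, z)).hasFDerivAt.comp z h).fderiv
  rw [show (fun z => φ (w, z)) = φ ∘ fun z => (w, z) from rfl, this]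
  simp

theorem deriv_slice {F : Type*} [NormedAddCommGroup F] [NormedSpace ℝ F] {φ : ℝ × F → ℝ}
    (hφ : IsTestFunction φ) (w : ℝ) (z : F) :
    deriv (fun w => φ (w, z)) w = fderiv ℝ φ (w, z) (1, 0) := by
  have h : HasFDerivAt (fun w : ℝ => (w, z)) (ContinuousLinearMap.inl ℝ ℝ F) w :=
    hasFDerivAt_prodMk_left w z
  have := ((hφ.differentiable (w, z)).hasFDerivAt.comp w h).hasDerivAt.deriv
  rw [show (fun w => φ (w, z)) = φ ∘ fun w => (w, z) from rfl, this]
  simp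

/-- Symmetry of the second derivative. It exchanges the derivative in the kinetic variable with
those in `(t, x)` before the integration by parts, and it gives `∂ₜ∂ₓV = ∂ₓ∂ₜV` for the mollified
value function. -/
theorem ContDiff.fderiv_apply_comm {E : Type*} [NormedAddCommGroup E] [NormedSpace ℝ E]
    {φ : E → ℝ} (hφ : ContDiff ℝ ∞ φ) (p a b : E) :
    fderiv ℝ (fun q => fderiv ℝ φ q a) p b = fderiv ℝ (fun q => fderiv ℝ φ q b) p a := by
  have hd : Differentiable ℝ (fderiv ℝ φ) :=
    (hφ.fderiv_right (m := 1) (by norm_cast)).differentiable (by simp)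
  have h : ∀ c, fderiv ℝ (fun q => fderiv ℝ φ q c) p = (fderiv ℝ (fderiv ℝ φ) p).flip c := by
    intro c
    have := ((ContinuousLinearMap.apply ℝ ℝ c).hasFDerivAt.comp p (hd p).hasFDerivAt).fderiv
    exact this
  rw [h, h]
  exact (hφ.contDiffAt.isSymmSndFDerivAt (by
    rw [minSmoothness_of_isRCLikeNormedField]
    exact WithTop.coe_le_coe.2 le_top)).eq b a

/-! ### The kinetic measure of an entropy solution -/

/-- The kinetic transport term on the half plane `t > 0`, including the initial trace. -/
noncomputable def kineticPairing (u : ℝ → ℝ → ℝ) (φ : ℝ × ℝ × ℝ → ℝ) : ℝ :=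
  (∫ z in Ioi (0 : ℝ) ×ˢ (univ : Set ℝ), ∫ w, signedIndicator w (u z.1 z.2) *
    (fderiv ℝ φ (w, z) (0, (1, 0)) + w * fderiv ℝ φ (w, z) (0, (0, 1)))) +
  ∫ x, ∫ w, signedIndicator w (u 0 x) * φ (w, (0, x))

section

variable {u₀ : ℝ → ℝ} {u : ℝ → ℝ → ℝ} {F : ℝ → ℝ}

theorem IsEntropySolution.integrable_kin (hu : IsEntropySolution F u₀ u) {k : ℝ → ℝ → ℝ}
    (hk : Measurable (Function.uncurry k)) (hC : ∀ M, ∃ C, ∀ w a, |a| ≤ M → |k w a| ≤ C)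
    {ψ : ℝ × ℝ × ℝ → ℝ} (hψ : IsTestFunction ψ) :
    Integrable (fun p : ℝ × ℝ × ℝ => k p.1 (u p.2.1 p.2.2) * ψ p)
      (volume.prod (volume.restrict (Ioi (0 : ℝ) ×ˢ (univ : Set ℝ)))) := by
  obtain ⟨M, -, hM⟩ := hu.exists_bound
  obtain ⟨C, hC⟩ := hC M
  exact integrable_prod_mul (v := fun z : ℝ × ℝ => u z.1 z.2) hu.measurable
    ((ae_restrict_iff' measurableSet_upper).2 (ae_of_all _ fun z hz => hM _ _ (le_of_lt hz.1)))
    hk hC (hψ.integrable _)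

theorem IsTestFunction.trace {ψ : ℝ × ℝ × ℝ → ℝ} (hψ : IsTestFunction ψ) :
    IsTestFunction (fun p : ℝ × ℝ => ψ (p.1, (0, p.2))) := by
  refine hψ.comp_isClosedEmbedding (contDiff_fst.prodMk (contDiff_const.prodMk contDiff_snd)) ?_
  have hl : Function.LeftInverse (fun q : ℝ × ℝ × ℝ => (q.1, q.2.2))
      (fun p : ℝ × ℝ => (p.1, ((0 : ℝ), p.2))) := fun p => rfl
  exact hl.isClosedEmbedding (by fun_prop) (by fun_prop)

theorem IsEntropySolution.integrable_kin_trace (hu : IsEntropySolution F u₀ u) {k : ℝ → ℝ → ℝ}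
    (hk : Measurable (Function.uncurry k)) (hC : ∀ M, ∃ C, ∀ w a, |a| ≤ M → |k w a| ≤ C)
    {ψ : ℝ × ℝ × ℝ → ℝ} (hψ : IsTestFunction ψ) :
    Integrable (fun p : ℝ × ℝ => k p.1 (u 0 p.2) * ψ (p.1, (0, p.2)))
      ((volume : Measure ℝ).prod (volume : Measure ℝ)) := by
  obtain ⟨M, -, hM⟩ := hu.exists_bound
  obtain ⟨C, hC⟩ := hC M
  exact integrable_prod_mul (hu.measurable_slice 0) (ae_of_all _ fun z => hM _ _ le_rfl)
    hk hC (hψ.trace.integrable _)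

theorem exists_bound_kinEntropy (M : ℝ) : ∃ C, ∀ w a, |a| ≤ M → |kinEntropy w a| ≤ C :=
  ⟨_, fun _ _ h => abs_kinEntropy_le h⟩

theorem exists_bound_kinFlux (M : ℝ) : ∃ C, ∀ w a, |a| ≤ M → |kinFlux w a| ≤ C :=
  ⟨_, fun _ _ h => abs_kinFlux_le h⟩

theorem exists_bound_signedIndicator (M : ℝ) : ∃ C, ∀ w a, |a| ≤ M → |signedIndicator w a| ≤ C :=
  ⟨1, fun w a _ => abs_signedIndicator_le w a⟩

theorem IsEntropySolution.integrable_kin_integrand (hu : IsEntropySolution F u₀ u)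
    {ψ : ℝ × ℝ × ℝ → ℝ} (hψ : IsTestFunction ψ) :
    Integrable (fun p : ℝ × ℝ × ℝ => kinEntropy p.1 (u p.2.1 p.2.2) * fderiv ℝ ψ p (0, (1, 0)) +
      kinFlux p.1 (u p.2.1 p.2.2) * fderiv ℝ ψ p (0, (0, 1)))
      (volume.prod (volume.restrict (Ioi (0 : ℝ) ×ˢ (univ : Set ℝ)))) :=
  (hu.integrable_kin measurable_kinEntropy exists_bound_kinEntropy (hψ.fderiv_apply _)).add
    (hu.integrable_kin measurable_kinFlux exists_bound_kinFlux (hψ.fderiv_apply _))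

theorem entropyFunctional_kin_eq {ψ : ℝ × ℝ × ℝ → ℝ} (hψ : IsTestFunction ψ) (w : ℝ) :
    entropyFunctional u (kinEntropy w) (kinFlux w) (fun z => ψ (w, z)) =
      (∫ z in Ioi (0 : ℝ) ×ˢ (univ : Set ℝ),
        (kinEntropy w (u z.1 z.2) * fderiv ℝ ψ (w, z) (0, (1, 0)) +
          kinFlux w (u z.1 z.2) * fderiv ℝ ψ (w, z) (0, (0, 1)))) +
      ∫ x, kinEntropy w (u 0 x) * ψ (w, (0, x)) := by
  unfold entropyFunctional
  simp_rw [fderiv_slice hψ]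

theorem IsEntropySolution.integrable_entropyFunctional_kin (hu : IsEntropySolution F u₀ u)
    {ψ : ℝ × ℝ × ℝ → ℝ} (hψ : IsTestFunction ψ) :
    Integrable fun w => entropyFunctional u (kinEntropy w) (kinFlux w) (fun z => ψ (w, z)) := by
  simp_rw [entropyFunctional_kin_eq hψ]
  exact (hu.integrable_kin_integrand hψ).integral_prod_left.add
    (hu.integrable_kin_trace measurable_kinEntropy exists_bound_kinEntropy hψ).integral_prod_left

/-- The kinetic measure of an entropy solution. -/
theorem IsEntropySolution.exists_kinetic_measure
    (hu : IsEntropySolution (fun v => v ^ 2 / 2) u₀ u) :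
    ∃ m : Measure (ℝ × ℝ × ℝ), IsLocallyFiniteMeasure m ∧ ∀ ψ, IsTestFunction ψ →
      ∫ p, ψ p ∂m =
        ∫ w, entropyFunctional u (kinEntropy w) (kinFlux w) (fun z => ψ (w, z)) := by
  refine exists_measure_of_positive _ ?_ ?_ ?_
  · intro φ ψ hφ hψ
    rw [← integral_add (hu.integrable_entropyFunctional_kin hφ)
      (hu.integrable_entropyFunctional_kin hψ)]
    refine integral_congr_ae (ae_of_all _ fun w => ?_)
    exact entropyFunctional_add hu (isEntropyPair_kin w).continuous_left
      (isEntropyPair_kin w).continuous_right (hφ.slice w) (hψ.slice w)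
  · intro c φ hφ
    rw [← integral_const_mul]
    exact integral_congr_ae (ae_of_all _ fun w => entropyFunctional_const_mul _ _ _ c (hφ.slice w))
  · exact fun φ hφ h0 => integral_nonneg fun w =>
      hu.entropyFunctional_nonneg (isEntropyPair_kin w) (hφ.slice w) fun z => h0 _

/-- The kinetic measure tested with a derivative in the kinetic variable. -/
theorem IsEntropySolution.integral_kin_fderiv (hu : IsEntropySolution (fun v => v ^ 2 / 2) u₀ u)
    {φ : ℝ × ℝ × ℝ → ℝ} (hφ : IsTestFunction φ) :
    ∫ w, entropyFunctional u (kinEntropy w) (kinFlux w) (fun z => fderiv ℝ φ (w, z) (1, 0)) =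
      kineticPairing u φ := by
  have hψ := hφ.fderiv_apply ((1 : ℝ), ((0 : ℝ), (0 : ℝ)))
  have hψ' : IsTestFunction (fun p : ℝ × ℝ × ℝ => fderiv ℝ φ p (1, 0)) := hψ
  have i1 := hu.integrable_kin_integrand hψ'
  have i2 := hu.integrable_kin_trace measurable_kinEntropy exists_bound_kinEntropy hψ'
  -- Integrating by parts in `w` reduces the kinetic entropies to their indicator, up to boundary
  -- terms at `w = 0` which form the integrand of the linear pair `(v, v²/2)`.
  have e1 : ∀ z : ℝ × ℝ, ∫ w, (kinEntropy w (u z.1 z.2) *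
        fderiv ℝ (fun p : ℝ × ℝ × ℝ => fderiv ℝ φ p (1, 0)) (w, z) (0, (1, 0)) +
      kinFlux w (u z.1 z.2) *
        fderiv ℝ (fun p : ℝ × ℝ × ℝ => fderiv ℝ φ p (1, 0)) (w, z) (0, (0, 1))) =
      (∫ w, signedIndicator w (u z.1 z.2) *
        (fderiv ℝ φ (w, z) (0, (1, 0)) + w * fderiv ℝ φ (w, z) (0, (0, 1)))) -
      (u z.1 z.2 * fderiv ℝ (fun z => φ (0, z)) z (1, 0) +
        u z.1 z.2 ^ 2 / 2 * fderiv ℝ (fun z => φ (0, z)) z (0, 1)) := by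
    intro z
    set v := u z.1 z.2
    have hg : ∀ a : ℝ × ℝ, IsTestFunction (fun w => fderiv ℝ φ (w, z) (0, a)) :=
      fun a => (hφ.fderiv_apply (0, a)).slice_right z
    have hd : ∀ (a : ℝ × ℝ) (w : ℝ),
        fderiv ℝ (fun p : ℝ × ℝ × ℝ => fderiv ℝ φ p (1, 0)) (w, z) (0, a) =
          deriv (fun w => fderiv ℝ φ (w, z) (0, a)) w := by
      intro a w
      rw [hφ.1.fderiv_apply_comm, deriv_slice (hφ.fderiv_apply (0, a))]
    simp_rw [hd]
    have hb : ∀ {k : ℝ → ℝ → ℝ}, Measurable (Function.uncurry k) →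
        (∀ M, ∃ C, ∀ w a, |a| ≤ M → |k w a| ≤ C) → ∀ {g : ℝ → ℝ}, IsTestFunction g →
        Integrable fun w => k w v * g w := by
      intro k hk hC g hg
      obtain ⟨C, hC⟩ := hC |v|
      exact (hg.integrable volume).bdd_mul (c := C)
        (hk.comp measurable_prodMk_right).aestronglyMeasurable
        (ae_of_all _ fun w => hC w v le_rfl)
    have hderiv : ∀ {g : ℝ → ℝ}, IsTestFunction g → IsTestFunction (deriv g) := by
      intro g hg
      have := hg.fderiv_apply (1 : ℝ)
      exact this
    rw [integral_add (hb measurable_kinEntropy exists_bound_kinEntropy (hderiv (hg _)))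
      (hb measurable_kinFlux exists_bound_kinFlux (hderiv (hg _))),
      integral_kinEntropy_mul_deriv v (hg _), integral_kinFlux_mul_deriv v (hg _),
      fderiv_slice hφ, fderiv_slice hφ]
    simp_rw [mul_add]
    have hw : ∀ a : ℝ × ℝ, IsTestFunction (fun w => w * fderiv ℝ φ (w, z) (0, a)) :=
      fun a => (hg a).mul_left contDiff_id
    rw [integral_add (hb measurable_signedIndicator exists_bound_signedIndicator (hg _))
      (hb measurable_signedIndicator exists_bound_signedIndicator (hw _))]
    ring
  have e2 : ∀ x : ℝ, ∫ w, kinEntropy w (u 0 x) * fderiv ℝ φ (w, (0, x)) (1, 0) =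
      (∫ w, signedIndicator w (u 0 x) * φ (w, (0, x))) - u 0 x * φ (0, (0, x)) := by
    intro x
    simp_rw [← deriv_slice hφ]
    rw [integral_kinEntropy_mul_deriv _ (hφ.slice_right _)]
    ring
  simp_rw [entropyFunctional_kin_eq hψ']
  rw [integral_add i1.integral_prod_left i2.integral_prod_left]
  have s1 := integral_integral_swap (f := fun (w : ℝ) (z : ℝ × ℝ) => kinEntropy w (u z.1 z.2) *
      fderiv ℝ (fun p : ℝ × ℝ × ℝ => fderiv ℝ φ p (1, 0)) (w, z) (0, (1, 0)) +
    kinFlux w (u z.1 z.2) *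
      fderiv ℝ (fun p : ℝ × ℝ × ℝ => fderiv ℝ φ p (1, 0)) (w, z) (0, (0, 1))) i1
  have s2 := integral_integral_swap (f := fun w x => kinEntropy w (u 0 x) *
    fderiv ℝ φ (w, (0, x)) (1, 0)) i2
  simp_rw [e1] at s1
  simp_rw [e2] at s2
  rw [s1, s2]
  have j1 := i1.integral_prod_right
  have j2 := i2.integral_prod_right
  simp_rw [e1] at j1
  simp_rw [e2] at j2
  have l1 : IntegrableOn (fun z : ℝ × ℝ => u z.1 z.2 * fderiv ℝ (fun z => φ (0, z)) z (1, 0) +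
        u z.1 z.2 ^ 2 / 2 * fderiv ℝ (fun z => φ (0, z)) z (0, 1)) (Ioi (0 : ℝ) ×ˢ univ) :=
    hu.integrableOn_integrand (η := fun v => v) (Q := fun v => v ^ 2 / 2) continuous_id
      (by fun_prop) (hφ.slice 0)
  have l2 : Integrable fun x => u 0 x * φ (0, (0, x)) :=
    hu.integrable_slice_mul (η := fun v => v) continuous_id ((hφ.slice (0 : ℝ)).slice (0 : ℝ))
      le_rfl
  -- Integrability of the kinetic term alone is recovered by adding the linear term back to the
  -- integrable difference.
  have m1 := j1.add l1
  have m2 := j2.add l2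
  rw [integral_sub (m1.congr (ae_of_all _ fun z => sub_add_cancel _ _)) l1,
    integral_sub (m2.congr (ae_of_all _ fun z => sub_add_cancel _ _)) l2]
  -- The collected boundary terms are the production of the linear entropy, which vanishes because
  -- `u` solves the equation itself.
  have hlin : entropyFunctional u (fun v => v) (fun v => v ^ 2 / 2) (fun z => φ (0, z)) = 0 := by
    refine hu.entropyFunctional_eq_zero ?_ ?_ (hφ.slice 0)
    · simpa using isEntropyPair_linear 1 0
    · simpa using isEntropyPair_linear (-1) 0
  unfold entropyFunctional at hlin
  unfold kineticPairing
  linarith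

/-- The mass over `A` is at most the integral over `w` of the productions tested with `b`. These are
at most `K` and vanish for `|w| > M`, whence the factor `2 * M`. -/
theorem IsEntropySolution.kinetic_measure_le (hu : IsEntropySolution (fun v => v ^ 2 / 2) u₀ u)
    {M : ℝ} (hM0 : 0 ≤ M) (hM : ∀ t x, 0 ≤ t → |u t x| ≤ M) {m : Measure (ℝ × ℝ × ℝ)}
    [IsLocallyFiniteMeasure m]
    (hm : ∀ ψ, IsTestFunction ψ → ∫ p, ψ p ∂m =
        ∫ w, entropyFunctional u (kinEntropy w) (kinFlux w) (fun z => ψ (w, z)))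
    {b : ℝ × ℝ → ℝ} (hb : IsTestFunction b) (hb0 : ∀ z, 0 ≤ b z) {A : Set (ℝ × ℝ)}
    (hA : MeasurableSet A) (hbA : ∀ z ∈ A, 1 ≤ b z) {K : ℝ}
    (hK : ∀ w, entropyFunctional u (kinEntropy w) (kinFlux w) b ≤ K) :
    m (univ ×ˢ A) ≤ ENNReal.ofReal (2 * M * K) := by
  have hz : ∀ w, w ∉ Icc (-M) M → entropyFunctional u (kinEntropy w) (kinFlux w) b = 0 := by
    intro w hw
    have hw' : M < |w| := by
      by_contra h
      exact hw (abs_le.1 (not_lt.1 h))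
    unfold entropyFunctional
    rw [setIntegral_eq_zero_of_forall_eq_zero, integral_eq_zero_of_ae, add_zero]
    · refine ae_of_all _ fun x => ?_
      simp [kinEntropy_eq_zero ((hM 0 x le_rfl).trans_lt hw')]
    · intro z hz
      have := (hM z.1 z.2 (le_of_lt hz.1)).trans_lt hw'
      simp [kinEntropy_eq_zero this, kinFlux_eq_zero this]
  -- Test functions must also be compactly supported in the kinetic variable, so the line is
  -- exhausted by intervals; the bound does not depend on `N`.
  have hN : ∀ N : ℕ, m (Icc (-(N : ℝ)) N ×ˢ A) ≤ ENNReal.ofReal (2 * M * K) := by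
    intro N
    obtain ⟨a, ha, ha0, ha1, haN⟩ := exists_isTestFunction_eq_one
      (isCompact_Icc (a := -(N : ℝ)) (b := N))
    have hab := ha.mul_prod hb
    have h1 : m (Icc (-(N : ℝ)) N ×ˢ A) ≤ ∫⁻ p, ENNReal.ofReal (a p.1 * b p.2) ∂m := by
      rw [← lintegral_indicator_one (measurableSet_Icc.prod hA)]
      refine lintegral_mono fun p => ?_
      by_cases hp : p ∈ Icc (-(N : ℝ)) N ×ˢ A
      · rw [indicator_of_mem hp, Pi.one_apply, haN _ hp.1, one_mul, ← ENNReal.ofReal_one]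
        exact ENNReal.ofReal_le_ofReal (hbA _ hp.2)
      · rw [indicator_of_notMem hp]
        exact bot_le
    rw [← ofReal_integral_eq_lintegral_ofReal (hab.integrable m)
      (ae_of_all _ fun p => mul_nonneg (ha0 _) (hb0 _)), hm _ hab] at h1
    refine h1.trans (ENNReal.ofReal_le_ofReal ?_)
    have e : ∀ w, entropyFunctional u (kinEntropy w) (kinFlux w) (fun z => a w * b z) =
        a w * entropyFunctional u (kinEntropy w) (kinFlux w) b :=
      fun w => entropyFunctional_const_mul _ _ _ _ hb
    simp_rw [e]
    rw [← setIntegral_eq_integral_of_forall_compl_eq_zero (s := Icc (-M) M)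
      (fun w hw => by rw [hz w hw, mul_zero])]
    have hT0 : ∀ w, 0 ≤ entropyFunctional u (kinEntropy w) (kinFlux w) b := fun w =>
      hu.entropyFunctional_nonneg (isEntropyPair_kin w) hb hb0
    have := norm_setIntegral_le_of_norm_le_const (μ := volume) (s := Icc (-M) M)
      (f := fun w => a w * entropyFunctional u (kinEntropy w) (kinFlux w) b) (C := K) (by simp)
      (fun w _ => by
        rw [Real.norm_eq_abs, abs_of_nonneg (mul_nonneg (ha0 w) (hT0 w))]
        exact (mul_le_of_le_one_left (hT0 w) (ha1 w)).trans (hK w))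
    refine (le_abs_self _).trans (this.trans (le_of_eq ?_))
    rw [Real.volume_real_Icc_of_le (by linarith)]
    ring
  have hU : (univ : Set ℝ) ×ˢ A = ⋃ N : ℕ, Icc (-(N : ℝ)) N ×ˢ A := by
    ext ⟨w, z⟩
    simp only [mem_prod, mem_univ, true_and, mem_iUnion]
    constructor
    · intro h
      obtain ⟨N, hN⟩ := exists_nat_ge |w|
      exact ⟨N, abs_le.1 hN, h⟩
    · rintro ⟨N, h⟩
      exact h.2
  have hmono : Monotone fun N : ℕ => Icc (-(N : ℝ)) N ×ˢ A := by
    intro N N' h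
    have : (N : ℝ) ≤ N' := by exact_mod_cast h
    exact prod_mono (Icc_subset_Icc (by linarith) this) subset_rfl
  rw [hU, hmono.measure_iUnion]
  exact iSup_le hN

end

/-! ### Entropy production controlled by oscillation -/

theorem IsTestFunction.rescale {E : Type*} [NormedAddCommGroup E] [NormedSpace ℝ E] {φ : E → ℝ}
    (hφ : IsTestFunction φ) (p₀ : E) {r : ℝ} (hr : 0 < r) :
    IsTestFunction (fun p => φ (r⁻¹ • (p - p₀))) := by
  refine hφ.comp_isClosedEmbedding (contDiff_const.smul (contDiff_id.sub contDiff_const)) ?_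
  exact ((Homeomorph.subRight p₀).trans
    (Homeomorph.smulOfNeZero r⁻¹ (inv_ne_zero hr.ne'))).isClosedEmbedding

theorem IsTestFunction.fderiv_rescale {E : Type*} [NormedAddCommGroup E] [NormedSpace ℝ E]
    {φ : E → ℝ} (hφ : IsTestFunction φ) (p₀ : E) (r : ℝ) (p v : E) :
    fderiv ℝ (fun p => φ (r⁻¹ • (p - p₀))) p v = r⁻¹ * fderiv ℝ φ (r⁻¹ • (p - p₀)) v := by
  have h1 : HasFDerivAt (fun p : E => r⁻¹ • (p - p₀)) (r⁻¹ • ContinuousLinearMap.id ℝ E) p :=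
    ((hasFDerivAt_id p).sub_const p₀).const_smul r⁻¹
  have h2 := ((hφ.differentiable (r⁻¹ • (p - p₀))).hasFDerivAt.comp p h1).fderiv
  rw [show (fun p => φ (r⁻¹ • (p - p₀))) = φ ∘ fun p => r⁻¹ • (p - p₀) from rfl, h2]
  simp

/-- In `v` this is a positive or a negative part of `v - w`, hence Lipschitz with constant one
uniformly in `w`. -/
theorem abs_kinEntropy_sub_le (w v c : ℝ) : |kinEntropy w v - kinEntropy w c| ≤ |v - c| := by
  unfold kinEntropy signedIndicator
  rw [abs_le]
  rcases abs_cases (v - c) with ⟨h1, h2⟩ | ⟨h1, h2⟩ <;> rw [h1] <;>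
    split_ifs with h3 h4 h5 h6 h7 h8 <;> constructor <;> grind

/-- The flux has derivative `η'(v) v` in `v`, with `|η'| ≤ 1` and `|v| ≤ M`. -/
theorem abs_kinFlux_sub_le {w v c M : ℝ} (hv : |v| ≤ M) (hc : |c| ≤ M) :
    |kinFlux w v - kinFlux w c| ≤ M * |v - c| := by
  wlog h : c ≤ v generalizing v c
  · rw [abs_sub_comm, abs_sub_comm v]
    exact this hc hv (le_of_not_ge h)
  obtain ⟨hv1, hv2⟩ := abs_le.1 hv
  obtain ⟨hc1, hc2⟩ := abs_le.1 hc
  rw [abs_of_nonneg (sub_nonneg.2 h)]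
  have key : ∀ a b : ℝ, -M ≤ a → a ≤ M → -M ≤ b → b ≤ M → a ≤ b →
      |(b ^ 2 - a ^ 2) / 2| ≤ M * (b - a) := by
    intro a b h1 h2 h3 h4 hab
    rw [abs_le]
    constructor <;> nlinarith
  have key' : ∀ a b : ℝ, c ≤ a → a ≤ b → b ≤ v → |(b ^ 2 - a ^ 2) / 2| ≤ M * (v - c) := by
    intro a b h1 h2 h3
    refine (key a b (by linarith) (by linarith) (by linarith) (by linarith) h2).trans ?_
    have : 0 ≤ M := (abs_nonneg v).trans hv
    exact mul_le_mul_of_nonneg_left (by linarith) this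
  have h0 : |(0 : ℝ)| ≤ M * (v - c) := by
    rw [abs_zero]
    exact mul_nonneg ((abs_nonneg v).trans hv) (by linarith)
  rcases lt_or_ge 0 w with hw | hw
  · have e : ∀ s, kinFlux w s = if w ≤ s then (s ^ 2 - w ^ 2) / 2 else 0 := by
      intro s
      unfold kinFlux signedIndicator
      by_cases hs : w ≤ s
      · simp [hw, hs]
      · rw [if_neg (fun h' => hs h'.2), if_neg (fun h' => by linarith [h'.2])]
        simp [hs]
    rw [e, e]
    split_ifs with h1 h2
    · convert key' c v le_rfl h le_rfl using 2
      ring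
    · rw [sub_zero]
      exact key' w v (not_le.1 h2).le h1 le_rfl
    · exact absurd (by linarith) h1
    · simpa using h0
  · have e : ∀ s, kinFlux w s = if s < w then (w ^ 2 - s ^ 2) / 2 else 0 := by
      intro s
      unfold kinFlux signedIndicator
      rw [if_neg (fun h' => by linarith [h'.1])]
      by_cases h : s < w
      · simp [hw, h]
        ring
      · rw [if_neg (fun h' => h h'.1)]
        simp [h]
    rw [e, e]
    split_ifs with h1 h2
    · have := key' c v le_rfl h le_rfl
      rw [abs_sub_comm]
      convert this using 2
      ring
    · exact absurd (by linarith) h2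
    · rw [zero_sub, abs_neg]
      exact key' c w le_rfl (by linarith) (by linarith)
    · simpa using h0

section

variable {u₀ : ℝ → ℝ} {u : ℝ → ℝ → ℝ}

theorem IsEntropySolution.integrableOn_abs_sub {F : ℝ → ℝ} (hu : IsEntropySolution F u₀ u)
    (c : ℝ) (p₀ : ℝ × ℝ) (r : ℝ) :
    IntegrableOn (fun p : ℝ × ℝ => |u p.1 p.2 - c|)
      ((Ioi (0 : ℝ) ×ˢ univ) ∩ Metric.closedBall p₀ r) := by
  obtain ⟨M, -, hM⟩ := hu.exists_bound
  have hmeas := measurableSet_upper.inter (Metric.isClosed_closedBall (x := p₀) (ε := r)).measurableSet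
  refine Measure.integrableOn_of_bounded (M := M + |c|) ?_
    (hu.measurable.sub_const c).abs.aestronglyMeasurable ?_
  · exact ((measure_mono inter_subset_right).trans_lt
      (isCompact_closedBall p₀ r).measure_lt_top).ne
  · refine (ae_restrict_iff' hmeas).2 (ae_of_all _ fun p hp => ?_)
    rw [Real.norm_eq_abs, abs_abs]
    exact (abs_sub _ _).trans (by linarith [hM p.1 p.2 (le_of_lt hp.1.1)])

/-- Constants do not contribute to the entropy production, so that it is controlled by the
oscillation of the solution. -/
theorem IsEntropySolution.abs_entropyFunctional_rescale_sub_le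
    (hu : IsEntropySolution (fun v => v ^ 2 / 2) u₀ u)
    {M : ℝ} (hM : ∀ t x, 0 ≤ t → |u t x| ≤ M) {b : ℝ × ℝ → ℝ} (hb : IsTestFunction b) :
    ∃ C R, 0 ≤ C ∧ 0 < R ∧ (∀ p, R < ‖p‖ → b p = 0) ∧ ∀ (η Q : ℝ → ℝ) (c L : ℝ),
      Continuous η → Continuous Q → 0 ≤ L →
      (∀ v, |v| ≤ M → |η v - η c| ≤ L * |v - c|) →
      (∀ v, |v| ≤ M → |Q v - Q c| ≤ L * |v - c|) → ∀ (p₀ : ℝ × ℝ) (r : ℝ), 0 < r →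
      |entropyFunctional u η Q (fun p => b (r⁻¹ • (p - p₀))) -
        ∫ x, (η (u 0 x) - η c) * b (r⁻¹ • ((0, x) - p₀))| ≤
      L * C * (r⁻¹ * ∫ p in (Ioi (0 : ℝ) ×ˢ univ) ∩ Metric.closedBall p₀ (R * r),
        |u p.1 p.2 - c|) := by
  obtain ⟨R, hR0, hR⟩ := hb.2.isCompact.isBounded.subset_closedBall_lt 0 0
  obtain ⟨C₁, hC₁0, hC₁⟩ := (hb.fderiv_apply (1, 0)).exists_bound
  obtain ⟨C₂, hC₂0, hC₂⟩ := (hb.fderiv_apply (0, 1)).exists_bound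
  have hout : ∀ p, R < ‖p‖ → p ∉ tsupport b := fun p hp h => by
    have := hR h
    rw [mem_closedBall_zero_iff] at this
    linarith
  refine ⟨C₁ + C₂, R, add_nonneg hC₁0 hC₂0, hR0,
    fun p hp => image_eq_zero_of_notMem_tsupport (hout p hp), ?_⟩
  intro η Q c L hη hQ hL hηL hQL p₀ r hr
  have hbr := hb.rescale p₀ hr
  have hlin := entropyFunctional_linear_pair hu hη hQ (η' := fun _ => η c) (Q' := fun _ => Q c)
    continuous_const continuous_const (-1) hbr
  -- A constant pair and its negative are both entropy pairs, so the pair may be replaced by its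
  -- difference from the value at `c` without changing the production.
  have hz : entropyFunctional u (fun _ => η c) (fun _ => Q c)
      (fun p => b (r⁻¹ • (p - p₀))) = 0 := by
    refine hu.entropyFunctional_eq_zero ⟨convexOn_const _ convex_univ, 0, fun v => ?_⟩
      ⟨convexOn_const _ convex_univ, 0, fun v => ?_⟩ hbr
    · simp
    · simp
  rw [hz, mul_zero, add_zero] at hlin
  rw [← hlin]
  unfold entropyFunctional
  have e : ∀ x : ℝ, η (u 0 x) + -1 * η c = η (u 0 x) - η c := fun x => by ring
  simp_rw [e]
  rw [add_sub_cancel_right]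
  set S : Set (ℝ × ℝ) := (Ioi (0 : ℝ) ×ˢ univ) ∩ Metric.closedBall p₀ (R * r) with hS
  have hSm : MeasurableSet S :=
    measurableSet_upper.inter (Metric.isClosed_closedBall).measurableSet
  have hd : ∀ p v, p ∉ Metric.closedBall p₀ (R * r) →
      fderiv ℝ (fun p => b (r⁻¹ • (p - p₀))) p v = 0 := by
    intro p v hp
    rw [hb.fderiv_rescale]
    have : r⁻¹ • (p - p₀) ∉ tsupport b := by
      refine hout _ ?_
      rw [mem_closedBall_iff_norm, not_le] at hp
      rw [norm_smul, Real.norm_eq_abs, abs_of_pos (inv_pos.2 hr), ← div_eq_inv_mul,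
        lt_div_iff₀ hr]
      exact hp
    rw [image_eq_zero_of_notMem_tsupport fun h => this (tsupport_fderiv_subset ℝ h)]
    simp
  have hset : ∫ p in Ioi (0 : ℝ) ×ˢ (univ : Set ℝ), ((η (u p.1 p.2) + -1 * η c) *
        fderiv ℝ (fun p => b (r⁻¹ • (p - p₀))) p (1, 0) + (Q (u p.1 p.2) + -1 * Q c) *
        fderiv ℝ (fun p => b (r⁻¹ • (p - p₀))) p (0, 1)) =
      ∫ p in S, ((η (u p.1 p.2) + -1 * η c) *
        fderiv ℝ (fun p => b (r⁻¹ • (p - p₀))) p (1, 0) + (Q (u p.1 p.2) + -1 * Q c) *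
        fderiv ℝ (fun p => b (r⁻¹ • (p - p₀))) p (0, 1)) :=
    setIntegral_eq_of_subset_of_forall_sdiff_eq_zero measurableSet_upper
      inter_subset_left (fun p hp => by
        have : p ∉ Metric.closedBall p₀ (R * r) := fun h => hp.2 ⟨hp.1, h⟩
        rw [hd p _ this, hd p _ this, mul_zero, mul_zero, add_zero])
  rw [hset]
  rw [← integral_const_mul, ← integral_const_mul, ← Real.norm_eq_abs]
  refine norm_integral_le_of_norm_le (((hu.integrableOn_abs_sub c p₀ (R * r)).const_mul _).const_mul
    _) ((ae_restrict_iff' hSm).2 (ae_of_all _ fun p hp => ?_))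
  have hp0 : |u p.1 p.2| ≤ M := hM _ _ (le_of_lt hp.1.1)
  rw [hb.fderiv_rescale, hb.fderiv_rescale]
  have hr' : |r⁻¹| = r⁻¹ := abs_of_pos (inv_pos.2 hr)
  have a1 : |(η (u p.1 p.2) + -1 * η c) * (r⁻¹ * fderiv ℝ b (r⁻¹ • (p - p₀)) (1, 0))| ≤
      L * |u p.1 p.2 - c| * (r⁻¹ * C₁) := by
    rw [abs_mul, abs_mul, hr', show η (u p.1 p.2) + -1 * η c = η (u p.1 p.2) - η c by ring]
    exact mul_le_mul (hηL _ hp0) (mul_le_mul_of_nonneg_left (hC₁ _) (inv_pos.2 hr).le)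
      (mul_nonneg (inv_pos.2 hr).le (abs_nonneg _)) (mul_nonneg hL (abs_nonneg _))
  have a2 : |(Q (u p.1 p.2) + -1 * Q c) * (r⁻¹ * fderiv ℝ b (r⁻¹ • (p - p₀)) (0, 1))| ≤
      L * |u p.1 p.2 - c| * (r⁻¹ * C₂) := by
    rw [abs_mul, abs_mul, hr', show Q (u p.1 p.2) + -1 * Q c = Q (u p.1 p.2) - Q c by ring]
    exact mul_le_mul (hQL _ hp0) (mul_le_mul_of_nonneg_left (hC₂ _) (inv_pos.2 hr).le)
      (mul_nonneg (inv_pos.2 hr).le (abs_nonneg _)) (mul_nonneg hL (abs_nonneg _))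
  refine (norm_add_le _ _).trans ((add_le_add a1 a2).trans (le_of_eq ?_))
  ring

/-- The kinetic entropies and fluxes are Lipschitz uniformly in `w`. Testing with a bump rescaled to
the ball bounds every production by the oscillation around `c`: the gradient of the bump costs `r⁻¹`
in the interior and nothing on the trace. -/
theorem IsEntropySolution.kinetic_measure_closedBall_le
    (hu : IsEntropySolution (fun v => v ^ 2 / 2) u₀ u) {m : Measure (ℝ × ℝ × ℝ)}
    [IsLocallyFiniteMeasure m]
    (hm : ∀ ψ, IsTestFunction ψ → ∫ p, ψ p ∂m =
        ∫ w, entropyFunctional u (kinEntropy w) (kinFlux w) (fun z => ψ (w, z))) :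
    ∃ C R, 0 ≤ C ∧ 0 < R ∧ ∀ (p₀ : ℝ × ℝ) (c r : ℝ), 0 < r →
      m (univ ×ˢ Metric.closedBall p₀ r) ≤ ENNReal.ofReal (C *
        ((r⁻¹ * ∫ p in (Ioi (0 : ℝ) ×ˢ univ) ∩ Metric.closedBall p₀ (R * r), |u p.1 p.2 - c|) +
          ∫ x in {x : ℝ | ((0 : ℝ), x) ∈ Metric.closedBall p₀ (R * r)}, |u 0 x - c|)) := by
  obtain ⟨M, hM1, hM⟩ := hu.exists_bound
  let b : ContDiffBump (0 : ℝ × ℝ) := ⟨1, 2, zero_lt_one, one_lt_two⟩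
  have hb : IsTestFunction b := ⟨b.contDiff, b.hasCompactSupport⟩
  obtain ⟨C, R, hC0, hR0, hRb, hCR⟩ := hu.abs_entropyFunctional_rescale_sub_le hM hb
  refine ⟨2 * M * (M * C + 1), R, by positivity, hR0, fun p₀ c r hr => ?_⟩
  -- The Lipschitz bound for the fluxes needs `|c| ≤ M`. Projecting `c` onto `[-M, M]` does not
  -- increase its distance to the values of `u`.
  set c' := max (-M) (min M c) with hc'
  have hc'M : |c'| ≤ M :=
    abs_le.2 ⟨le_max_left _ _, max_le (by linarith) (min_le_left _ _)⟩
  have hcc : ∀ v, |v| ≤ M → |v - c'| ≤ |v - c| := by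
    intro v hv
    obtain ⟨h1, h2⟩ := abs_le.1 hv
    rw [hc']
    rcases le_total M c with h | h
    · rw [min_eq_left h, max_eq_right (by linarith), abs_of_nonpos (by linarith),
        abs_of_nonpos (by linarith)]
      linarith
    · rw [min_eq_right h]
      rcases le_total (-M) c with h' | h'
      · rw [max_eq_right h']
      · rw [max_eq_left h', abs_of_nonneg (by linarith), abs_of_nonneg (by linarith)]
        linarith
  set S := (Ioi (0 : ℝ) ×ˢ (univ : Set ℝ)) ∩ Metric.closedBall p₀ (R * r) with hS
  have hSm : MeasurableSet S :=
    measurableSet_upper.inter (Metric.isClosed_closedBall).measurableSet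
  set S₀ := {x : ℝ | ((0 : ℝ), x) ∈ Metric.closedBall p₀ (R * r)} with hS₀
  have hS₀c : IsClosed S₀ := Metric.isClosed_closedBall.preimage
    (show Continuous fun x : ℝ => ((0 : ℝ), x) by fun_prop)
  have hS₀K : S₀ ⊆ Metric.closedBall p₀.2 (R * r) := fun x hx => by
    have := mem_ofPred.1 hx
    rw [mem_closedBall_iff_norm, Prod.norm_def] at this
    exact mem_closedBall_iff_norm.2 ((le_max_right _ _).trans this)
  have hi₀ : ∀ c, IntegrableOn (fun x => |u 0 x - c|) S₀ := by
    intro c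
    refine Measure.integrableOn_of_bounded (M := M + |c|) ?_
      ((hu.measurable_slice 0).sub_const c).abs.aestronglyMeasurable (ae_of_all _ fun x => ?_)
    · exact ((measure_mono hS₀K).trans_lt (isCompact_closedBall _ _).measure_lt_top).ne
    · rw [Real.norm_eq_abs, abs_abs]
      exact (abs_sub _ _).trans (by linarith [hM 0 x le_rfl])
  have I1 : ∫ p in S, |u p.1 p.2 - c'| ≤ ∫ p in S, |u p.1 p.2 - c| :=
    setIntegral_mono_on (hu.integrableOn_abs_sub c' p₀ _) (hu.integrableOn_abs_sub c p₀ _) hSm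
      fun p hp => hcc _ (hM _ _ (le_of_lt hp.1.1))
  have I2 : ∫ x in S₀, |u 0 x - c'| ≤ ∫ x in S₀, |u 0 x - c| :=
    setIntegral_mono_on (hi₀ _) (hi₀ _) hS₀c.measurableSet fun x _ => hcc _ (hM _ _ le_rfl)
  have J1 : 0 ≤ ∫ p in S, |u p.1 p.2 - c| := integral_nonneg fun _ => abs_nonneg _
  have J2 : 0 ≤ ∫ x in S₀, |u 0 x - c| := integral_nonneg fun _ => abs_nonneg _
  have hr' : 0 < r⁻¹ := inv_pos.2 hr
  have hbound : ∀ w, entropyFunctional u (kinEntropy w) (kinFlux w)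
      (fun p => b (r⁻¹ • (p - p₀))) ≤ M * C * (r⁻¹ * ∫ p in S, |u p.1 p.2 - c|) +
        ∫ x in S₀, |u 0 x - c| := by
    intro w
    have h1 := hCR (kinEntropy w) (kinFlux w) c' M (isEntropyPair_kin w).continuous_left
      (isEntropyPair_kin w).continuous_right (by linarith)
      (fun v _ => (abs_kinEntropy_sub_le w v c').trans
        (le_mul_of_one_le_left (abs_nonneg _) hM1))
      (fun v hv => abs_kinFlux_sub_le hv hc'M) p₀ r hr
    have h2 : ‖∫ x, (kinEntropy w (u 0 x) - kinEntropy w c') * b (r⁻¹ • ((0, x) - p₀))‖ ≤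
        ∫ x in S₀, |u 0 x - c'| := by
      rw [← setIntegral_eq_integral_of_forall_compl_eq_zero (s := S₀) (fun x hx => by
        rw [hRb, mul_zero]
        have : ((0 : ℝ), x) ∉ Metric.closedBall p₀ (R * r) := hx
        rw [mem_closedBall_iff_norm, not_le] at this
        rw [norm_smul, Real.norm_eq_abs, abs_of_pos hr', ← div_eq_inv_mul, lt_div_iff₀ hr]
        exact this)]
      refine norm_integral_le_of_norm_le (hi₀ c') (ae_of_all _ fun x => ?_)
      rw [norm_mul]
      refine (mul_le_of_le_one_right (norm_nonneg _) ?_).trans (abs_kinEntropy_sub_le w _ c')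
      rw [Real.norm_eq_abs, abs_of_nonneg b.nonneg]
      exact b.le_one
    have h3 := (abs_le.1 h1).2
    have h4 := le_of_abs_le h2
    have h5 : M * C * (r⁻¹ * ∫ p in S, |u p.1 p.2 - c'|) ≤
        M * C * (r⁻¹ * ∫ p in S, |u p.1 p.2 - c|) := by gcongr
    linarith
  have hle := hu.kinetic_measure_le (by linarith) hM hm (hb.rescale p₀ hr) (fun z => b.nonneg)
    (Metric.isClosed_closedBall (x := p₀) (ε := r)).measurableSet (fun z hz => by
      refine (b.one_of_mem_closedBall ?_).ge
      rw [mem_closedBall_zero_iff, norm_smul, Real.norm_eq_abs, abs_of_pos hr', ← div_eq_inv_mul]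
      exact (div_le_one hr).2 (mem_closedBall_iff_norm.1 hz)) hbound
  refine hle.trans (ENNReal.ofReal_le_ofReal ?_)
  rw [mul_assoc (2 * M)]
  refine mul_le_mul_of_nonneg_left ?_ (by linarith)
  have h6 : 0 ≤ M * C := by positivity
  have h7 : 0 ≤ r⁻¹ * ∫ p in S, |u p.1 p.2 - c| := by positivity
  nlinarith

end

/-! ### Comparison with constants in characteristic cones -/

/-- A test function which decreases along the characteristic cone of speed `M`. -/
theorem exists_cone_function {M : ℝ} (hM : 1 ≤ M) :
    ∃ φ : ℝ × ℝ → ℝ, IsTestFunction φ ∧ (∀ p, 0 ≤ φ p) ∧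
      (∀ p : ℝ × ℝ, 0 < p.1 → fderiv ℝ φ p (1, 0) + M * |fderiv ℝ φ p (0, 1)| ≤ 0) ∧
      ∀ p : ℝ × ℝ, 0 < p.1 → ‖p‖ ≤ 1 → fderiv ℝ φ p (1, 0) + M * |fderiv ℝ φ p (0, 1)| ≤ -1 := by
  -- The profile is cut off along the parabolas `k t + x² = const`. Where the cut-off varies, `x² ≤
  -- k + 2`, so `(2 M |x|)² ≤ k (k + 2) / 2 ≤ k²`: the decay in time beats the transport with speed
  -- `M`.
  set k : ℝ := 8 * M ^ 2 with hk
  have hk2 : 8 ≤ k := by nlinarith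
  let Θ : ℝ → ℝ := fun s => 1 - smoothStep (s - k)
  have hΘ : ContDiff ℝ ∞ Θ :=
    contDiff_const.sub (smoothStep_contDiff.comp (contDiff_id.sub contDiff_const))
  have hΘ0 : ∀ s, 0 ≤ Θ s := fun s => sub_nonneg.2 (smoothStep_le_one _)
  have hΘ1 : ∀ s, s ≤ k + 1 → Θ s = 1 := fun s hs => by
    simp only [Θ]
    rw [smoothStep_eq_zero (by linarith), sub_zero]
  have hΘ2 : ∀ s, k + 2 ≤ s → Θ s = 0 := fun s hs => by
    simp only [Θ]
    rw [smoothStep_eq_one (by linarith), sub_self]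
  have hΘanti : Antitone Θ := fun a b hab => by
    have : smoothStep (a - k) ≤ smoothStep (b - k) := smoothStep_monotone (by linarith)
    simp only [Θ]
    linarith
  have hΘd : ∀ s, deriv Θ s ≤ 0 := fun s => hΘanti.deriv_nonpos
  have hΘd0 : ∀ s, k + 2 < s → deriv Θ s = 0 := fun s hs => by
    have : Θ =ᶠ[𝓝 s] fun _ => 0 := by
      filter_upwards [Ioi_mem_nhds hs] with y hy using hΘ2 y (le_of_lt hy)
    rw [this.deriv_eq, deriv_const]
  -- The factor `2 - t` gives the strict decrease `-Θ`, equal to `-1` on the unit ball in `t > 0`;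
  -- the last factor only makes the support compact in `t < 0` and equals one for `t ≥ 0`.
  let φ : ℝ × ℝ → ℝ := fun p => (2 - p.1) * Θ (k * p.1 + p.2 ^ 2) * smoothStep (p.1 + 2)
  have hφc : ContDiff ℝ ∞ φ := by
    refine ((contDiff_const.sub contDiff_fst).mul (hΘ.comp ?_)).mul (smoothStep_contDiff.comp ?_)
    · exact (contDiff_const.mul contDiff_fst).add (contDiff_snd.pow 2)
    · exact contDiff_fst.add contDiff_const
  have hφs : HasCompactSupport φ := by
    refine HasCompactSupport.intro (K := Icc (-1) 2 ×ˢ Icc (-(2 * k + 2)) (2 * k + 2))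
      (isCompact_Icc.prod isCompact_Icc) ?_
    rintro ⟨t, x⟩ hp
    by_contra hne
    refine hp ?_
    have h1 : -1 < t := by
      by_contra h
      refine hne ?_
      simp only [φ]
      rw [smoothStep_eq_zero (by linarith), mul_zero]
    have h2 : k * t + x ^ 2 < k + 2 := by
      by_contra h
      refine hne ?_
      simp only [φ]
      rw [hΘ2 _ (not_lt.1 h), mul_zero, zero_mul]
    have h3 : t ≤ 2 := by nlinarith [sq_nonneg x]
    have h4 : x ^ 2 ≤ (2 * k + 2) ^ 2 := by nlinarith
    exact ⟨⟨h1.le, h3⟩, abs_le_of_sq_le_sq' h4 (by linarith)⟩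
  have hd : ∀ p : ℝ × ℝ, 0 < p.1 → ∀ v : ℝ × ℝ, fderiv ℝ φ p v =
      -v.1 * Θ (k * p.1 + p.2 ^ 2) +
        (2 - p.1) * (deriv Θ (k * p.1 + p.2 ^ 2) * (k * v.1 + 2 * p.2 * v.2)) := by
    intro p hp v
    have he : φ =ᶠ[𝓝 p] fun p : ℝ × ℝ => (2 - p.1) * Θ (k * p.1 + p.2 ^ 2) := by
      filter_upwards [(isOpen_lt continuous_const continuous_fst).mem_nhds (mem_ofPred.2 hp)]
        with q hq
      have hq : 0 < q.1 := mem_ofPred.1 hq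
      simp only [φ]
      rw [smoothStep_eq_one (by linarith), mul_one]
    have h1 : HasFDerivAt (fun p : ℝ × ℝ => 2 - p.1) (-ContinuousLinearMap.fst ℝ ℝ ℝ) p :=
      hasFDerivAt_fst.const_sub 2
    have h2 : HasFDerivAt (fun p : ℝ × ℝ => k * p.1 + p.2 ^ 2)
        (k • ContinuousLinearMap.fst ℝ ℝ ℝ + (2 * p.2) • ContinuousLinearMap.snd ℝ ℝ ℝ) p := by
      have := (hasFDerivAt_fst (𝕜 := ℝ) (E := ℝ) (F := ℝ) (p := p)).const_mul k |>.fun_add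
        ((hasFDerivAt_snd (𝕜 := ℝ) (E := ℝ) (F := ℝ) (p := p)).pow 2)
      refine this.congr_fderiv ?_
      ext <;> simp
    have h3 := HasDerivAt.comp_hasFDerivAt (h₂ := Θ) p
      (hΘ.differentiable (by simp) (k * p.1 + p.2 ^ 2)).hasDerivAt h2
    rw [he.fderiv_eq]
    have h4 := (h1.fun_mul h3).fderiv
    simp only [Function.comp_def] at h4
    rw [h4]
    simp
    ring
  have key : ∀ p : ℝ × ℝ, 0 < p.1 → fderiv ℝ φ p (1, 0) + M * |fderiv ℝ φ p (0, 1)| ≤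
      -Θ (k * p.1 + p.2 ^ 2) := by
    intro p hp
    rw [hd p hp, hd p hp]
    set s := k * p.1 + p.2 ^ 2 with hs
    simp only [mul_one, mul_zero, add_zero, zero_add, neg_zero, zero_mul]
    rcases lt_or_ge (k + 2) s with h | h
    · rw [hΘd0 s h]
      simp
    · have ht : 0 ≤ 2 - p.1 := by nlinarith [sq_nonneg p.2]
      have hx : p.2 ^ 2 ≤ k + 2 := by nlinarith
      have hMx : 2 * M * |p.2| ≤ k := by
        refine abs_le_of_sq_le_sq (a := 2 * M * |p.2|) ?_ (by linarith) |> le_trans (le_abs_self _)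
        rw [mul_pow, sq_abs]
        nlinarith
      have hD := hΘd s
      rw [abs_mul, abs_mul, abs_of_nonneg ht, abs_of_nonpos hD, abs_mul, abs_two]
      have : 0 ≤ (2 - p.1) * (-deriv Θ s) * (k - 2 * M * |p.2|) :=
        mul_nonneg (mul_nonneg ht (by linarith)) (by linarith)
      nlinarith
  refine ⟨φ, ⟨hφc, hφs⟩, ?_, fun p hp => (key p hp).trans (by linarith [hΘ0 (k * p.1 + p.2 ^ 2)]),
    fun p hp h1 => (key p hp).trans ?_⟩
  · rintro ⟨t, x⟩
    refine mul_nonneg ?_ (smoothStep_nonneg _)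
    change 0 ≤ (2 - t) * Θ (k * t + x ^ 2)
    rcases le_or_gt t 2 with h | h
    · exact mul_nonneg (by linarith) (hΘ0 _)
    · rw [hΘ2 _ (by nlinarith [sq_nonneg x]), mul_zero]
  · rw [Prod.norm_def] at h1
    have a1 := le_of_abs_le ((le_max_left _ _).trans h1)
    have a2 := abs_le.1 ((le_max_right _ _).trans h1)
    rw [hΘ1]
    nlinarith

/-- The Kružkov pair, as the sum of its two half entropies. -/
theorem isEntropyPair_abs (c : ℝ) : IsEntropyPair (fun v => |v - c|)
    (fun v => (if c ≤ v then (v ^ 2 - c ^ 2) / 2 else 0) +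
      if v < c then (c ^ 2 - v ^ 2) / 2 else 0) := by
  convert (isEntropyPair_posPart c).add (isEntropyPair_negPart c) using 1
  funext v
  rcases le_total c v with h | h
  · rw [abs_of_nonneg (by linarith), max_eq_left (by linarith), max_eq_right (by linarith),
      add_zero]
  · rw [abs_of_nonpos (by linarith), max_eq_right (by linarith), max_eq_left (by linarith)]
    ring

theorem abs_kruzkovFlux_le {v c M : ℝ} (hv : |v| ≤ M) (hc : |c| ≤ M) :
    |(if c ≤ v then (v ^ 2 - c ^ 2) / 2 else 0) + if v < c then (c ^ 2 - v ^ 2) / 2 else 0| ≤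
      M * |v - c| := by
  obtain ⟨h1, h2⟩ := abs_le.1 hv
  obtain ⟨h3, h4⟩ := abs_le.1 hc
  rcases le_or_gt c v with h | h
  · rw [if_pos h, if_neg (not_lt.2 h), add_zero, abs_of_nonneg (sub_nonneg.2 h), abs_le]
    constructor <;> nlinarith
  · rw [if_neg (not_le.2 h), if_pos h, zero_add, abs_of_neg (sub_neg.2 h), abs_le]
    constructor <;> nlinarith

section

variable {u₀ : ℝ → ℝ} {u : ℝ → ℝ → ℝ}

/-- Comparison with constants inside the characteristic cone. -/
theorem IsEntropySolution.cone_estimate (hu : IsEntropySolution (fun v => v ^ 2 / 2) u₀ u) :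
    ∃ C R, 0 ≤ C ∧ 0 < R ∧ ∀ (x₀ c r : ℝ), |c| ≤ 1 → 0 < r →
      r⁻¹ * ∫ p in (Ioi (0 : ℝ) ×ˢ univ) ∩ Metric.closedBall (0, x₀) r, |u p.1 p.2 - c| ≤
        C * ∫ x in Metric.closedBall x₀ (R * r), |u 0 x - c| := by
  obtain ⟨M, hM1, hM⟩ := hu.exists_bound
  obtain ⟨φ, hφ, hφ0, hφ1, hφ2⟩ := exists_cone_function hM1
  obtain ⟨C, hC0, hC⟩ := hφ.exists_bound
  obtain ⟨R, hR0, hR⟩ := hφ.2.isCompact.isBounded.subset_closedBall_lt 0 0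
  refine ⟨C, R, hC0, hR0, fun x₀ c r hc hr => ?_⟩
  have hr' : 0 < r⁻¹ := inv_pos.2 hr
  have hpair := isEntropyPair_abs c
  set Q : ℝ → ℝ := fun v => (if c ≤ v then (v ^ 2 - c ^ 2) / 2 else 0) +
      if v < c then (c ^ 2 - v ^ 2) / 2 else 0 with hQ
  have hφr := hφ.rescale ((0 : ℝ), x₀) hr
  have hT := hu.entropyFunctional_nonneg hpair hφr (fun p => hφ0 _)
  unfold entropyFunctional at hT
  set S : Set (ℝ × ℝ) := (Ioi (0 : ℝ) ×ˢ univ) ∩ Metric.closedBall (0, x₀) r with hS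
  have hSm : MeasurableSet S :=
    measurableSet_upper.inter (Metric.isClosed_closedBall).measurableSet
  have hI := hu.integrableOn_abs_sub c ((0 : ℝ), x₀) r
  -- The cone function makes the integrand nonpositive everywhere and at most `-r⁻¹ |u - c|` on the
  -- ball of radius `r`; the initial trace has to compensate this loss.
  have h1 : ∫ p in Ioi (0 : ℝ) ×ˢ (univ : Set ℝ), (|u p.1 p.2 - c| *
        fderiv ℝ (fun p => φ (r⁻¹ • (p - ((0 : ℝ), x₀)))) p (1, 0) +
        Q (u p.1 p.2) * fderiv ℝ (fun p => φ (r⁻¹ • (p - ((0 : ℝ), x₀)))) p (0, 1)) ≤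
      ∫ p in Ioi (0 : ℝ) ×ˢ (univ : Set ℝ), S.indicator (fun p => -(r⁻¹ * |u p.1 p.2 - c|)) p := by
    refine setIntegral_mono_on (hu.integrableOn_integrand hpair.continuous_left
      hpair.continuous_right hφr) ?_ measurableSet_upper ?_
    · exact ((integrable_indicator_iff hSm).2 (hI.const_mul r⁻¹).neg).integrableOn
    · intro p hp
      have hp1 : 0 < p.1 := hp.1
      -- Here `|c| ≤ 1 ≤ M` is used: the Kružkov flux then travels at speed at most `M`.
      have hQb : |Q (u p.1 p.2)| ≤ M * |u p.1 p.2 - c| :=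
        abs_kruzkovFlux_le (hM _ _ hp1.le) (hc.trans hM1)
      rw [hφ.fderiv_rescale, hφ.fderiv_rescale]
      set q := r⁻¹ • (p - ((0 : ℝ), x₀)) with hq
      have hq1 : 0 < q.1 := by
        have : q.1 = r⁻¹ * p.1 := by simp [hq]
        rw [this]
        positivity
      have hle : |u p.1 p.2 - c| * (r⁻¹ * fderiv ℝ φ q (1, 0)) +
          Q (u p.1 p.2) * (r⁻¹ * fderiv ℝ φ q (0, 1)) ≤
          r⁻¹ * |u p.1 p.2 - c| * (fderiv ℝ φ q (1, 0) + M * |fderiv ℝ φ q (0, 1)|) := by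
        have h3 : Q (u p.1 p.2) * fderiv ℝ φ q (0, 1) ≤
            M * |u p.1 p.2 - c| * |fderiv ℝ φ q (0, 1)| := by
          refine (le_abs_self _).trans ?_
          rw [abs_mul]
          exact mul_le_mul_of_nonneg_right hQb (abs_nonneg _)
        have := mul_le_mul_of_nonneg_left h3 hr'.le
        linarith
      refine hle.trans ?_
      have hnn : 0 ≤ r⁻¹ * |u p.1 p.2 - c| := mul_nonneg hr'.le (abs_nonneg _)
      by_cases hpS : p ∈ S
      · rw [indicator_of_mem hpS]
        have hqn : ‖q‖ ≤ 1 := by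
          rw [hq, norm_smul, Real.norm_eq_abs, abs_of_pos hr', ← div_eq_inv_mul, div_le_one hr]
          exact mem_closedBall_iff_norm.1 hpS.2
        nlinarith [hφ2 q hq1 hqn]
      · rw [indicator_of_notMem hpS]
        exact mul_nonpos_of_nonneg_of_nonpos hnn (hφ1 q hq1)
  rw [setIntegral_indicator hSm, inter_eq_self_of_subset_right inter_subset_left, integral_neg,
    integral_const_mul] at h1
  have h2 : ‖∫ x, |u 0 x - c| * φ (r⁻¹ • ((0, x) - ((0 : ℝ), x₀)))‖ ≤
      C * ∫ x in Metric.closedBall x₀ (R * r), |u 0 x - c| := by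
    rw [← setIntegral_eq_integral_of_forall_compl_eq_zero (s := Metric.closedBall x₀ (R * r))
      (fun x hx => by
        refine mul_eq_zero_of_right _ (image_eq_zero_of_notMem_tsupport fun h => ?_)
        have h := mem_closedBall_zero_iff.1 (hR h)
        refine hx (mem_closedBall_iff_norm.2 ?_)
        rw [norm_smul, Real.norm_eq_abs, abs_of_pos hr', ← div_eq_inv_mul, div_le_iff₀ hr] at h
        refine le_trans ?_ h
        rw [Prod.norm_def]
        exact le_max_right _ _), ← integral_const_mul]
    refine norm_integral_le_of_norm_le (Integrable.const_mul ?_ C) (ae_of_all _ fun x => ?_)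
    · refine Measure.integrableOn_of_bounded (M := M + |c|)
        (isCompact_closedBall _ _).measure_lt_top.ne
        ((hu.measurable_slice 0).sub_const c).abs.aestronglyMeasurable (ae_of_all _ fun x => ?_)
      rw [Real.norm_eq_abs, abs_abs]
      exact (abs_sub _ _).trans (by linarith [hM 0 x le_rfl])
    · rw [norm_mul, Real.norm_eq_abs, abs_abs, mul_comm]
      exact mul_le_mul_of_nonneg_right (hC _) (abs_nonneg _)
  have h3 := le_of_abs_le h2
  linarith

end

/-! ### The datum near the origin, near `±1` and elsewhere -/

theorem oscDatum_eq (x : ℝ) : oscDatum x = Real.sin (Real.log (Real.log x)) := by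
  unfold oscDatum
  rw [Real.log_abs, Real.log_abs]

theorem measurable_oscDatum : Measurable oscDatum := by
  rw [funext oscDatum_eq]
  exact Real.measurable_sin.comp (Real.measurable_log.comp Real.measurable_log)

theorem abs_oscDatum_le (x : ℝ) : |oscDatum x| ≤ 1 := Real.abs_sin_le_one _

theorem oscDatum_neg (x : ℝ) : oscDatum (-x) = oscDatum x := by
  simp [oscDatum_eq, Real.log_neg_eq_log]

theorem continuousAt_oscDatum {x : ℝ} (h0 : x ≠ 0) (h1 : x ≠ 1) (h2 : x ≠ -1) :
    ContinuousAt oscDatum x := by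
  rw [funext oscDatum_eq]
  exact Real.continuous_sin.continuousAt.comp
    ((Real.continuousAt_log (Real.log_ne_zero.2 ⟨h0, h1, h2⟩)).comp (Real.continuousAt_log h0))

theorem tendsto_average_of_continuousAt {f : ℝ → ℝ} {x₀ : ℝ}
    (h : ContinuousAt f x₀) (R : ℝ) (hR : 0 < R) :
    Tendsto (fun r => r⁻¹ * ∫ x in Metric.closedBall x₀ (R * r), |f x - f x₀|) (𝓝[>] 0)
      (𝓝 0) := by
  rw [Metric.tendsto_nhds]
  intro ε hε
  obtain ⟨δ, hδ, hfδ⟩ := Metric.continuousAt_iff.1 h (ε / (4 * R)) (by positivity)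
  filter_upwards [Ioo_mem_nhdsGT (show (0 : ℝ) < δ / R by positivity)] with r hr
  have hr0 : 0 < r := hr.1
  have hRr : R * r < δ := by
    have := (lt_div_iff₀ hR).1 hr.2
    linarith
  have hb := norm_setIntegral_le_of_norm_le_const (μ := volume)
    (s := Metric.closedBall x₀ (R * r)) (f := fun x => |f x - f x₀|) (C := ε / (4 * R))
    (isCompact_closedBall _ _).measure_lt_top (fun x hx => by
      rw [Real.norm_eq_abs, abs_abs]
      exact (hfδ (lt_of_le_of_lt hx hRr)).le)
  rw [Real.volume_real_closedBall (by positivity)] at hb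
  rw [Real.dist_eq, sub_zero, abs_mul, abs_of_pos (inv_pos.2 hr0)]
  have : r⁻¹ * ‖∫ x in Metric.closedBall x₀ (R * r), |f x - f x₀|‖ ≤
      r⁻¹ * (ε / (4 * R) * (2 * (R * r))) :=
    mul_le_mul_of_nonneg_left hb (inv_pos.2 hr0).le
  refine this.trans_lt ?_
  have e : r⁻¹ * (ε / (4 * R) * (2 * (R * r))) = ε / 2 := by
    field_simp
    ring
  rw [e]
  linarith

/-- The slowly oscillating values of the datum near the origin. -/
noncomputable def oscValue (r : ℝ) : ℝ := Real.sin (Real.log (Real.log r))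

/-- From `log (r y) = log r (1 + log y / log r)` the two iterated logarithms differ by `log (1 + log
y / log r)`, which tends to zero. Real logarithms ignore signs, so negative `y` are included. -/
theorem oscDatum_scale_tendsto {y : ℝ} (hy : y ≠ 0) :
    Tendsto (fun r => oscDatum (r * y) - oscValue r) (𝓝[>] 0) (𝓝 0) := by
  have hlog := Real.tendsto_log_nhdsGT_zero
  have h1 : Tendsto (fun r => Real.log y / Real.log r) (𝓝[>] 0) (𝓝 0) :=
    tendsto_const_nhds.div_atBot hlog
  have h2 : Tendsto (fun r => Real.log (1 + Real.log y / Real.log r)) (𝓝[>] 0) (𝓝 0) := by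
    have h3 := h1.const_add 1
    rw [add_zero] at h3
    have := (Real.continuousAt_log one_ne_zero).tendsto.comp h3
    rwa [Real.log_one] at this
  have h3 : ∀ᶠ r in 𝓝[>] (0 : ℝ), 1 + Real.log y / Real.log r ≠ 0 := by
    have h := h1.const_add 1
    rw [add_zero] at h
    exact h.eventually_ne one_ne_zero
  have h4 : ∀ᶠ r in 𝓝[>] (0 : ℝ), Real.log r ≠ 0 := hlog.eventually_ne_atBot 0
  have h5 := h2.abs
  rw [abs_zero] at h5
  refine squeeze_zero_norm' ?_ h5
  filter_upwards [h3, h4, self_mem_nhdsWithin] with r hr3 hr4 hr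
  have hr0 : r ≠ 0 := (mem_Ioi.1 hr).ne'
  have e : Real.log (r * y) = Real.log r * (1 + Real.log y / Real.log r) := by
    rw [Real.log_mul hr0 hy]
    field_simp
  rw [oscDatum_eq, oscValue, e, Real.log_mul hr4 hr3]
  refine (Real.abs_sin_sub_sin_le _ _).trans (le_of_eq ?_)
  rw [add_sub_cancel_left]

theorem abs_oscValue_le (r : ℝ) : |oscValue r| ≤ 1 := Real.abs_sin_le_one _

/-- After the substitution `x = r y` the pointwise limit for `y ≠ 0` passes to the mean by dominated
convergence. -/
theorem oscDatum_average_tendsto (R : ℝ) (hR : 0 < R) :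
    Tendsto (fun r => r⁻¹ * ∫ x in Metric.closedBall 0 (R * r), |oscDatum x - oscValue r|)
      (𝓝[>] 0) (𝓝 0) := by
  have h1 : Tendsto (fun r => ∫ y in Metric.closedBall 0 R, |oscDatum (r * y) - oscValue r|)
      (𝓝[>] 0) (𝓝 (∫ y in Metric.closedBall (0 : ℝ) R, (0 : ℝ))) := by
    refine tendsto_integral_filter_of_dominated_convergence (fun _ => 2) ?_ ?_ ?_ ?_
    · exact Eventually.of_forall fun r => ((measurable_oscDatum.comp
        (measurable_const_mul r)).sub_const _).abs.aestronglyMeasurable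
    · refine Eventually.of_forall fun r => ae_of_all _ fun y => ?_
      rw [Real.norm_eq_abs, abs_abs]
      exact (abs_sub _ _).trans (by linarith [abs_oscDatum_le (r * y), abs_oscValue_le r])
    · exact integrableOn_const (isCompact_closedBall _ _).measure_lt_top.ne
    · have : ∀ᵐ y : ℝ, y ≠ 0 := by simp [ae_iff, measure_singleton]
      refine ae_restrict_of_ae ?_
      filter_upwards [this] with y hy
      have := (oscDatum_scale_tendsto hy).abs
      rwa [abs_zero] at this
  rw [integral_zero] at h1
  refine h1.congr' ?_
  filter_upwards [self_mem_nhdsWithin] with r hr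
  have hr0 : 0 < r := hr
  have := Measure.setIntegral_comp_smul_of_pos volume
    (fun x => |oscDatum x - oscValue r|) (Metric.closedBall (0 : ℝ) R) hr0
  rw [smul_closedBall r 0 hR.le] at this
  simp only [smul_eq_mul, Module.finrank_self, pow_one, mul_zero, Real.norm_eq_abs,
    abs_of_pos hr0] at this
  rw [this, mul_comm r R]

/-- Away from `±1` the datum is close to constants at small scales. -/
theorem exists_oscDatum_average_tendsto {x₀ : ℝ} (h1 : x₀ ≠ 1) (h2 : x₀ ≠ -1) :
    ∃ c : ℝ → ℝ, (∀ r, |c r| ≤ 1) ∧ ∀ R, 0 < R →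
      Tendsto (fun r => r⁻¹ * ∫ x in Metric.closedBall x₀ (R * r), |oscDatum x - c r|)
        (𝓝[>] 0) (𝓝 0) := by
  rcases eq_or_ne x₀ 0 with rfl | h0
  · exact ⟨oscValue, abs_oscValue_le, oscDatum_average_tendsto⟩
  · exact ⟨fun _ => oscDatum x₀, fun _ => abs_oscDatum_le x₀, fun R hR =>
      tendsto_average_of_continuousAt (continuousAt_oscDatum h0 h1 h2) R hR⟩

theorem oscValue_not_tendsto (c : ℝ) : ¬ Tendsto oscValue (𝓝[>] 0) (𝓝 c) := by
  intro h
  -- Along these scales the value is exactly `sin θ`, so every `sin θ` would have to equal the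
  -- limit.
  have key : ∀ θ : ℝ, Tendsto (fun n : ℕ => Real.exp (-Real.exp (θ + n * (2 * Real.pi)))) atTop
      (𝓝[>] 0) := by
    intro θ
    refine tendsto_nhdsWithin_iff.2 ⟨?_, Eventually.of_forall fun n => Real.exp_pos _⟩
    refine Real.tendsto_exp_atBot.comp (tendsto_neg_atTop_atBot.comp (Real.tendsto_exp_atTop.comp ?_))
    exact tendsto_atTop_add_const_left _ _
      (tendsto_natCast_atTop_atTop.atTop_mul_const Real.two_pi_pos)
  have key2 : ∀ θ : ℝ, Real.sin θ = c := by
    intro θ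
    refine tendsto_nhds_unique (tendsto_const_nhds.congr fun n => ?_) (h.comp (key θ))
    simp only [Function.comp, oscValue]
    rw [Real.log_exp, Real.log_neg_eq_log, Real.log_exp, Real.sin_add_nat_mul_two_pi]
  have h1 := key2 0
  have h2 := key2 (Real.pi / 2)
  rw [Real.sin_zero] at h1
  rw [Real.sin_pi_div_two] at h2
  linarith

/-- At `s = ±1` the logarithm has a simple zero with slope of modulus one, so `log|log|s + r y|| =
log r + log|y| + o(1)`. The scales `r = exp (θ - 2πn)` make the sine of this converge. -/
theorem oscDatum_scale_one_tendsto {s : ℝ} (hs : |s| = 1) {y : ℝ} (hy : y ≠ 0) (θ : ℝ) :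
    Tendsto (fun n : ℕ => oscDatum (s + Real.exp (θ - n * (2 * Real.pi)) * y)) atTop
      (𝓝 (Real.sin (θ + Real.log y))) := by
  have hs0 : s ≠ 0 := by
    rintro rfl
    simp at hs
  have hr : Tendsto (fun n : ℕ => Real.exp (θ - n * (2 * Real.pi))) atTop (𝓝 0) := by
    refine Real.tendsto_exp_atBot.comp ?_
    refine tendsto_atBot_add_const_left _ _ (tendsto_neg_atTop_atBot.comp ?_)
    exact tendsto_natCast_atTop_atTop.atTop_mul_const Real.two_pi_pos
  have hd := hasDerivAt_iff_tendsto_slope_zero.1 (Real.hasDerivAt_log hs0)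
  have hls : Real.log s = 0 := by rw [← Real.log_abs, hs, Real.log_one]
  have h1 : Tendsto (fun n : ℕ => (Real.exp (θ - n * (2 * Real.pi)) * y)⁻¹ *
      Real.log (s + Real.exp (θ - n * (2 * Real.pi)) * y)) atTop (𝓝 s⁻¹) := by
    have h2 : Tendsto (fun n : ℕ => Real.exp (θ - n * (2 * Real.pi)) * y) atTop (𝓝[≠] 0) := by
      refine tendsto_nhdsWithin_iff.2 ⟨?_, Eventually.of_forall fun n =>
        mul_ne_zero (Real.exp_pos _).ne' hy⟩
      simpa using hr.mul_const y
    have := hd.comp h2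
    simpa [Function.comp_def, hls] using this
  have h2 : Tendsto (fun n : ℕ => Real.log ((Real.exp (θ - n * (2 * Real.pi)) * y)⁻¹ *
      Real.log (s + Real.exp (θ - n * (2 * Real.pi)) * y))) atTop (𝓝 (Real.log s⁻¹)) :=
    (Real.continuousAt_log (inv_ne_zero hs0)).tendsto.comp h1
  rw [Real.log_inv, hls, neg_zero] at h2
  have h3 := (Real.continuous_sin.tendsto _).comp (h2.const_add (θ + Real.log y))
  rw [add_zero] at h3
  refine h3.congr' ?_
  filter_upwards [h1.eventually_ne (inv_ne_zero hs0)] with n hn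
  have hn2 := right_ne_zero_of_mul hn
  simp only [Function.comp]
  rw [oscDatum_eq, Real.log_mul (left_ne_zero_of_mul hn) hn2, Real.log_inv,
    Real.log_mul (Real.exp_pos _).ne' hy, Real.log_exp]
  refine Eq.trans (congrArg Real.sin ?_) (Real.sin_add_nat_mul_two_pi _ n)
  ring

/-- At `±1` the rescaled datum has no weak limit which is a constant. -/
theorem oscDatum_not_weakly_tendsto {s : ℝ} (hs : |s| = 1) (c : ℝ) :
    ¬ ∀ β : ℝ → ℝ, IsTestFunction β →
      Tendsto (fun r => ∫ y, (oscDatum (s + r * y) - c) * β y) (𝓝[>] 0) (𝓝 0) := by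
  intro h
  -- The support `[1, 3]` is chosen so that `0 < log y < π`, hence `sin (log y) > 0`, on its
  -- interior.
  let b : ContDiffBump (2 : ℝ) := ⟨1 / 2, 1, by norm_num, by norm_num⟩
  have hb : IsTestFunction b := ⟨b.contDiff, b.hasCompactSupport⟩
  have hbi : Integrable (b : ℝ → ℝ) := hb.integrable volume
  have hr : ∀ θ : ℝ, Tendsto (fun n : ℕ => Real.exp (θ - n * (2 * Real.pi))) atTop (𝓝[>] 0) := by
    intro θ
    refine tendsto_nhdsWithin_iff.2 ⟨?_, Eventually.of_forall fun n => Real.exp_pos _⟩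
    refine Real.tendsto_exp_atBot.comp ?_
    refine tendsto_atBot_add_const_left _ _ (tendsto_neg_atTop_atBot.comp ?_)
    exact tendsto_natCast_atTop_atTop.atTop_mul_const Real.two_pi_pos
  have key : ∀ θ : ℝ, ∫ y, (Real.sin (θ + Real.log y) - c) * b y = 0 := by
    intro θ
    refine tendsto_nhds_unique ?_ ((h b hb).comp (hr θ))
    refine tendsto_integral_of_dominated_convergence (fun y => (1 + |c|) * b y) ?_
      (hbi.const_mul _) ?_ ?_
    · exact fun n => (((measurable_oscDatum.comp ((measurable_const_mul _).const_add s)).sub_const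
        c).mul b.continuous.measurable).aestronglyMeasurable
    · refine fun n => ae_of_all _ fun y => ?_
      rw [norm_mul, Real.norm_eq_abs, Real.norm_eq_abs, abs_of_nonneg (b.nonneg (x := y))]
      refine mul_le_mul_of_nonneg_right ?_ b.nonneg
      exact (abs_sub _ _).trans (add_le_add_left (abs_oscDatum_le _) _)
    · have : ∀ᵐ y : ℝ, y ≠ 0 := by simp [ae_iff, measure_singleton]
      filter_upwards [this] with y hy
      exact ((oscDatum_scale_one_tendsto hs hy θ).sub_const c).mul_const _
  have hm : ∀ θ, Integrable fun y => (Real.sin (θ + Real.log y) - c) * b y := by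
    intro θ
    refine hbi.bdd_mul (c := 1 + |c|) ?_ (ae_of_all _ fun y => ?_)
    · exact ((Real.measurable_sin.comp (Real.measurable_log.const_add θ)).sub_const
        c).aestronglyMeasurable
    · exact (abs_sub _ _).trans (by linarith [Real.abs_sin_le_one (θ + Real.log y)])
  -- The phases `0` and `π` have opposite profiles; subtracting the two limits eliminates `c`.
  have hdiff : ∫ y, 2 * (Real.sin (Real.log y) * b y) = 0 := by
    have e : ∀ y, 2 * (Real.sin (Real.log y) * b y) = (Real.sin (0 + Real.log y) - c) * b y -
        (Real.sin (Real.pi + Real.log y) - c) * b y := by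
      intro y
      rw [add_comm Real.pi, Real.sin_add_pi, zero_add]
      ring
    simp_rw [e]
    rw [integral_sub (hm 0) (hm Real.pi), key, key, sub_zero]
  have hpos : ∀ y ∈ Metric.ball (2 : ℝ) 1, 0 < Real.sin (Real.log y) := by
    intro y hy
    have hy' := abs_lt.1 (mem_ball_iff_norm.1 hy)
    refine Real.sin_pos_of_pos_of_lt_pi (Real.log_pos (by linarith [hy'.1])) ?_
    have := Real.log_le_sub_one_of_pos (show 0 < y by linarith [hy'.1])
    linarith [hy'.2, Real.pi_gt_three]
  have hz : ∀ y, y ∉ Metric.ball (2 : ℝ) 1 → b y = 0 := fun y hy =>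
    b.zero_of_le_dist (not_lt.1 hy)
  have hi : Integrable fun y => 2 * (Real.sin (Real.log y) * b y) := by
    refine Integrable.const_mul (hbi.bdd_mul (c := 1) ?_ (ae_of_all _ fun y =>
      Real.abs_sin_le_one _)) 2
    exact (Real.measurable_sin.comp Real.measurable_log).aestronglyMeasurable
  have hgt : 0 < ∫ y, 2 * (Real.sin (Real.log y) * b y) := by
    rw [integral_pos_iff_support_of_nonneg _ hi]
    · refine lt_of_lt_of_le (Metric.measure_ball_pos volume (2 : ℝ) one_pos) (measure_mono ?_)
      intro y hy
      have hby : 0 < b y := b.pos_of_mem_ball hy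
      have := hpos y hy
      simp only [Function.mem_support]
      positivity
    · intro y
      by_cases hy : y ∈ Metric.ball (2 : ℝ) 1
      · have := hpos y hy
        exact mul_nonneg zero_le_two (mul_nonneg this.le b.nonneg)
      · simp [hz y hy]
  linarith

/-! ### The Lax–Oleinik value function -/

/-- The cost of the straight characteristic with speed `p` through `(t, x)`. -/
noncomputable def laxCost (h : ℝ → ℝ) (p : ℝ) (z : ℝ × ℝ) : ℝ :=
  h (z.2 - z.1 * p) + z.1 * (p ^ 2 / 2)

/-- The Lax–Oleinik value function for initial data with Lipschitz constant one. -/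
noncomputable def laxOleinik (h : ℝ → ℝ) (z : ℝ × ℝ) : ℝ :=
  sInf ((fun p => laxCost h p z) '' Icc (-3) 3)

section LaxOleinik

variable {h : ℝ → ℝ} (hh : LipschitzWith 1 h)
include hh

theorem LipschitzWith.abs_sub_le_of_one (a b : ℝ) : |h a - h b| ≤ |a - b| := by
  have := hh.dist_le_mul a b
  rwa [NNReal.coe_one, one_mul, Real.dist_eq, Real.dist_eq] at this

theorem exists_laxOleinik_eq (z : ℝ × ℝ) : ∃ p ∈ Icc (-3 : ℝ) 3,
    laxOleinik h z = laxCost h p z ∧ ∀ q ∈ Icc (-3 : ℝ) 3, laxCost h p z ≤ laxCost h q z := by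
  have hc : Continuous fun p => laxCost h p z := by
    unfold laxCost
    exact (hh.continuous.comp (by fun_prop)).add (by fun_prop)
  obtain ⟨p, hp, hmin⟩ := isCompact_Icc.exists_isMinOn (nonempty_Icc.2 (by norm_num : (-3 : ℝ) ≤ 3))
    hc.continuousOn
  refine ⟨p, hp, ?_, fun q hq => hmin hq⟩
  refine (IsLeast.csInf_eq ⟨mem_image_of_mem _ hp, ?_⟩)
  rintro _ ⟨q, hq, rfl⟩
  exact hmin hq

theorem laxOleinik_le {p : ℝ} (hp : p ∈ Icc (-3 : ℝ) 3) (z : ℝ × ℝ) :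
    laxOleinik h z ≤ laxCost h p z := by
  obtain ⟨q, -, h1, h2⟩ := exists_laxOleinik_eq hh z
  exact h1.trans_le (h2 p hp)

/-- Both points are compared along the slope that is optimal for one of them; the three
contributions `1`, `3` and `9 / 2` add up to less than `9`. -/
theorem laxOleinik_lipschitz : LipschitzWith 9 (laxOleinik h) := by
  refine LipschitzWith.of_le_add_mul 9 fun a b => ?_
  obtain ⟨p, hp, h1, -⟩ := exists_laxOleinik_eq hh b
  refine (laxOleinik_le hh hp a).trans ?_
  rw [h1]
  unfold laxCost
  have e1 := le_of_abs_le (hh.abs_sub_le_of_one (a.2 - a.1 * p) (b.2 - b.1 * p))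
  have e2 : |a.2 - a.1 * p - (b.2 - b.1 * p)| ≤ |a.2 - b.2| + |a.1 - b.1| * |p| := by
    rw [← abs_mul]
    have : a.2 - a.1 * p - (b.2 - b.1 * p) = (a.2 - b.2) - (a.1 - b.1) * p := by ring
    rw [this]
    exact abs_sub _ _
  have hp3 : |p| ≤ 3 := abs_le.2 hp
  have hd1 : |a.1 - b.1| ≤ dist a b := by
    rw [Prod.dist_eq]
    exact le_max_left _ _
  have hd2 : |a.2 - b.2| ≤ dist a b := by
    rw [Prod.dist_eq]
    exact le_max_right _ _
  have e3 : |a.1 - b.1| * |p| ≤ dist a b * 3 :=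
    mul_le_mul hd1 hp3 (abs_nonneg _) dist_nonneg
  have e4 : (a.1 - b.1) * (p ^ 2 / 2) ≤ dist a b * (9 / 2) := by
    refine (mul_le_mul_of_nonneg_right ((le_abs_self _).trans hd1) (by positivity)).trans ?_
    refine mul_le_mul_of_nonneg_left ?_ dist_nonneg
    nlinarith [hp.1, hp.2]
  have hd0 : 0 ≤ dist a b := dist_nonneg
  have : ((9 : NNReal) : ℝ) = 9 := rfl
  rw [this]
  linarith

theorem laxOleinik_zero (x : ℝ) : laxOleinik h (0, x) = h x := by
  obtain ⟨p, -, h1, -⟩ := exists_laxOleinik_eq hh (0, x)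
  rw [h1]
  simp [laxCost]

/-- Removes the restriction to speeds in `[-3, 3]`: if the slope from `y` to `x` is larger, the
quadratic cost exceeds `|x - y|`, and by the Lipschitz bound the zero slope is already cheaper. -/
theorem laxOleinik_le_of_pos {t : ℝ} (ht : 0 < t) (x y : ℝ) :
    laxOleinik h (t, x) ≤ h y + (x - y) ^ 2 / (2 * t) := by
  have e : laxCost h ((x - y) / t) (t, x) = h y + (x - y) ^ 2 / (2 * t) := by
    unfold laxCost
    have : x - t * ((x - y) / t) = y := by
      field_simp
      ring
    rw [this]
    field_simp
  by_cases hp : (x - y) / t ∈ Icc (-3 : ℝ) 3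
  · exact (laxOleinik_le hh hp _).trans e.le
  · have h3 : 3 < |(x - y) / t| := by
      by_contra hcon
      exact hp (abs_le.1 (not_lt.1 hcon))
    rw [abs_div, abs_of_pos ht, lt_div_iff₀ ht] at h3
    have h0 := laxOleinik_le hh (p := 0) (by norm_num) (t, x)
    simp only [laxCost, mul_zero, sub_zero, ne_eq, OfNat.ofNat_ne_zero, not_false_eq_true,
      zero_pow, zero_div, add_zero] at h0
    have h1 := le_of_abs_le (hh.abs_sub_le_of_one x y)
    have h2 : |x - y| ≤ (x - y) ^ 2 / (2 * t) := by
      rw [le_div_iff₀ (by positivity), ← sq_abs (x - y)]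
      nlinarith
    linarith

/-- Comparison with the zero slope gives `t p² / 2 ≤ t |p|`, so minimisers have speed at most `2`.
-/
theorem exists_laxOleinik_minimizer {t : ℝ} (ht : 0 < t) (x : ℝ) :
    ∃ y, laxOleinik h (t, x) = h y + (x - y) ^ 2 / (2 * t) ∧ |(x - y) / t| ≤ 2 := by
  obtain ⟨p, hp, h1, h2⟩ := exists_laxOleinik_eq hh (t, x)
  refine ⟨x - t * p, ?_, ?_⟩
  · rw [h1]
    unfold laxCost
    simp only [sub_sub_cancel]
    field_simp
  · have e : (x - (x - t * p)) / t = p := by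
      field_simp
      ring
    rw [e]
    have h3 := h2 0 (by norm_num)
    simp only [laxCost, mul_zero, sub_zero, ne_eq, OfNat.ofNat_ne_zero, not_false_eq_true,
      zero_pow, zero_div, add_zero] at h3
    have h4 := le_of_abs_le (hh.abs_sub_le_of_one x (x - t * p))
    rw [sub_sub_cancel, abs_mul, abs_of_pos ht] at h4
    have h5 : t * (p ^ 2 / 2) ≤ t * |p| := by linarith
    have h6 := le_of_mul_le_mul_left h5 ht
    rw [← sq_abs] at h6
    nlinarith [abs_nonneg p]

/-- The smooth function `h y + (x - y)² / (2t)` touches the value function from above at the given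
point, so the two gradients agree there. -/
theorem laxOleinik_fderiv {t x y : ℝ} (ht : 0 < t)
    (hd : DifferentiableAt ℝ (laxOleinik h) (t, x))
    (hy : laxOleinik h (t, x) = h y + (x - y) ^ 2 / (2 * t)) :
    fderiv ℝ (laxOleinik h) (t, x) (1, 0) = -((x - y) / t) ^ 2 / 2 ∧
      fderiv ℝ (laxOleinik h) (t, x) (0, 1) = (x - y) / t := by
  let f : ℝ × ℝ → ℝ := fun z => (z.2 - y) ^ 2 * (2 * z.1)⁻¹
  have hf : HasFDerivAt f ((x - y) ^ 2 • ((-((2 * t) ^ 2)⁻¹) • ((2 : ℝ) •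
      ContinuousLinearMap.fst ℝ ℝ ℝ)) + (2 * t)⁻¹ • ((2 * (x - y)) •
      ContinuousLinearMap.snd ℝ ℝ ℝ)) (t, x) := by
    have h1 : HasFDerivAt (fun z : ℝ × ℝ => (z.2 - y) ^ 2)
        ((2 * (x - y)) • ContinuousLinearMap.snd ℝ ℝ ℝ) (t, x) := by
      have := (hasFDerivAt_snd (𝕜 := ℝ) (E := ℝ) (F := ℝ) (p := (t, x))).sub_const y |>.pow 2
      refine this.congr_fderiv ?_
      ext <;> simp
    have h2 : HasFDerivAt (fun z : ℝ × ℝ => 2 * z.1) ((2 : ℝ) • ContinuousLinearMap.fst ℝ ℝ ℝ)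
        (t, x) := hasFDerivAt_fst.const_mul 2
    have h3 : HasFDerivAt (fun z : ℝ × ℝ => (2 * z.1)⁻¹)
        ((-((2 * t) ^ 2)⁻¹) • ((2 : ℝ) • ContinuousLinearMap.fst ℝ ℝ ℝ)) (t, x) :=
      HasDerivAt.comp_hasFDerivAt (h₂ := fun s : ℝ => s⁻¹) (t, x)
        (hasDerivAt_inv (by positivity : (2 * t) ≠ 0)) h2
    exact h1.fun_mul h3
  have hmin : IsLocalMin (fun z => f z - laxOleinik h z) (t, x) := by
    have hpos : ∀ᶠ z : ℝ × ℝ in 𝓝 (t, x), 0 < z.1 :=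
      (isOpen_lt continuous_const continuous_fst).mem_nhds (mem_ofPred.2 ht)
    filter_upwards [hpos] with z hz
    have := laxOleinik_le_of_pos hh hz z.2 y
    simp only [f, ← div_eq_mul_inv]
    rw [hy]
    linarith
  have h0 := hmin.fderiv_eq_zero
  have h1 := (hf.sub hd.hasFDerivAt).fderiv
  have h2 : fderiv ℝ (fun z => f z - laxOleinik h z) (t, x) = fderiv ℝ (f - laxOleinik h) (t, x) :=
    rfl
  rw [h2, h1] at h0
  constructor
  · have := DFunLike.congr_fun h0 ((1 : ℝ), (0 : ℝ))
    simp at this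
    rw [← sub_eq_zero.1 this]
    field_simp
  · have := DFunLike.congr_fun h0 ((0 : ℝ), (1 : ℝ))
    simp at this
    rw [← sub_eq_zero.1 this]
    field_simp

/-- The touching argument on a single time slice, needed because differentiability in `x` at a fixed
time does not give joint differentiability. -/
theorem laxOleinik_deriv {t x y : ℝ} (ht : 0 < t)
    (hd : DifferentiableAt ℝ (fun x => laxOleinik h (t, x)) x)
    (hy : laxOleinik h (t, x) = h y + (x - y) ^ 2 / (2 * t)) :
    deriv (fun x => laxOleinik h (t, x)) x = (x - y) / t := by
  have hf : HasDerivAt (fun x => (x - y) ^ 2 / (2 * t)) ((x - y) / t) x := by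
    refine ((((hasDerivAt_id x).sub_const y).pow 2).div_const (2 * t)).congr_deriv ?_
    simp
    field_simp
  have hmin : IsLocalMin (fun x => (x - y) ^ 2 / (2 * t) - laxOleinik h (t, x)) x := by
    refine Eventually.of_forall fun z => ?_
    have := laxOleinik_le_of_pos hh ht z y
    simp only
    rw [hy]
    linarith
  have h0 := hmin.deriv_eq_zero
  have h1 := (hf.fun_sub hd.hasDerivAt).deriv
  rw [h1] at h0
  linarith

/-- The one-sided Lipschitz bound of Oleinik. -/
theorem laxOleinik_oleinik {t x k y y' : ℝ} (ht : 0 < t) (hk : 0 < k)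
    (hy : laxOleinik h (t, x) = h y + (x - y) ^ 2 / (2 * t))
    (hy' : laxOleinik h (t, x + k) = h y' + (x + k - y') ^ 2 / (2 * t)) :
    (x + k - y') / t - (x - y) / t ≤ k / t := by
  -- Exchanging the two minimisers and adding the inequalities shows `y ≤ y'`: optimal
  -- characteristics do not cross.
  have h1 := laxOleinik_le_of_pos hh ht x y'
  have h2 := laxOleinik_le_of_pos hh ht (x + k) y
  rw [hy] at h1
  rw [hy'] at h2
  have h3 : (x - y) ^ 2 / (2 * t) + (x + k - y') ^ 2 / (2 * t) ≤
      (x - y') ^ 2 / (2 * t) + (x + k - y) ^ 2 / (2 * t) := by linarith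
  rw [← add_div, ← add_div, div_le_div_iff_of_pos_right (by positivity)] at h3
  have h4 : 0 ≤ k * (y' - y) := by nlinarith
  have h5 : 0 ≤ y' - y := nonneg_of_mul_nonneg_right h4 hk
  rw [← sub_div, div_le_div_iff_of_pos_right ht]
  linarith

end LaxOleinik

/-! ### Continuity in time of the Lax–Oleinik solution -/

/-- The spatial derivative of the Lax–Oleinik value function. -/
noncomputable def laxSolution (h : ℝ → ℝ) (t x : ℝ) : ℝ :=
  deriv (fun x => laxOleinik h (t, x)) x

section LaxSolution

variable {h : ℝ → ℝ} (hh : LipschitzWith 1 h)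
include hh

theorem measurable_laxSolution : Measurable (Function.uncurry (laxSolution h)) := by
  have hc : Continuous (Function.uncurry fun t x : ℝ => laxOleinik h (t, x)) :=
    (laxOleinik_lipschitz hh).continuous
  exact measurable_deriv_with_param hc

theorem laxOleinik_slice_lipschitz (t : ℝ) : LipschitzWith 9 fun x => laxOleinik h (t, x) := by
  have := (laxOleinik_lipschitz hh).comp (LipschitzWith.prodMk_left (α := ℝ) (β := ℝ) t)
  rw [mul_one] at this
  exact this

theorem abs_laxSolution_le (t x : ℝ) : |laxSolution h t x| ≤ 9 := by
  have := norm_deriv_le_of_lipschitz (x₀ := x) (laxOleinik_slice_lipschitz hh t)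
  exact this

theorem laxOleinik_abs_sub_le (s t x : ℝ) :
    |laxOleinik h (t, x) - laxOleinik h (s, x)| ≤ 9 * |t - s| := by
  have := (laxOleinik_lipschitz hh).dist_le_mul (t, x) (s, x)
  simpa [Prod.dist_eq, Real.dist_eq] using this

/-- Semiconcavity: the touching parabola at `x`, expanded in `k`. -/
theorem laxOleinik_le_quadratic {t x : ℝ} (ht : 0 < t)
    (hd : DifferentiableAt ℝ (fun x => laxOleinik h (t, x)) x) (k : ℝ) :
    laxOleinik h (t, x + k) ≤ laxOleinik h (t, x) + laxSolution h t x * k + k ^ 2 / (2 * t) := by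
  obtain ⟨y, hy, -⟩ := exists_laxOleinik_minimizer hh ht x
  rw [laxSolution, laxOleinik_deriv hh ht hd hy, hy]
  refine (laxOleinik_le_of_pos hh ht (x + k) y).trans_eq ?_
  field_simp
  ring

/-- The value functions at times `t` and `s` are uniformly close, and at time `t` the graph lies
below a parabola with slope `laxSolution h t x`. Testing with increments `±d` pins this slope to the
derivative at time `s`. -/
theorem laxSolution_eventually_of_pos {s x : ℝ} (hs : 0 < s)
    (hd : DifferentiableAt ℝ (fun x => laxOleinik h (s, x)) x) {ε : ℝ} (hε : 0 < ε) :
    ∀ᶠ t in 𝓝 s, DifferentiableAt ℝ (fun x => laxOleinik h (t, x)) x →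
      |laxSolution h t x - laxSolution h s x| ≤ ε := by
  have h1 := hd.hasDerivAt.isLittleO
  have h2 := (Metric.eventually_nhds_iff.1 (h1.bound (by positivity : 0 < ε / 3)))
  obtain ⟨δ, hδ, h3⟩ := h2
  -- Three errors of size `ε d / 3` are allowed: the linearisation at time `s`, the parabola (with
  -- `t > s / 2`), and the change of the value function in time, which occurs twice with constant
  -- `9`; hence `d ε / 54` below.
  set d := min (δ / 2) (s * ε / 3) with hdd
  have hd0 : 0 < d := by positivity
  have e1 : ∀ᶠ t in 𝓝 s, s / 2 < t := lt_mem_nhds (by linarith)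
  have e2 : ∀ᶠ t in 𝓝 s, dist t s < d * ε / 54 := Metric.ball_mem_nhds s (by positivity)
  filter_upwards [e1, e2] with t ht1 ht2 hdt
  have ht : 0 < t := by linarith
  rw [Real.dist_eq] at ht2
  have key : ∀ k : ℝ, |k| = d →
      (laxSolution h s x - laxSolution h t x) * k ≤ ε * d := by
    intro k hk
    have a1 := laxOleinik_le_quadratic hh ht hdt k
    have a2 := abs_le.1 (laxOleinik_abs_sub_le hh s t x)
    have a3 := abs_le.1 (laxOleinik_abs_sub_le hh s t (x + k))
    have a4 : dist (x + k) x < δ := by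
      rw [Real.dist_eq, add_sub_cancel_left, hk]
      have := min_le_left (δ / 2) (s * ε / 3)
      linarith
    have a5 := h3 a4
    rw [add_sub_cancel_left, Real.norm_eq_abs, Real.norm_eq_abs, hk, smul_eq_mul] at a5
    have a6 := (abs_le.1 a5).1
    have a7 : k ^ 2 / (2 * t) ≤ ε / 3 * d := by
      rw [div_le_iff₀ (by positivity), ← sq_abs, hk]
      have : d ≤ s * ε / 3 := min_le_right _ _
      nlinarith [mul_pos hd0 hε, mul_le_mul_of_nonneg_left this hd0.le,
        mul_pos (mul_pos hd0 hε) ht]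
    change _ ≤ laxOleinik h (s, x + k) - laxOleinik h (s, x) - k * laxSolution h s x at a6
    linarith
  have k1 := key d (abs_of_pos hd0)
  have k2 := key (-d) (by rw [abs_neg, abs_of_pos hd0])
  have k1' := le_of_mul_le_mul_right k1 hd0
  have k2' : laxSolution h t x - laxSolution h s x ≤ ε :=
    le_of_mul_le_mul_right (by linarith) hd0
  rw [abs_le]
  constructor <;> linarith

/-- Here the parabola degenerates. Instead the minimising speed `q` is compared with the speed `p =
deriv h x`: linearising `h` at `x` leaves `t (q - p)² / 2` bounded by an error of order `ε² t`. -/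
theorem laxSolution_eventually_of_zero {x : ℝ} (hd : DifferentiableAt ℝ h x) {ε : ℝ}
    (hε : 0 < ε) :
    ∀ᶠ t in 𝓝[Ici 0] (0 : ℝ), DifferentiableAt ℝ (fun x => laxOleinik h (t, x)) x →
      |laxSolution h t x - laxSolution h 0 x| ≤ ε := by
  have e0 : laxSolution h 0 x = deriv h x := by
    rw [laxSolution]
    congr 1
    exact funext fun x => laxOleinik_zero hh x
  have h1 := hd.hasDerivAt.isLittleO
  obtain ⟨δ, hδ, h3⟩ := (Metric.eventually_nhds_iff.1 (h1.bound (by positivity : 0 < ε ^ 2 / 6)))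
  have e2 : ∀ᶠ t in 𝓝[Ici 0] (0 : ℝ), dist t 0 < δ / 3 :=
    mem_nhdsWithin_of_mem_nhds (Metric.ball_mem_nhds 0 (by positivity))
  filter_upwards [e2, self_mem_nhdsWithin] with t ht2 ht0 hdt
  rcases (mem_Ici.1 ht0).eq_or_lt with rfl | ht
  · simpa using hε.le
  rw [Real.dist_eq, sub_zero, abs_of_pos ht] at ht2
  obtain ⟨y, hy, hy2⟩ := exists_laxOleinik_minimizer hh ht x
  have hq : laxSolution h t x = (x - y) / t := laxOleinik_deriv hh ht hdt hy
  rw [e0]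
  set q := laxSolution h t x
  set p := deriv h x with hp
  rw [← hq] at hy2
  have hyq : y = x - t * q := by
    rw [hq]
    field_simp
    ring
  have hp1 : |p| ≤ 1 := by simpa using norm_deriv_le_of_lipschitz (x₀ := x) hh
  have a1 := laxOleinik_le_of_pos hh ht x (x - t * p)
  rw [hy, hyq] at a1
  have b1 : (x - (x - t * q)) ^ 2 / (2 * t) = t * q ^ 2 / 2 := by
    field_simp
    ring
  have b2 : (x - (x - t * p)) ^ 2 / (2 * t) = t * p ^ 2 / 2 := by
    field_simp
    ring
  rw [b1, b2] at a1
  have key : ∀ v : ℝ, |v| ≤ 2 → |h (x - t * v) - h x + t * v * p| ≤ ε ^ 2 / 6 * (t * |v|) := by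
    intro v hv
    have : dist (x - t * v) x < δ := by
      rw [Real.dist_eq, sub_sub_cancel_left, abs_neg, abs_mul, abs_of_pos ht]
      nlinarith
    have a := h3 this
    rw [sub_sub_cancel_left, Real.norm_eq_abs, Real.norm_eq_abs, smul_eq_mul, abs_neg, abs_mul,
      abs_of_pos ht, neg_mul, sub_neg_eq_add] at a
    exact a
  have c1 := (abs_le.1 (key q hy2)).1
  have c2 := (abs_le.1 (key p (hp1.trans (by norm_num)))).2
  have c3 : ε ^ 2 / 6 * (t * |q|) ≤ ε ^ 2 / 6 * (t * 2) := by gcongr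
  have c4 : ε ^ 2 / 6 * (t * |p|) ≤ ε ^ 2 / 6 * (t * 1) := by gcongr
  have c5 : t * (q - p) ^ 2 ≤ t * ε ^ 2 := by nlinarith
  exact abs_le_of_sq_le_sq (le_of_mul_le_mul_left c5 ht) hε.le

theorem laxSolution_continuous_L1loc {R s : ℝ} (hs : 0 ≤ s) :
    Tendsto (fun t : ℝ => ∫ x in Icc (-R) R, |laxSolution h t x - laxSolution h s x|)
      (𝓝[Ici 0] s) (𝓝 0) := by
  have hm : ∀ t, Measurable (laxSolution h t) := fun t =>
    (measurable_laxSolution hh).of_uncurry_left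
  -- The exceptional set of nondifferentiability depends on the time; along a sequence the union of
  -- these sets is still null.
  refine tendsto_of_seq_tendsto fun τ hτ => ?_
  have hm' : ∀ n, Measurable fun x => |laxSolution h (τ n) x - laxSolution h s x| := fun n =>
    measurable_abs.comp ((hm (τ n)).sub (hm s))
  have hc : Integrable (fun _ : ℝ => (18 : ℝ)) (volume.restrict (Icc (-R) R)) := integrable_const 18
  suffices key : Tendsto (fun n => ∫ x in Icc (-R) R, |laxSolution h (τ n) x - laxSolution h s x|)
      atTop (𝓝 (∫ _ in Icc (-R) R, (0 : ℝ))) by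
    rwa [integral_zero] at key
  refine tendsto_integral_of_dominated_convergence (fun _ => (18 : ℝ))
    (fun n => (hm' n).aestronglyMeasurable)
    hc (fun n => ae_of_all _ fun x => ?_) (ae_restrict_of_ae ?_)
  · rw [Real.norm_eq_abs, abs_abs]
    have := abs_sub (laxSolution h (τ n) x) (laxSolution h s x)
    linarith [abs_laxSolution_le hh (τ n) x, abs_laxSolution_le hh s x]
  · have d0 := (laxOleinik_slice_lipschitz hh s).ae_differentiableAt_real
    have d1 : ∀ᵐ x, ∀ n, DifferentiableAt ℝ (fun x => laxOleinik h (τ n, x)) x :=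
      ae_all_iff.2 fun n => (laxOleinik_slice_lipschitz hh (τ n)).ae_differentiableAt_real
    filter_upwards [d0, d1] with x h0 h1
    rw [Metric.tendsto_atTop']
    have : ∀ ε > 0, ∀ᶠ n in atTop, |laxSolution h (τ n) x - laxSolution h s x| ≤ ε := by
      intro ε hε
      have : ∀ᶠ t in 𝓝[Ici 0] s, DifferentiableAt ℝ (fun x => laxOleinik h (t, x)) x →
          |laxSolution h t x - laxSolution h s x| ≤ ε := by
        rcases hs.eq_or_lt with rfl | hs
        · refine laxSolution_eventually_of_zero hh ?_ hε
          simpa only [laxOleinik_zero hh] using h0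
        · exact mem_nhdsWithin_of_mem_nhds (laxSolution_eventually_of_pos hh hs h0 hε)
      filter_upwards [hτ.eventually this] with n hn
      exact hn (h1 n)
    intro ε hε
    obtain ⟨N, hN⟩ := eventually_atTop.1 (this (ε / 2) (half_pos hε))
    refine ⟨N, fun n hn => ?_⟩
    rw [Real.dist_eq, sub_zero, abs_abs]
    linarith [hN n hn.le]

theorem laxSolution_zero : laxSolution h 0 = deriv h := by
  funext x
  rw [laxSolution]
  congr 1
  exact funext fun x => laxOleinik_zero hh x

end LaxSolution

/-! ### Mollification of bounded and Lipschitz functions -/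

section MollifyBounded

open scoped Convolution

variable {E : Type*} [NormedAddCommGroup E] [NormedSpace ℝ E] [FiniteDimensional ℝ E]
  [MeasureSpace E] [BorelSpace E] [(volume : Measure E).IsAddHaarMeasure]
  {ρ : ContDiffBump (0 : E)} {f g : E → ℝ} {C C' : ℝ}

theorem ContDiffBump.integrable_normed_mul (ρ : ContDiffBump (0 : E)) (hg : Measurable g)
    (hC : ∀ y, |g y| ≤ C) (z : E) : Integrable (fun s => ρ.normed volume s * g (z - s)) := by
  have h := ρ.integrable_normed (μ := volume)
  exact (h.bdd_mul (c := C) (f := fun s => g (z - s))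
    (hg.comp (measurable_const.sub measurable_id)).aestronglyMeasurable
    (ae_of_all _ fun s => hC _)).congr (ae_of_all _ fun s => mul_comm _ _)

theorem mollify_add_const_mul (hf : Measurable f) (hC : ∀ y, |f y| ≤ C) (hg : Measurable g)
    (hC' : ∀ y, |g y| ≤ C') (c : ℝ) (z : E) :
    mollify ρ (fun y => f y + c * g y) z = mollify ρ f z + c * mollify ρ g z := by
  rw [mollify_apply, mollify_apply, mollify_apply, ← integral_const_mul,
    ← integral_add (ρ.integrable_normed_mul hf hC z)
      ((ρ.integrable_normed_mul hg hC' z).const_mul c)]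
  refine integral_congr_ae (ae_of_all _ fun s => ?_)
  simp only
  ring

omit [(volume : Measure E).IsAddHaarMeasure] in
theorem mollify_add_right (g : E → ℝ) (z k : E) :
    mollify ρ g (z + k) = mollify ρ (fun y => g (y + k)) z := by
  rw [mollify_apply, mollify_apply]
  refine integral_congr_ae (ae_of_all _ fun s => ?_)
  simp only [add_sub_right_comm]

/-- The bound is only needed almost everywhere in the ball that the kernel sees, which allows
inequalities valid only for `t > 0`. -/
theorem mollify_le (hg : Measurable g) (hC : ∀ y, |g y| ≤ C) {z : E} {c : ℝ}
    (h : ∀ᵐ y, y ∈ Metric.ball z ρ.rOut → g y ≤ c) : mollify ρ g z ≤ c := by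
  have e : ∫ s, ρ.normed volume s * c = c := by
    rw [integral_mul_const, ρ.integral_normed, one_mul]
  rw [mollify_apply, ← e]
  refine integral_mono_ae (ρ.integrable_normed_mul hg hC z) (ρ.integrable_normed.mul_const c) ?_
  have := (quasiMeasurePreserving_sub_left volume z).ae h
  filter_upwards [this] with s hs
  by_cases hs' : s ∈ Metric.ball (0 : E) ρ.rOut
  · refine mul_le_mul_of_nonneg_left (hs ?_) (ρ.nonneg_normed s)
    rw [mem_ball_iff_norm, sub_sub_cancel_left, norm_neg]
    exact mem_ball_zero_iff.1 hs'
  · have : ρ.normed volume s = 0 := by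
      rw [← Function.notMem_support, ρ.support_normed_eq]
      exact hs'
    rw [this, zero_mul, zero_mul]

theorem abs_mollify_le (hg : Measurable g) (hC : ∀ y, |g y| ≤ C) (z : E) :
    |mollify ρ g z| ≤ C := by
  rw [abs_le]
  constructor
  · have h := mollify_le (ρ := ρ) (g := fun y => 0 + (-1) * g y) (z := z) (c := C) (C := C)
      (by fun_prop) (fun y => by simpa using hC y)
      (ae_of_all _ fun y _ => by linarith [(abs_le.1 (hC y)).1])
    rw [mollify_add_const_mul (f := fun _ => 0) (C := 0) measurable_const (by simp) hg hC] at h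
    have : mollify ρ (fun _ : E => (0 : ℝ)) z = 0 := by simp [mollify_apply]
    linarith
  · exact mollify_le hg hC (ae_of_all _ fun y _ => (abs_le.1 (hC y)).2)

theorem contDiff_mollify (hg : Continuous g) : ContDiff ℝ ∞ (mollify ρ g) :=
  ρ.hasCompactSupport_normed.contDiff_convolution_left _ ρ.contDiff_normed hg.locallyIntegrable

/-- Differentiation under the integral with a Lipschitz domination; the pointwise derivative exists
almost everywhere by Rademacher's theorem. -/
theorem LipschitzWith.fderiv_mollify {K : NNReal} (hg : LipschitzWith K g) (z v : E) :
    fderiv ℝ (mollify ρ g) z v = mollify ρ (fun y => fderiv ℝ g y v) z := by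
  have hd : ∀ᵐ s, DifferentiableAt ℝ g (z - s) :=
    (quasiMeasurePreserving_sub_left volume z).ae hg.ae_differentiableAt
  have hi : ∀ y, Integrable fun s => ρ.normed volume s * g (y - s) := fun y => by
    refine Continuous.integrable_of_hasCompactSupport ?_ ?_
    · exact ρ.continuous_normed.mul (hg.continuous.comp (by fun_prop))
    · exact ρ.hasCompactSupport_normed.mul_right
  have key := hasFDerivAt_integral_of_dominated_loc_of_lip (𝕜 := ℝ) (μ := (volume : Measure E))
    (F := fun y s => ρ.normed volume s * g (y - s)) (x₀ := z) (s := univ)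
    (F' := fun s => ρ.normed volume s • fderiv ℝ g (z - s))
    (bound := fun s => ρ.normed volume s * K) univ_mem
    (Eventually.of_forall fun y => (hi y).aestronglyMeasurable) (hi z)
    (by
      refine Measurable.aestronglyMeasurable ?_
      exact ρ.continuous_normed.measurable.smul
        ((measurable_fderiv ℝ g).comp (measurable_const.sub measurable_id)))
    (by
      refine ae_of_all _ fun s => LipschitzWith.lipschitzOnWith ?_
      refine LipschitzWith.of_dist_le_mul fun x y => ?_
      have h0 := ρ.nonneg_normed (μ := volume) s
      rw [Real.coe_nnabs, abs_of_nonneg (by positivity), Real.dist_eq, ← mul_sub, abs_mul,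
        abs_of_nonneg h0, mul_assoc]
      refine mul_le_mul_of_nonneg_left ?_ h0
      have := hg.dist_le_mul (x - s) (y - s)
      rwa [dist_sub_right, Real.dist_eq] at this)
    (ρ.integrable_normed.mul_const _)
    (by
      filter_upwards [hd] with s hs
      have h1 : HasFDerivAt (fun y => g (y - s)) (fderiv ℝ g (z - s)) z := by
        have h2 := hs.hasFDerivAt.comp z ((hasFDerivAt_id z).sub_const s)
        rw [ContinuousLinearMap.comp_id] at h2
        exact h2
      exact h1.const_mul _)
  have e : fderiv ℝ (mollify ρ g) z = ∫ s, ρ.normed volume s • fderiv ℝ g (z - s) :=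
    key.2.fderiv
  rw [e, ContinuousLinearMap.integral_apply key.1, mollify_apply]
  rfl

theorem integral_fderiv_eq_zero {G : E → ℝ} (hG : ContDiff ℝ 1 G) (hc : HasCompactSupport G)
    (v : E) : ∫ z, fderiv ℝ G z v = 0 := by
  have h1 : Continuous fun z => fderiv ℝ G z v :=
    (hG.continuous_fderiv one_ne_zero).clm_apply continuous_const
  have h2 : Integrable fun z => fderiv ℝ G z v :=
    h1.integrable_of_hasCompactSupport (hc.fderiv_apply (𝕜 := ℝ) v)
  have := integral_mul_fderiv_eq_neg_fderiv_mul_of_integrable (μ := (volume : Measure E))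
    (f := fun _ : E => (1 : ℝ)) (g := G) (v := v) (by simp)
    (by simpa using h2)
    (by simpa using hG.continuous.integrable_of_hasCompactSupport hc)
    (fun x _ => differentiableAt_const _) (fun x _ => hG.differentiable one_ne_zero x)
  simpa using this

end MollifyBounded

/-! ### The entropy inequality for the Lax–Oleinik solution -/

/-- Entropy balance of a smooth solution of `∂ₜa = ∂ₓb`. -/
theorem integral_entropy_eq {a b φ : ℝ × ℝ → ℝ} (ha : ContDiff ℝ 1 a) (hb : ContDiff ℝ 1 b)
    (hab : ∀ z, fderiv ℝ a z (1, 0) = fderiv ℝ b z (0, 1)) (hφ : IsTestFunction φ)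
    {η Q : ℝ → ℝ} (hη : ContDiff ℝ 2 η) (hQ : ∀ v, HasDerivAt Q (deriv η v * v) v) :
    Integrable (fun z => η (a z) * fderiv ℝ φ z (1, 0) + Q (a z) * fderiv ℝ φ z (0, 1)) ∧
    Integrable (fun z => (b z + a z ^ 2 / 2) * (deriv (deriv η) (a z) * fderiv ℝ a z (0, 1) * φ z +
      deriv η (a z) * fderiv ℝ φ z (0, 1))) ∧
    ∫ z, (η (a z) * fderiv ℝ φ z (1, 0) + Q (a z) * fderiv ℝ φ z (0, 1)) =
      ∫ z, (b z + a z ^ 2 / 2) * (deriv (deriv η) (a z) * fderiv ℝ a z (0, 1) * φ z +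
        deriv η (a z) * fderiv ℝ φ z (0, 1)) := by
  have hη1 : ContDiff ℝ 1 η := hη.of_le (by norm_cast)
  have hη' : ContDiff ℝ 1 (deriv η) := by
    have h2 : ContDiff ℝ (1 + 1) η := hη
    exact (contDiff_succ_iff_deriv.1 h2).2.2
  have hη'' : Continuous (deriv (deriv η)) := hη'.continuous_deriv le_rfl
  have hQ1 : ContDiff ℝ 1 Q := by
    refine contDiff_one_iff_deriv.2 ⟨fun v => (hQ v).differentiableAt, ?_⟩
    have : deriv Q = fun v => deriv η v * v := funext fun v => (hQ v).deriv
    rw [this]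
    exact hη'.continuous.mul continuous_id
  have hφ1 : ContDiff ℝ 1 φ := hφ.1.of_le (by norm_cast)
  have hsupp : ∀ v, HasCompactSupport fun z => fderiv ℝ φ z v := fun v => (hφ.fderiv_apply v).2
  have hcont : ∀ v, Continuous fun z => fderiv ℝ φ z v := fun v => (hφ.fderiv_apply v).continuous
  have i1 : Integrable fun z => η (a z) * fderiv ℝ φ z (1, 0) :=
    ((hη.continuous.comp ha.continuous).mul (hcont _)).integrable_of_hasCompactSupport
      (hsupp _).mul_left
  have i2 : Integrable fun z => Q (a z) * fderiv ℝ φ z (0, 1) :=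
    ((hQ1.continuous.comp ha.continuous).mul (hcont _)).integrable_of_hasCompactSupport
      (hsupp _).mul_left
  have hax : Continuous fun z => fderiv ℝ a z (0, 1) :=
    (ha.continuous_fderiv one_ne_zero).clm_apply continuous_const
  have cD : Continuous fun z => b z + a z ^ 2 / 2 := by
    have := ha.continuous
    have := hb.continuous
    fun_prop
  have i3 : Integrable fun z => (b z + a z ^ 2 / 2) *
      (deriv (deriv η) (a z) * fderiv ℝ a z (0, 1) * φ z +
        deriv η (a z) * fderiv ℝ φ z (0, 1)) := by
    refine Continuous.integrable_of_hasCompactSupport ?_ ?_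
    · exact cD.mul ((((hη''.comp ha.continuous).mul hax).mul hφ.continuous).add
        ((hη'.continuous.comp ha.continuous).mul (hcont _)))
    · exact ((HasCompactSupport.mul_left hφ.2).add (hsupp _).mul_left).mul_left
  have i12 : Integrable fun z => η (a z) * fderiv ℝ φ z (1, 0) + Q (a z) * fderiv ℝ φ z (0, 1) :=
    i1.add i2
  refine ⟨i12, i3, ?_⟩
  rw [← sub_eq_zero, ← integral_sub i12 i3]
  -- With `D = b + a²/2`, the two sides differ by the integral of `∂ₜ(η(a) φ) + ∂ₓ((Q(a) - D η'(a))
  -- φ)`. The terms without derivatives of `φ`, other than `D η''(a) ∂ₓa φ`, cancel by `∂ₜa = ∂ₓb`.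
  have g1 : ContDiff ℝ 1 fun z => η (a z) * φ z := (hη1.comp ha).mul hφ1
  have g2 : ContDiff ℝ 1 fun z => (Q (a z) - (b z + a z ^ 2 / 2) * deriv η (a z)) * φ z :=
    ((hQ1.comp ha).sub ((hb.add ((ha.pow 2).div_const 2)).mul (hη'.comp ha))).mul hφ1
  have s1 : HasCompactSupport fun z => η (a z) * φ z := hφ.2.mul_left
  have s2 : HasCompactSupport fun z => (Q (a z) - (b z + a z ^ 2 / 2) * deriv η (a z)) * φ z :=
    hφ.2.mul_left
  have z1 := integral_fderiv_eq_zero g1 s1 (1, 0)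
  have z2 := integral_fderiv_eq_zero g2 s2 (0, 1)
  have j : ∀ {G : ℝ × ℝ → ℝ}, ContDiff ℝ 1 G → HasCompactSupport G → ∀ v,
      Integrable fun z => fderiv ℝ G z v := fun hG hc v =>
    ((hG.continuous_fderiv one_ne_zero).clm_apply continuous_const).integrable_of_hasCompactSupport
      (hc.fderiv_apply (𝕜 := ℝ) v)
  refine Eq.trans ?_ ((congrArg₂ (· + ·) z1 z2).trans (add_zero 0))
  rw [← integral_add (j g1 s1 _) (j g2 s2 _)]
  refine integral_congr_ae (ae_of_all _ fun z => ?_)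
  have da := (ha.differentiable one_ne_zero z).hasFDerivAt
  have db := (hb.differentiable one_ne_zero z).hasFDerivAt
  have dφ := (hφ1.differentiable one_ne_zero z).hasFDerivAt
  have dη := ((hη1.differentiable one_ne_zero (a z)).hasDerivAt).comp_hasFDerivAt z da
  have dη' := ((hη'.differentiable one_ne_zero (a z)).hasDerivAt).comp_hasFDerivAt z da
  have dQ := (hQ (a z)).comp_hasFDerivAt z da
  have da2 : HasFDerivAt (fun z => a z ^ 2 / 2) (a z • fderiv ℝ a z) z := by
    have h : HasDerivAt (fun v : ℝ => v ^ 2 / 2) (a z) (a z) := by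
      refine ((hasDerivAt_pow 2 (a z)).div_const 2).congr_deriv ?_
      simp
    exact h.comp_hasFDerivAt z da
  have e1 : fderiv ℝ (fun z => η (a z) * φ z) z = _ := (dη.fun_mul dφ).fderiv
  have e2 : fderiv ℝ (fun z => (Q (a z) - (b z + a z ^ 2 / 2) * deriv η (a z)) * φ z) z = _ :=
    ((dQ.fun_sub ((db.fun_add da2).fun_mul dη')).fun_mul dφ).fderiv
  simp only [e1, e2]
  simp only [Function.comp_apply, add_apply, sub_apply,
    smul_apply, smul_eq_mul, hab]
  ring

section LaxSolutionEntropy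

variable {h : ℝ → ℝ} (hh : LipschitzWith 1 h)
include hh

theorem abs_fderiv_laxOleinik_le {v : ℝ × ℝ} (hv : ‖v‖ ≤ 1) (y : ℝ × ℝ) :
    |fderiv ℝ (laxOleinik h) y v| ≤ 9 := by
  have h1 := (fderiv ℝ (laxOleinik h) y).le_opNorm v
  have h2 : ‖fderiv ℝ (laxOleinik h) y‖ ≤ 9 :=
    norm_fderiv_le_of_lipschitz ℝ (laxOleinik_lipschitz hh)
  refine h1.trans ((mul_le_mul h2 hv (norm_nonneg _) (by norm_num)).trans_eq (mul_one _))

/-- The Hamilton–Jacobi equation. -/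
theorem laxOleinik_hamiltonJacobi {y : ℝ × ℝ} (hy : 0 < y.1)
    (hd : DifferentiableAt ℝ (laxOleinik h) y) :
    fderiv ℝ (laxOleinik h) y (1, 0) = -(fderiv ℝ (laxOleinik h) y (0, 1) ^ 2 / 2) := by
  obtain ⟨x, hx, -⟩ := exists_laxOleinik_minimizer hh hy y.2
  obtain ⟨e1, e2⟩ := laxOleinik_fderiv hh hy hd hx
  rw [Prod.mk.eta] at e1 e2
  rw [e1, e2]
  ring

/-- Oleinik's bound as a difference quotient almost everywhere: this form survives mollification and
becomes a bound for the derivative. -/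
theorem fderiv_laxOleinik_add_le {k : ℝ} (hk : 0 < k) :
    ∀ᵐ y : ℝ × ℝ, 0 < y.1 → fderiv ℝ (laxOleinik h) (y + (0, k)) (0, 1) ≤
      fderiv ℝ (laxOleinik h) y (0, 1) + k / y.1 := by
  have d0 := (laxOleinik_lipschitz hh).ae_differentiableAt (μ := (volume : Measure (ℝ × ℝ)))
  have d1 := (quasiMeasurePreserving_add_right (volume : Measure (ℝ × ℝ)) ((0 : ℝ), k)).ae d0
  filter_upwards [d0, d1] with y h0 h1 hy
  obtain ⟨x, hx, -⟩ := exists_laxOleinik_minimizer hh hy y.2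
  obtain ⟨x', hx', -⟩ := exists_laxOleinik_minimizer hh hy (y.2 + k)
  have e : y + (0, k) = (y.1, y.2 + k) := by
    ext <;> simp
  rw [e] at h1 ⊢
  have a1 := (laxOleinik_fderiv hh hy h0 hx).2
  have a2 := (laxOleinik_fderiv hh hy h1 hx').2
  rw [Prod.mk.eta] at a1
  rw [a1, a2]
  linarith [laxOleinik_oleinik hh hy hk hx hx']

/-- Jensen's inequality, in tangent-line form: with `a` the mollified slope, `-W²/2 + a W ≤ a²/2`
pointwise, and averaging gives the claim. -/
theorem mollify_hamiltonJacobi_le (ρ : ContDiffBump (0 : ℝ × ℝ)) {z : ℝ × ℝ} (hz : ρ.rOut ≤ z.1) :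
    mollify ρ (fun y => fderiv ℝ (laxOleinik h) y (1, 0)) z +
      mollify ρ (fun y => fderiv ℝ (laxOleinik h) y (0, 1)) z ^ 2 / 2 ≤ 0 := by
  set a := mollify ρ (fun y => fderiv ℝ (laxOleinik h) y (0, 1)) z with ha
  have m : ∀ v, Measurable fun y => fderiv ℝ (laxOleinik h) y v := fun v =>
    measurable_fderiv_apply_const ℝ _ v
  have b1 := abs_fderiv_laxOleinik_le hh (v := (1, 0)) (by simp [Prod.norm_def])
  have b2 := abs_fderiv_laxOleinik_le hh (v := (0, 1)) (by simp [Prod.norm_def])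
  have d0 := (laxOleinik_lipschitz hh).ae_differentiableAt (μ := (volume : Measure (ℝ × ℝ)))
  have key := mollify_le (ρ := ρ) (z := z) (c := a ^ 2 / 2)
    (g := fun y => fderiv ℝ (laxOleinik h) y (1, 0) + a * fderiv ℝ (laxOleinik h) y (0, 1))
    (C := 9 + |a| * 9) ((m _).add ((m _).const_mul a))
    (fun y => (abs_add_le _ _).trans (add_le_add (b1 y) (by
      rw [abs_mul]
      exact mul_le_mul_of_nonneg_left (b2 y) (abs_nonneg a))))
    (by
      filter_upwards [d0] with y hd hy
      have hy1 : 0 < y.1 := by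
        have h1 := (norm_fst_le (y - z)).trans_lt (mem_ball_iff_norm.1 hy)
        have h2 := (abs_lt.1 h1).1
        rw [Prod.fst_sub] at h2
        linarith
      rw [laxOleinik_hamiltonJacobi hh hy1 hd]
      nlinarith [sq_nonneg (fderiv ℝ (laxOleinik h) y (0, 1) - a)])
  rw [mollify_add_const_mul (m _) b1 (m _) b2, ← ha] at key
  linarith

theorem fderiv_mollify_laxOleinik_le (ρ : ContDiffBump (0 : ℝ × ℝ)) {z : ℝ × ℝ} {t₀ : ℝ}
    (ht₀ : 0 < t₀) (hz : ρ.rOut + t₀ ≤ z.1) :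
    fderiv ℝ (fun z => fderiv ℝ (mollify ρ (laxOleinik h)) z (0, 1)) z (0, 1) ≤ 1 / t₀ := by
  have m : ∀ v, Measurable fun y => fderiv ℝ (laxOleinik h) y v := fun v =>
    measurable_fderiv_apply_const ℝ _ v
  have b2 := abs_fderiv_laxOleinik_le hh (v := (0, 1)) (by simp [Prod.norm_def])
  set W := fun y => fderiv ℝ (laxOleinik h) y (0, 1) with hW
  set a := fun z => fderiv ℝ (mollify ρ (laxOleinik h)) z (0, 1) with ha
  have haW : a = mollify ρ W := funext fun z => (laxOleinik_lipschitz hh).fderiv_mollify z _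
  have hca : ContDiff ℝ ∞ a :=
    ((contDiff_mollify (ρ := ρ) (laxOleinik_lipschitz hh).continuous).fderiv_right
      (m := ∞) (by norm_cast)).clm_apply contDiff_const
  have hline : HasDerivAt (fun k : ℝ => a (z + k • (0, 1))) (fderiv ℝ a z (0, 1)) 0 := by
    have h1 : HasDerivAt (fun k : ℝ => z + k • ((0 : ℝ), (1 : ℝ))) ((0 : ℝ), (1 : ℝ)) 0 := by
      simpa using ((hasDerivAt_id (0 : ℝ)).smul_const ((0 : ℝ), (1 : ℝ))).const_add z
    have h2 : HasFDerivAt a (fderiv ℝ a z) (z + (0 : ℝ) • ((0 : ℝ), (1 : ℝ))) := by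
      rw [zero_smul, add_zero]
      exact (hca.differentiable (by simp) z).hasFDerivAt
    exact h2.comp_hasDerivAt 0 h1
  refine le_of_tendsto hline.tendsto_slope_zero_right ?_
  filter_upwards [self_mem_nhdsWithin] with k hk
  have hk0 : 0 < k := hk
  rw [zero_add, zero_smul, add_zero, smul_eq_mul, inv_mul_le_iff₀ hk0]
  have e : z + k • ((0 : ℝ), (1 : ℝ)) = z + (0, k) := by simp
  rw [e, haW, mollify_add_right]
  have m' : Measurable fun y => W (y + (0, k)) := (m (0, 1)).comp (measurable_id.add_const _)
  have key := mollify_le (ρ := ρ) (z := z) (c := k * (1 / t₀))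
    (g := fun y => W (y + (0, k)) + (-1) * W y)
    (C := 9 + 9) (m'.add ((m _).const_mul _))
    (fun y => (abs_add_le _ _).trans (add_le_add (b2 _) (by
      rw [abs_mul, abs_neg, abs_one, one_mul]
      exact b2 y)))
    (by
      filter_upwards [fderiv_laxOleinik_add_le hh hk0] with y hd hy
      have hy1 : t₀ ≤ y.1 := by
        have h1 := (norm_fst_le (y - z)).trans_lt (mem_ball_iff_norm.1 hy)
        have h2 := (abs_lt.1 h1).1
        rw [Prod.fst_sub] at h2
        linarith
      have h3 := hd (ht₀.trans_le hy1)
      have h4 : k / y.1 ≤ k * (1 / t₀) := by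
        rw [mul_one_div]
        gcongr
      linarith)
  rw [mollify_add_const_mul (C := 9) (C' := 9) m' (fun y => b2 _) (m _) b2] at key
  linarith

theorem ae_laxSolution_eq :
    ∀ᵐ y : ℝ × ℝ, laxSolution h y.1 y.2 = fderiv ℝ (laxOleinik h) y (0, 1) := by
  filter_upwards [(laxOleinik_lipschitz hh).ae_differentiableAt
    (μ := (volume : Measure (ℝ × ℝ)))] with y hy
  have h1 : HasDerivAt (fun x : ℝ => (y.1, x)) ((0 : ℝ), (1 : ℝ)) y.2 :=
    (hasDerivAt_const y.2 y.1).prodMk (hasDerivAt_id y.2)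
  exact (hy.hasFDerivAt.comp_hasDerivAt y.2 h1).deriv

/-- Lebesgue differentiation; it requires bumps whose outer and inner radii have bounded ratio, here
`2`. -/
theorem tendsto_mollify_fderiv_laxOleinik (v : ℝ × ℝ) :
    ∀ᵐ z : ℝ × ℝ, Tendsto (fun n => fderiv ℝ (mollify (bumpSeq (ℝ × ℝ) n) (laxOleinik h)) z v)
      atTop (𝓝 (fderiv ℝ (laxOleinik h) z v)) := by
  have hb : ∃ C, ∀ y, ‖fderiv ℝ (laxOleinik h) y v‖ ≤ C :=
    ⟨9 * ‖v‖, fun y => (fderiv ℝ (laxOleinik h) y).le_of_opNorm_le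
      (norm_fderiv_le_of_lipschitz ℝ (laxOleinik_lipschitz hh)) v⟩
  obtain ⟨C, hC⟩ := hb
  have hl : LocallyIntegrable (fun y => fderiv ℝ (laxOleinik h) y v)
      (volume : Measure (ℝ × ℝ)) := by
    refine (locallyIntegrable_const C).mono
      (measurable_fderiv_apply_const ℝ _ v).aestronglyMeasurable (ae_of_all _ fun y => ?_)
    exact (hC y).trans (le_abs_self C)
  have := ContDiffBump.ae_convolution_tendsto_right_of_locallyIntegrable
    (φ := bumpSeq (ℝ × ℝ)) (l := atTop) (K := 2) (μ := (volume : Measure (ℝ × ℝ)))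
    (tendsto_bumpSeq_rOut _) (Eventually.of_forall fun n => by
      change 1 / ((n : ℝ) + 1) ≤ 2 * (1 / (2 * ((n : ℝ) + 1)))
      field_simp
      exact le_rfl) hl
  filter_upwards [this] with z hz
  refine hz.congr fun n => ?_
  exact ((laxOleinik_lipschitz hh).fderiv_mollify z v).symm

end LaxSolutionEntropy

/-- The factor two leaves room for a mollification radius below `t₀`, so that the kernel stays in `t
≥ t₀`. -/
theorem IsTestFunction.exists_pos_le_fst {φ : ℝ × ℝ → ℝ} (hφ : IsTestFunction φ)
    (hs : tsupport φ ⊆ Ioi 0 ×ˢ univ) : ∃ t₀, 0 < t₀ ∧ ∀ z ∈ tsupport φ, 2 * t₀ ≤ z.1 := by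
  rcases (tsupport φ).eq_empty_or_nonempty with h | h
  · exact ⟨1, one_pos, by simp [h]⟩
  · obtain ⟨z, hz, hmin⟩ := hφ.2.isCompact.exists_isMinOn h continuous_fst.continuousOn
    have h0 : 0 < z.1 := (hs hz).1
    exact ⟨z.1 / 2, half_pos h0, fun y hy => by
      have : z.1 ≤ y.1 := hmin hy
      linarith⟩

section LaxSolutionEntropy

variable {h : ℝ → ℝ} (hh : LipschitzWith 1 h)
include hh

/-- For the mollified value function the production equals `∫ D (η''(a) ∂ₓa φ + η'(a) ∂ₓφ)` with `D
≤ 0`. As `η'' ≥ 0`, the upper bound on `∂ₓa` bounds the second factor above by a fixed `g`, so the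
production is at least `∫ D g`. This tends to zero because `D` is bounded and tends to zero almost
everywhere on the support of `φ`. -/
theorem laxSolution_entropy {η Q : ℝ → ℝ} (hη : ContDiff ℝ 2 η) (hconv : ConvexOn ℝ univ η)
    (hQ : ∀ v, HasDerivAt Q (deriv η v * v) v) {φ : ℝ × ℝ → ℝ} (hφ : IsTestFunction φ)
    (hφ0 : ∀ p, 0 ≤ φ p) (hs : tsupport φ ⊆ Ioi 0 ×ˢ univ) :
    0 ≤ ∫ p : ℝ × ℝ, (η (laxSolution h p.1 p.2) * fderiv ℝ φ p (1, 0) +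
        Q (laxSolution h p.1 p.2) * fderiv ℝ φ p (0, 1)) := by
  have hL := laxOleinik_lipschitz hh
  obtain ⟨t₀, ht₀, hφt⟩ := hφ.exists_pos_le_fst hs
  have hη' : ContDiff ℝ 1 (deriv η) := by
    have h2 : ContDiff ℝ (1 + 1) η := hη
    exact (contDiff_succ_iff_deriv.1 h2).2.2
  have hQc : Continuous Q := continuous_iff_continuousAt.2 fun v => (hQ v).continuousAt
  obtain ⟨C₁, hC₁, hC₁b⟩ := exists_bound_of_continuous hη'.continuous 9
  obtain ⟨C₂, hC₂, hC₂b⟩ := exists_bound_of_continuous (hη'.continuous_deriv le_rfl) 9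
  obtain ⟨C₃, hC₃, hC₃b⟩ := exists_bound_of_continuous hη.continuous 9
  obtain ⟨C₄, hC₄, hC₄b⟩ := exists_bound_of_continuous hQc 9
  have hη2 : ∀ v, 0 ≤ deriv (deriv η) v := by
    have hm : Monotone (deriv η) := by
      have := hconv.monotoneOn_deriv (fun x _ => (hη.differentiable (by simp)) x)
      exact monotoneOn_univ.1 this
    exact fun v => hm.deriv_nonneg
  set W := fun y => fderiv ℝ (laxOleinik h) y (0, 1) with hW
  set T := fun y => fderiv ℝ (laxOleinik h) y (1, 0) with hT
  let V := fun n => mollify (bumpSeq (ℝ × ℝ) n) (laxOleinik h)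
  let a := fun n z => fderiv ℝ (V n) z (0, 1)
  let b := fun n z => fderiv ℝ (V n) z (1, 0)
  have hV : ∀ n, ContDiff ℝ ∞ (V n) := fun n => contDiff_mollify hL.continuous
  have hd : ∀ n v, ContDiff ℝ 1 fun z => fderiv ℝ (V n) z v := fun n v =>
    ((hV n).fderiv_right (m := 1) (by norm_cast)).clm_apply contDiff_const
  have hab : ∀ n z, fderiv ℝ (a n) z (1, 0) = fderiv ℝ (b n) z (0, 1) := fun n z =>
    (hV n).fderiv_apply_comm z _ _
  have m : ∀ v, Measurable fun y => fderiv ℝ (laxOleinik h) y v := fun v =>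
    measurable_fderiv_apply_const ℝ _ v
  have bT := abs_fderiv_laxOleinik_le hh (v := (1, 0)) (by simp [Prod.norm_def])
  have bW := abs_fderiv_laxOleinik_le hh (v := (0, 1)) (by simp [Prod.norm_def])
  have ha9 : ∀ n z, |a n z| ≤ 9 := fun n z => by
    have := hL.fderiv_mollify (ρ := bumpSeq (ℝ × ℝ) n) z (0, 1)
    change |fderiv ℝ (mollify _ _) z (0, 1)| ≤ 9
    rw [this]
    exact abs_mollify_le (m _) bW z
  have hb9 : ∀ n z, |b n z| ≤ 9 := fun n z => by
    have := hL.fderiv_mollify (ρ := bumpSeq (ℝ × ℝ) n) z (1, 0)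
    change |fderiv ℝ (mollify _ _) z (1, 0)| ≤ 9
    rw [this]
    exact abs_mollify_le (m _) bT z
  have ta : ∀ᵐ z, Tendsto (fun n => a n z) atTop (𝓝 (W z)) :=
    tendsto_mollify_fderiv_laxOleinik hh (0, 1)
  have tb : ∀ᵐ z, Tendsto (fun n => b n z) atTop (𝓝 (T z)) :=
    tendsto_mollify_fderiv_laxOleinik hh (1, 0)
  let g : ℝ × ℝ → ℝ := fun z => C₂ * (1 / t₀) * φ z + C₁ * |fderiv ℝ φ z (0, 1)|
  have ig : Integrable g := ((hφ.integrable volume).const_mul _).add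
    (((hφ.fderiv_apply _).integrable volume).abs.const_mul _)
  have hg0 : ∀ z, 0 ≤ g z := fun z =>
    add_nonneg (mul_nonneg (by positivity) (hφ0 z)) (mul_nonneg hC₁ (abs_nonneg _))
  have ent := fun n => integral_entropy_eq (hd n (0, 1)) (hd n (1, 0)) (hab n) hφ hη hQ
  have limI : Tendsto (fun n => ∫ z, (η (a n z) * fderiv ℝ φ z (1, 0) +
      Q (a n z) * fderiv ℝ φ z (0, 1))) atTop
      (𝓝 (∫ z, (η (W z) * fderiv ℝ φ z (1, 0) + Q (W z) * fderiv ℝ φ z (0, 1)))) := by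
    refine tendsto_integral_of_dominated_convergence
      (fun z => C₃ * |fderiv ℝ φ z (1, 0)| + C₄ * |fderiv ℝ φ z (0, 1)|)
      (fun n => (ent n).1.aestronglyMeasurable) ?_ (fun n => ae_of_all _ fun z => ?_) ?_
    · exact (((hφ.fderiv_apply _).integrable volume).abs.const_mul _).add
        (((hφ.fderiv_apply _).integrable volume).abs.const_mul _)
    · refine (norm_add_le _ _).trans ?_
      rw [norm_mul, norm_mul]
      exact add_le_add (mul_le_mul_of_nonneg_right (hC₃b _ (ha9 n z)) (abs_nonneg _))
        (mul_le_mul_of_nonneg_right (hC₄b _ (ha9 n z)) (abs_nonneg _))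
    · filter_upwards [ta] with z hz
      exact (((hη.continuous.tendsto _).comp hz).mul_const _).add
        (((hQc.tendsto _).comp hz).mul_const _)
  have iJ : ∀ n, Integrable fun z => (b n z + a n z ^ 2 / 2) * g z := fun n => by
    refine ig.bdd_mul (c := 9 + 81 / 2) ?_ (ae_of_all _ fun z => ?_)
    · exact ((hd n (1, 0)).continuous.add
        (((hd n (0, 1)).continuous.pow 2).div_const 2)).aestronglyMeasurable
    · rw [Real.norm_eq_abs]
      refine (abs_add_le _ _).trans (add_le_add (hb9 n z) ?_)
      rw [abs_of_nonneg (by positivity), ← sq_abs]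
      nlinarith [ha9 n z, abs_nonneg (a n z)]
  have limJ : Tendsto (fun n => ∫ z, (b n z + a n z ^ 2 / 2) * g z) atTop (𝓝 0) := by
    have e0 : ∫ z, (T z + W z ^ 2 / 2) * g z = 0 := by
      refine integral_eq_zero_of_ae ?_
      filter_upwards [hL.ae_differentiableAt (μ := (volume : Measure (ℝ × ℝ)))] with z hz
      by_cases hzs : z ∈ tsupport φ
      · simp only [hT, hW, laxOleinik_hamiltonJacobi hh (hs hzs).1 hz]
        simp
      · have z1 : φ z = 0 := image_eq_zero_of_notMem_tsupport hzs
        have z2 : fderiv ℝ φ z = 0 := by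
          by_contra hne
          exact hzs (support_fderiv_subset ℝ hne)
        simp [g, z1, z2]
    rw [← e0]
    refine tendsto_integral_of_dominated_convergence (fun z => (9 + 81 / 2) * g z)
      (fun n => (iJ n).aestronglyMeasurable) (ig.const_mul _) (fun n => ae_of_all _ fun z => ?_) ?_
    · rw [norm_mul, Real.norm_of_nonneg (hg0 z)]
      refine mul_le_mul_of_nonneg_right ?_ (hg0 z)
      refine (abs_add_le _ _).trans (add_le_add (hb9 n z) ?_)
      rw [abs_of_nonneg (by positivity), ← sq_abs]
      nlinarith [ha9 n z, abs_nonneg (a n z)]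
    · filter_upwards [ta, tb] with z h1 h2
      exact (h2.add ((h1.pow 2).div_const 2)).mul_const _
  have hJI : ∀ᶠ n in atTop, ∫ z, (b n z + a n z ^ 2 / 2) * g z ≤
      ∫ z, (η (a n z) * fderiv ℝ φ z (1, 0) + Q (a n z) * fderiv ℝ φ z (0, 1)) := by
    filter_upwards [(tendsto_bumpSeq_rOut (ℝ × ℝ)).eventually (gt_mem_nhds ht₀)] with n hn
    rw [(ent n).2.2]
    refine integral_mono (iJ n) (ent n).2.1 fun z => ?_
    by_cases hzs : z ∈ tsupport φ
    · have hz := hφt z hzs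
      have hD : b n z + a n z ^ 2 / 2 ≤ 0 := by
        have e1 : a n z = _ := hL.fderiv_mollify (ρ := bumpSeq (ℝ × ℝ) n) z (0, 1)
        have e2 : b n z = _ := hL.fderiv_mollify (ρ := bumpSeq (ℝ × ℝ) n) z (1, 0)
        rw [e1, e2]
        exact mollify_hamiltonJacobi_le hh _ (by linarith)
      -- Because `D ≤ 0`, only an upper bound on the other factor is needed; the one-sided Oleinik
      -- estimate provides it, and `∂ₓa` may be very negative.
      refine mul_le_mul_of_nonpos_left ?_ hD
      have hκ : fderiv ℝ (a n) z (0, 1) ≤ 1 / t₀ :=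
        fderiv_mollify_laxOleinik_le hh _ ht₀ (by linarith)
      refine add_le_add (mul_le_mul_of_nonneg_right ?_ (hφ0 z)) ?_
      · refine (mul_le_mul_of_nonneg_left hκ (hη2 _)).trans ?_
        exact mul_le_mul_of_nonneg_right ((le_abs_self _).trans (hC₂b _ (ha9 n z)))
          (by positivity)
      · refine (le_abs_self _).trans ?_
        rw [abs_mul]
        exact mul_le_mul_of_nonneg_right (hC₁b _ (ha9 n z)) (abs_nonneg _)
    · have z1 : φ z = 0 := image_eq_zero_of_notMem_tsupport hzs
      have z2 : fderiv ℝ φ z = 0 := by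
        by_contra hne
        exact hzs (support_fderiv_subset ℝ hne)
      simp [g, z1, z2]
  have := le_of_tendsto_of_tendsto limJ limI hJI
  refine this.trans_eq (integral_congr_ae ?_)
  filter_upwards [ae_laxSolution_eq hh] with z hz
  simp only [hz, hW]

theorem isEntropySolution_laxSolution :
    IsEntropySolution (fun v => v ^ 2 / 2) (deriv h) (laxSolution h) where
  measurable := measurable_laxSolution hh
  bounded := ⟨9, fun t x _ => abs_laxSolution_le hh t x⟩
  continuous_L1loc _ _ _ hs := laxSolution_continuous_L1loc hh hs
  initial := ae_of_all _ fun x => by rw [laxSolution_zero hh]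
  entropy η Q hη hconv hQ φ hφ hφ0 hs := by
    refine laxSolution_entropy hh hη hconv (fun v => ?_) hφ hφ0 hs
    have : deriv (fun v : ℝ => v ^ 2 / 2) v = v := by simp
    simpa only [this] using hQ v

end LaxSolutionEntropy

/-! ### Existence and reflection of entropy solutions -/

/-- Existence of an entropy solution of the Burgers equation for data bounded by one. -/
theorem exists_isEntropySolution {u₀ : ℝ → ℝ} (hm : Measurable u₀) (hb : ∀ x, |u₀ x| ≤ 1) :
    ∃ u, IsEntropySolution (fun v => v ^ 2 / 2) u₀ u := by
  have hi : LocallyIntegrable u₀ := (locallyIntegrable_const (1 : ℝ)).mono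
    hm.aestronglyMeasurable (ae_of_all _ fun x => (hb x).trans (le_abs_self 1))
  have hii : ∀ a b, IntervalIntegrable u₀ volume a b := fun a b =>
    (hi.integrableOn_isCompact isCompact_uIcc).intervalIntegrable
  let h : ℝ → ℝ := fun x => ∫ s in (0 : ℝ)..x, u₀ s
  have hh : LipschitzWith 1 h := by
    refine LipschitzWith.of_dist_le_mul fun x y => ?_
    rw [Real.dist_eq, Real.dist_eq, intervalIntegral.integral_interval_sub_left (hii _ _) (hii _ _)]
    have := intervalIntegral.norm_integral_le_of_norm_le_const (a := y) (b := x) (f := u₀) (C := 1)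
      fun s _ => hb s
    simpa using this
  have hs := isEntropySolution_laxSolution hh
  refine ⟨_, hs.measurable, hs.bounded, hs.continuous_L1loc, ?_, hs.entropy⟩
  have hd : ∀ᵐ x, deriv h x = u₀ x := by
    have := _root_.LocallyIntegrable.ae_hasDerivAt_integral hi
    filter_upwards [this] with x hx
    exact (hx 0).deriv
  filter_upwards [hs.initial, hd] with x h1 h2
  rw [h1, h2]

/-- Reflecting an entropy solution in space reverses the sign of the flux. -/
theorem IsEntropySolution.reflect {F G : ℝ → ℝ} {u₀ : ℝ → ℝ} {u : ℝ → ℝ → ℝ}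
    (hu : IsEntropySolution F u₀ u) (hFG : ∀ v, deriv F v = -deriv G v)
    (heven : ∀ x, u₀ (-x) = u₀ x) : IsEntropySolution G u₀ fun t x => u t (-x) where
  measurable := hu.measurable.comp (measurable_fst.prodMk measurable_snd.neg)
  bounded := by
    obtain ⟨M, hM⟩ := hu.bounded
    exact ⟨M, fun t x ht => hM t (-x) ht⟩
  continuous_L1loc R s hR hs := by
    refine (hu.continuous_L1loc R s hR hs).congr fun t => ?_
    have h := (Measure.measurePreserving_neg (volume : Measure ℝ)).setIntegral_preimage_emb
      (MeasurableEquiv.neg ℝ).measurableEmbedding (fun x => |u t x - u s x|) (Icc (-R) R)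
    rw [← h]
    congr 2
    simp
  initial := by
    have := (Measure.measurePreserving_neg (volume : Measure ℝ)).quasiMeasurePreserving.ae hu.initial
    filter_upwards [this] with x hx
    rw [hx, heven]
  entropy η Q hη hconv hQ φ hφ hφ0 hs := by
    let R : (ℝ × ℝ) ≃L[ℝ] (ℝ × ℝ) :=
      (ContinuousLinearEquiv.refl ℝ ℝ).prodCongr (ContinuousLinearEquiv.neg ℝ)
    have hR : MeasurePreserving R volume volume :=
      (MeasurePreserving.id volume).prod (Measure.measurePreserving_neg volume)
    -- Reflection in `x` changes the sign of `∂ₓφ`, which is compensated by the sign of the flux.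
    have key := hu.entropy η (fun v => -Q v) hη hconv (fun v => by
      rw [hFG, mul_neg]
      exact (hQ v).neg) (fun z => φ (R z)) (hφ.comp_equiv R) (fun z => hφ0 _) (fun z hz => by
        have h1 : z ∈ R ⁻¹' tsupport φ := tsupport_comp_subset_preimage φ R.continuous hz
        exact ⟨(hs h1).1, mem_univ _⟩)
    rw [← hR.integral_comp R.toHomeomorph.measurableEmbedding]
    refine key.trans_eq (integral_congr_ae (ae_of_all _ fun z => ?_))
    have e : fderiv ℝ (fun z => φ (R z)) z = (fderiv ℝ φ (R z)).comp (R : (ℝ × ℝ) →L[ℝ] ℝ × ℝ) :=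
      R.comp_right_fderiv
    have e1 : R (1, 0) = ((1 : ℝ), (0 : ℝ)) := by simp [R]
    have e2 : R (0, 1) = -((0 : ℝ), (1 : ℝ)) := by simp [R]
    have e3 : R z = (z.1, -z.2) := rfl
    simp only [e, ContinuousLinearMap.comp_apply, ContinuousLinearEquiv.coe_coe, e1, e2, map_neg]
    simp only [e3, neg_neg]
    ring

/-! ### Gluing two half planes by point reflection -/

/-- The identification of the Euclidean plane with a product of lines. -/
noncomputable def planeCoord : Pt 2 ≃L[ℝ] ℝ × ℝ :=
  (EuclideanSpace.equiv (Fin 2) ℝ).trans (ContinuousLinearEquiv.finTwoArrow ℝ ℝ)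

theorem planeCoord_apply (p : Pt 2) : planeCoord p = (p 0, p 1) := rfl

theorem planeCoord_symm_apply (a b : ℝ) : planeCoord.symm (a, b) = !₂[a, b] := by
  rw [ContinuousLinearEquiv.symm_apply_eq]
  rfl

theorem measurePreserving_planeCoord : MeasurePreserving planeCoord :=
  (volume_preserving_finTwoArrow ℝ).comp (PiLp.volume_preserving_ofLp (Fin 2))

theorem measurePreserving_planeCoord_symm : MeasurePreserving planeCoord.symm :=
  MeasurePreserving.symm planeCoord.toHomeomorph.toMeasurableEquiv measurePreserving_planeCoord

theorem integral_planeCoord (f : Pt 2 → ℝ) : ∫ p, f p = ∫ z, f (planeCoord.symm z) :=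
  (measurePreserving_planeCoord_symm.integral_comp
    planeCoord.symm.toHomeomorph.measurableEmbedding f).symm

/-- Two functions on the half plane glued along the time axis by a point reflection. -/
noncomputable def planeGlue (u v : ℝ → ℝ → ℝ) (z : ℝ × ℝ) : ℝ :=
  if 0 ≤ z.1 then u z.1 z.2 else v (-z.1) (-z.2)

/-- Reflecting the second solution in `x` turns the gluing by time reversal into a gluing by the
point reflection, under which both parts solve the same equation. -/
theorem glue_eq (u₁ u₂ : ℝ → ℝ → ℝ) (p : Pt 2) :
    glue u₁ u₂ p = planeGlue u₁ (fun t x => u₂ t (-x)) (planeCoord p) := by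
  simp [glue, planeGlue, planeCoord_apply]

theorem planeGlue_of_pos {u v : ℝ → ℝ → ℝ} {z : ℝ × ℝ} (hz : 0 < z.1) :
    planeGlue u v z = u z.1 z.2 := by
  simp [planeGlue, hz.le]

theorem planeGlue_neg_of_pos {u v : ℝ → ℝ → ℝ} {z : ℝ × ℝ} (hz : 0 < z.1) :
    planeGlue u v (-z) = v z.1 z.2 := by
  simp [planeGlue, hz]

theorem ae_fst_ne_zero : ∀ᵐ z : ℝ × ℝ, z.1 ≠ 0 :=
  Measure.quasiMeasurePreserving_fst.ae (Measure.ae_ne volume 0)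

/-- An integral over the plane as a sum of integrals over a half plane. -/
theorem integral_eq_add_upper {f : ℝ × ℝ → ℝ} (hf : Integrable f) :
    ∫ z, f z = (∫ z in Ioi (0 : ℝ) ×ˢ (univ : Set ℝ), f z) +
      ∫ z in Ioi (0 : ℝ) ×ˢ (univ : Set ℝ), f (-z) := by
  rw [← integral_add_compl measurableSet_upper hf]
  congr 1
  have h := (Measure.measurePreserving_neg (volume : Measure (ℝ × ℝ))).setIntegral_preimage_emb
    (MeasurableEquiv.neg (ℝ × ℝ)).measurableEmbedding (fun z => f (-z)) (Ioi (0 : ℝ) ×ˢ univ)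
  rw [← h]
  simp only [neg_neg]
  refine setIntegral_congr_set ?_
  filter_upwards [ae_fst_ne_zero] with z hz
  refine propext ?_
  change ¬ (0 < z.1 ∧ True) ↔ (0 < -z.1 ∧ True)
  simp only [and_true, not_lt, Left.neg_pos_iff]
  exact ⟨fun h => lt_of_le_of_ne h hz, le_of_lt⟩

section

variable {F G : ℝ → ℝ} {u₀ : ℝ → ℝ} {u v : ℝ → ℝ → ℝ}

theorem measurable_planeGlue (hu : IsEntropySolution F u₀ u) (hv : IsEntropySolution G u₀ v) :
    Measurable (planeGlue u v) :=
  Measurable.ite (measurableSet_le measurable_const measurable_fst) hu.measurable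
    (hv.measurable.comp measurable_neg)

theorem exists_bound_planeGlue (hu : IsEntropySolution F u₀ u) (hv : IsEntropySolution G u₀ v) :
    ∃ M, ∀ z, |planeGlue u v z| ≤ M := by
  obtain ⟨M, -, hM⟩ := hu.exists_bound
  obtain ⟨M', -, hM'⟩ := hv.exists_bound
  refine ⟨max M M', fun z => ?_⟩
  unfold planeGlue
  split_ifs with h
  · exact (hM _ _ h).trans (le_max_left _ _)
  · exact (hM' _ _ (by linarith)).trans (le_max_right _ _)

/-- Evenness of the datum makes the trace of the reflected part agree with that of the first part,
so that the line `t = 0` carries no production. -/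
theorem integral_trace_reflect (hu : IsEntropySolution F u₀ u) (hv : IsEntropySolution G u₀ v)
    (heven : ∀ x, u₀ (-x) = u₀ x) (K : ℝ → ℝ → ℝ) :
    ∫ x, K (v 0 x) (-x) = ∫ x, K (u 0 x) x := by
  have h1 : ∫ x, K (v 0 x) (-x) = ∫ x, K (u₀ (-x)) (-x) := by
    refine integral_congr_ae ?_
    filter_upwards [hv.initial] with x hx
    rw [hx, heven]
  rw [h1, integral_neg_eq_self (fun x => K (u₀ x) x)]
  refine integral_congr_ae ?_
  filter_upwards [hu.initial] with x hx
  rw [hx]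

theorem integrable_planeGlue_mul (hu : IsEntropySolution F u₀ u) (hv : IsEntropySolution G u₀ v)
    {η : ℝ → ℝ} (hη : Continuous η) {ψ : ℝ × ℝ → ℝ} (hψ : IsTestFunction ψ) :
    Integrable fun z => η (planeGlue u v z) * ψ z := by
  obtain ⟨M, hM⟩ := exists_bound_planeGlue hu hv
  obtain ⟨C, -, hC⟩ := exists_bound_of_continuous hη M
  exact (hψ.integrable volume).bdd_mul (c := C)
    (hη.measurable.comp (measurable_planeGlue hu hv)).aestronglyMeasurable
    (ae_of_all _ fun z => hC _ (hM z))

theorem fderiv_comp_neg (φ : ℝ × ℝ → ℝ) (z w : ℝ × ℝ) :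
    fderiv ℝ (fun z => φ (-z)) z w = -fderiv ℝ φ (-z) w := by
  have : fderiv ℝ (fun z => φ (-z)) z = (fderiv ℝ φ (-z)).comp
      ((ContinuousLinearEquiv.neg ℝ : (ℝ × ℝ) ≃L[ℝ] ℝ × ℝ) : (ℝ × ℝ) →L[ℝ] ℝ × ℝ) :=
    (ContinuousLinearEquiv.neg ℝ : (ℝ × ℝ) ≃L[ℝ] ℝ × ℝ).comp_right_fderiv
  rw [this]
  simp

theorem IsTestFunction.comp_neg {φ : ℝ × ℝ → ℝ} (hφ : IsTestFunction φ) :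
    IsTestFunction fun z => φ (-z) :=
  hφ.comp_equiv (ContinuousLinearEquiv.neg ℝ)

/-- The entropy production of a glued function; the initial traces cancel. -/
theorem integral_planeGlue_entropy (hu : IsEntropySolution F u₀ u)
    (hv : IsEntropySolution G u₀ v) (heven : ∀ x, u₀ (-x) = u₀ x) {η Q : ℝ → ℝ}
    (hη : Continuous η) (hQ : Continuous Q) {φ : ℝ × ℝ → ℝ} (hφ : IsTestFunction φ) :
    ∫ z, (η (planeGlue u v z) * fderiv ℝ φ z (1, 0) +
        Q (planeGlue u v z) * fderiv ℝ φ z (0, 1)) =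
      entropyFunctional u η Q φ - entropyFunctional v η Q (fun z => φ (-z)) := by
  have hi : Integrable fun z => η (planeGlue u v z) * fderiv ℝ φ z (1, 0) +
      Q (planeGlue u v z) * fderiv ℝ φ z (0, 1) :=
    (integrable_planeGlue_mul hu hv hη (hφ.fderiv_apply _)).add
      (integrable_planeGlue_mul hu hv hQ (hφ.fderiv_apply _))
  rw [integral_eq_add_upper hi]
  unfold entropyFunctional
  have ht : ∫ x, η (v 0 x) * φ (-(0, x)) = ∫ x, η (u 0 x) * φ (0, x) := by
    have := integral_trace_reflect hu hv heven (fun a x => η a * φ (0, x))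
    simpa using this
  rw [ht]
  have e1 : ∫ z in Ioi (0 : ℝ) ×ˢ (univ : Set ℝ), (η (planeGlue u v z) * fderiv ℝ φ z (1, 0) +
      Q (planeGlue u v z) * fderiv ℝ φ z (0, 1)) =
      ∫ z in Ioi (0 : ℝ) ×ˢ (univ : Set ℝ), (η (u z.1 z.2) * fderiv ℝ φ z (1, 0) +
      Q (u z.1 z.2) * fderiv ℝ φ z (0, 1)) :=
    setIntegral_congr_fun measurableSet_upper fun z hz => by
      simp only [planeGlue_of_pos (mem_Ioi.1 hz.1)]
  have e2 : ∫ z in Ioi (0 : ℝ) ×ˢ (univ : Set ℝ),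
      (η (planeGlue u v (-z)) * fderiv ℝ φ (-z) (1, 0) +
      Q (planeGlue u v (-z)) * fderiv ℝ φ (-z) (0, 1)) =
      -∫ z in Ioi (0 : ℝ) ×ˢ (univ : Set ℝ), (η (v z.1 z.2) * fderiv ℝ (fun z => φ (-z)) z (1, 0) +
      Q (v z.1 z.2) * fderiv ℝ (fun z => φ (-z)) z (0, 1)) := by
    rw [← integral_neg]
    refine setIntegral_congr_fun measurableSet_upper fun z hz => ?_
    simp only [planeGlue_neg_of_pos (mem_Ioi.1 hz.1), fderiv_comp_neg]
    ring
  rw [e1, e2]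
  ring

end

/-! ### Quasi-solution and divergence-free properties -/

theorem hasDerivAt_burgersFlux (v : ℝ) : HasDerivAt burgersFlux (planeCoord.symm (1, v)) v := by
  have h1 : HasDerivAt (fun v : ℝ => (v, v ^ 2 / 2)) (1, v) v := by
    refine (hasDerivAt_id v).prodMk (((hasDerivAt_pow 2 v).div_const 2).congr_deriv ?_)
    simp
  have h2 := (planeCoord.symm : (ℝ × ℝ) →L[ℝ] Pt 2).hasFDerivAt.comp_hasDerivAt v h1
  refine h2.congr_of_eventuallyEq (Eventually.of_forall fun w => ?_)
  exact (planeCoord_symm_apply _ _).symm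

/-- The entropy fluxes of the Burgers flux are entropy pairs. -/
theorem IsEntropyFlux.isEntropyPair {q : ℝ → Pt 2} (hq : IsEntropyFlux burgersFlux q) :
    IsEntropyPair (fun v => q v 0) fun v => q v 1 := by
  obtain ⟨hqc, η, hη, h⟩ := hq
  set g : ℝ → ℝ := fun v => derivWithin η (Ioi v) v with hg
  have hgi : ∀ a b, IntervalIntegrable g volume a b := fun a b => by
    refine MonotoneOn.intervalIntegrable (hη.monotoneOn_rightDeriv.mono ?_)
    rw [interior_univ]
    exact subset_univ _
  have hder : ∀ v, HasDerivWithinAt η (g v) (Ioi v) v := fun v =>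
    hη.hasDerivWithinAt_rightDeriv_of_mem_interior (by rw [interior_univ]; exact mem_univ v)
  have hgvi : ∀ a b, IntervalIntegrable (fun v => g v * v) volume a b := fun a b =>
    (hgi a b).mul_continuousOn continuousOn_id
  have hdf : ∀ v, deriv burgersFlux v = planeCoord.symm (1, v) := fun v =>
    (hasDerivAt_burgersFlux v).deriv
  have hvi : ∀ a b, IntervalIntegrable (fun v => g v • planeCoord.symm (1, v)) volume a b :=
    fun a b => (hgi a b).smul_continuousOn
      (planeCoord.symm.continuous.comp (by fun_prop)).continuousOn
  have h0 : ∀ a b, q b 0 - q a 0 = ∫ v in a..b, g v := fun a b => by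
    have e := congrArg (EuclideanSpace.proj (𝕜 := ℝ) (0 : Fin 2)) (h a b)
    simp only [hdf] at e
    rw [← ContinuousLinearMap.intervalIntegral_comp_comm _ (hvi a b)] at e
    simpa [planeCoord_symm_apply] using e
  have h1 : ∀ a b, q b 1 - q a 1 = ∫ v in a..b, g v * v := fun a b => by
    have e := congrArg (EuclideanSpace.proj (𝕜 := ℝ) (1 : Fin 2)) (h a b)
    simp only [hdf] at e
    rw [← ContinuousLinearMap.intervalIntegral_comp_comm _ (hvi a b)] at e
    simpa [planeCoord_symm_apply] using e
  have hηc := hη.continuous_real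
  -- The first component of `f'` is one, so `q 0` is the entropy up to a constant. Only right
  -- derivatives of `η` exist everywhere, and the fundamental theorem of calculus is used in that
  -- form.
  have e0 : (fun v => q v 0) = fun v => η v + (q 0 0 - η 0) := by
    funext v
    have := intervalIntegral.integral_eq_sub_of_hasDeriv_right (a := 0) (b := v)
      hηc.continuousOn (fun x _ => hder x) (hgi 0 v)
    linarith [h0 0 v]
  have hc0 : Continuous fun v => q v 0 := by
    rw [e0]
    exact hηc.add continuous_const
  refine ⟨?_, 0, fun v => ?_⟩
  · rw [e0]
    exact hη.add_const _
  -- The right-hand side of the integrated flux relation has right derivative `x η'(x)`, the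
  -- integrand of the second component of `q`.
  · have hder' : ∀ x, HasDerivWithinAt (fun x => x * q x 0 - ∫ s in (0 : ℝ)..x, q s 0) (g x * x)
        (Ioi x) x := fun x => by
      have d1 : HasDerivWithinAt (fun v => q v 0) (g x) (Ioi x) x := by
        rw [e0]
        exact (hder x).add_const _
      have d2 := (intervalIntegral.integral_hasDerivAt_right (hc0.intervalIntegrable 0 x)
        (hc0.stronglyMeasurableAtFilter _ _) hc0.continuousAt).hasDerivWithinAt (s := Ioi x)
      refine (((hasDerivWithinAt_id x (Ioi x)).fun_mul d1).fun_sub d2).congr_deriv ?_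
      simp only [id]
      ring
    have hcont : Continuous fun x => x * q x 0 - ∫ s in (0 : ℝ)..x, q s 0 :=
      (continuous_id.mul hc0).sub (intervalIntegral.continuous_primitive
        (fun x y => hc0.intervalIntegrable x y) 0)
    have := intervalIntegral.integral_eq_sub_of_hasDeriv_right (a := 0) (b := v)
      hcont.continuousOn (fun x _ => hder' x) (hgvi 0 v)
    simp only [intervalIntegral.integral_same] at this
    rw [h1 0 v, this]
    ring

theorem fderiv_planeCoord {φ : Pt 2 → ℝ} (p w : Pt 2) :
    fderiv ℝ φ p w = w 0 * fderiv ℝ (fun z => φ (planeCoord.symm z)) (planeCoord p) (1, 0) +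
      w 1 * fderiv ℝ (fun z => φ (planeCoord.symm z)) (planeCoord p) (0, 1) := by
  have e : fderiv ℝ (fun z => φ (planeCoord.symm z)) (planeCoord p) =
      (fderiv ℝ φ (planeCoord.symm (planeCoord p))).comp
        (planeCoord.symm : (ℝ × ℝ) →L[ℝ] Pt 2) := planeCoord.symm.comp_right_fderiv
  have hw : w = w 0 • planeCoord.symm (1, 0) + w 1 • planeCoord.symm (0, 1) := by
    rw [← map_smul, ← map_smul, ← map_add, ContinuousLinearEquiv.eq_symm_apply]
    simp [planeCoord_apply]
  rw [e, ContinuousLinearEquiv.symm_apply_apply]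
  nth_rewrite 1 [hw]
  simp

section

variable {u₀ : ℝ → ℝ} {u v : ℝ → ℝ → ℝ}

theorem integral_fderiv_planeGlue
    (hu : IsEntropySolution (fun v => v ^ 2 / 2) u₀ u)
    (hv : IsEntropySolution (fun v => v ^ 2 / 2) u₀ v) (heven : ∀ x, u₀ (-x) = u₀ x)
    {q : ℝ → Pt 2} (hq : Continuous q) {φ : Pt 2 → ℝ} (hφ : IsTestFunction φ) :
    ∫ p, fderiv ℝ φ p (q (planeGlue u v (planeCoord p))) =
      entropyFunctional u (fun w => q w 0) (fun w => q w 1) (fun z => φ (planeCoord.symm z)) -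
      entropyFunctional v (fun w => q w 0) (fun w => q w 1) (fun z => φ (planeCoord.symm (-z))) := by
  have hψ : IsTestFunction fun z => φ (planeCoord.symm z) := hφ.comp_equiv _
  rw [← integral_planeGlue_entropy hu hv heven (η := fun w => q w 0) (Q := fun w => q w 1)
    (by fun_prop) (by fun_prop) hψ, integral_planeCoord]
  refine integral_congr_ae (ae_of_all _ fun z => ?_)
  simp only [fderiv_planeCoord, ContinuousLinearEquiv.apply_symm_apply]

theorem IsEntropySolution.exists_entropy_measure
    (hu : IsEntropySolution (fun v => v ^ 2 / 2) u₀ u) {η Q : ℝ → ℝ} (h : IsEntropyPair η Q) :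
    ∃ m : Measure (ℝ × ℝ), IsLocallyFiniteMeasure m ∧ ∀ φ, IsTestFunction φ →
      ∫ z, φ z ∂m = entropyFunctional u η Q φ :=
  exists_measure_of_positive _
    (fun _ _ hφ hψ => entropyFunctional_add hu h.continuous_left h.continuous_right hφ hψ)
    (fun c _ hφ => entropyFunctional_const_mul _ _ _ c hφ)
    (fun _ hφ h0 => hu.entropyFunctional_nonneg h hφ h0)

theorem MeasureTheory.Measure.map_isLocallyFinite {X Y : Type*} [TopologicalSpace X]
    [TopologicalSpace Y] [MeasurableSpace X] [BorelSpace X] [MeasurableSpace Y] [BorelSpace Y]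
    (m : Measure X) [IsLocallyFiniteMeasure m] (e : X ≃ₜ Y) :
    IsLocallyFiniteMeasure (m.map e) := by
  refine ⟨fun y => ?_⟩
  obtain ⟨s, hs, hfin⟩ := m.finiteAt_nhds (e.symm y)
  refine ⟨e.symm ⁻¹' s, e.symm.continuous.continuousAt hs, ?_⟩
  rw [e.measurableEmbedding.map_apply]
  convert hfin
  ext x
  simp

/-- The difference of two measures on half planes, carried to the plane with the second one
reflected at the origin. -/
theorem exists_signedRadonMeasure_map {X Y : Type*} [TopologicalSpace X]
    [TopologicalSpace Y] [MeasurableSpace X] [BorelSpace X] [MeasurableSpace Y] [BorelSpace Y]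
    [SecondCountableTopology Y]
    (m₁ m₂ : Measure X) [IsLocallyFiniteMeasure m₁] [IsLocallyFiniteMeasure m₂] (e e' : X ≃ₜ Y) :
    ∃ μ : SignedRadonMeasure Y, μ.totalVariation ≤ m₁.map e + m₂.map e' ∧
      ∀ φ : Y → ℝ, Continuous φ → HasCompactSupport φ →
        μ.pairing φ = ∫ x, φ (e x) ∂m₁ - ∫ x, φ (e' x) ∂m₂ := by
  have i1 := m₁.map_isLocallyFinite e
  have i2 := m₂.map_isLocallyFinite e'
  obtain ⟨μ, h1, h2⟩ := exists_signedRadonMeasure (m₁.map e) (m₂.map e')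
  refine ⟨μ, h1, fun φ hφ hc => ?_⟩
  rw [h2 φ (hφ.integrable_of_hasCompactSupport hc) (hφ.integrable_of_hasCompactSupport hc),
    e.measurableEmbedding.integral_map, e'.measurableEmbedding.integral_map]

/-- Each half contributes a positive measure; the one of the second half is transported by the point
reflection and enters with a minus sign, since first derivatives are odd under it. -/
theorem isQuasiSolution_planeGlue
    (hu : IsEntropySolution (fun v => v ^ 2 / 2) u₀ u)
    (hv : IsEntropySolution (fun v => v ^ 2 / 2) u₀ v) (heven : ∀ x, u₀ (-x) = u₀ x) :
    IsQuasiSolution burgersFlux fun p => planeGlue u v (planeCoord p) := by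
  refine ⟨(measurable_planeGlue hu hv).comp planeCoord.continuous.measurable, ?_, fun q hq => ?_⟩
  · obtain ⟨M, hM⟩ := exists_bound_planeGlue hu hv
    exact ⟨M, fun p => hM _⟩
  · have hp := hq.isEntropyPair
    obtain ⟨m₁, l1, h1⟩ := hu.exists_entropy_measure hp
    obtain ⟨m₂, l2, h2⟩ := hv.exists_entropy_measure hp
    obtain ⟨μ, -, hμ⟩ := exists_signedRadonMeasure_map m₁ m₂ planeCoord.symm.toHomeomorph
      ((ContinuousLinearEquiv.neg ℝ).trans planeCoord.symm).toHomeomorph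
    refine ⟨μ, fun φ hφ => ?_⟩
    have hψ : IsTestFunction fun z => φ (planeCoord.symm z) := hφ.comp_equiv _
    rw [integral_fderiv_planeGlue hu hv heven hq.1 hφ, hμ φ hφ.continuous hφ.2,
      ← h1 _ hψ, ← h2 _ hψ.comp_neg]
    rfl

theorem IsEntropySolution.entropyFunctional_id_eq_zero
    (hu : IsEntropySolution (fun v => v ^ 2 / 2) u₀ u) {φ : ℝ × ℝ → ℝ} (hφ : IsTestFunction φ) :
    entropyFunctional u (fun v => v) (fun v => v ^ 2 / 2) φ = 0 := by
  refine hu.entropyFunctional_eq_zero ?_ ?_ hφ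
  · simpa using isEntropyPair_linear 1 0
  · simpa using isEntropyPair_linear (-1) 0

theorem isDivFree_planeGlue
    (hu : IsEntropySolution (fun v => v ^ 2 / 2) u₀ u)
    (hv : IsEntropySolution (fun v => v ^ 2 / 2) u₀ v) (heven : ∀ x, u₀ (-x) = u₀ x) :
    IsDivFree burgersFlux fun p => planeGlue u v (planeCoord p) := by
  intro φ hφ
  have hψ : IsTestFunction fun z => φ (planeCoord.symm z) := hφ.comp_equiv _
  have hc : Continuous burgersFlux := continuous_iff_continuousAt.2 fun v =>
    (hasDerivAt_burgersFlux v).continuousAt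
  rw [integral_fderiv_planeGlue hu hv heven hc hφ]
  have h1 := hu.entropyFunctional_id_eq_zero hψ
  have h2 := hv.entropyFunctional_id_eq_zero hψ.comp_neg
  exact (congrArg₂ (· - ·) h1 h2).trans (sub_zero 0)

end

/-! ### The kinetic measure of the glued function -/

theorem ContinuousLinearEquiv.fderiv_comp_apply {E F : Type*} [NormedAddCommGroup E]
    [NormedSpace ℝ E] [NormedAddCommGroup F] [NormedSpace ℝ F] (e : E ≃L[ℝ] F) (φ : F → ℝ)
    (x a : E) : fderiv ℝ (fun z => φ (e z)) x a = fderiv ℝ φ (e x) (e a) := by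
  have : fderiv ℝ (fun z => φ (e z)) x = (fderiv ℝ φ (e x)).comp (e : E →L[ℝ] F) :=
    e.comp_right_fderiv
  rw [this]
  rfl

/-- The coordinates `(v, (t, x))` of the kinetic space. -/
noncomputable def kineticCoord : (ℝ × ℝ × ℝ) ≃L[ℝ] ℝ × Pt 2 :=
  (ContinuousLinearEquiv.refl ℝ ℝ).prodCongr planeCoord.symm

/-- The coordinates `(v, (-t, -x))` of the kinetic space. -/
noncomputable def kineticCoordNeg : (ℝ × ℝ × ℝ) ≃L[ℝ] ℝ × Pt 2 :=
  (ContinuousLinearEquiv.refl ℝ ℝ).prodCongr ((ContinuousLinearEquiv.neg ℝ).trans planeCoord.symm)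

theorem kineticCoord_apply (p : ℝ × ℝ × ℝ) : kineticCoord p = (p.1, planeCoord.symm p.2) := rfl

theorem kineticCoordNeg_apply (p : ℝ × ℝ × ℝ) :
    kineticCoordNeg p = (p.1, planeCoord.symm (-p.2)) := rfl

theorem integral_kineticCoord (f : ℝ × Pt 2 → ℝ) : ∫ p, f p = ∫ p, f (kineticCoord p) :=
  (((MeasurePreserving.id volume).prod measurePreserving_planeCoord_symm).integral_comp
    kineticCoord.toHomeomorph.measurableEmbedding f).symm

section

variable {u₀ : ℝ → ℝ} {u v : ℝ → ℝ → ℝ} {F G : ℝ → ℝ}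

theorem integrable_signedIndicator_planeGlue (hu : IsEntropySolution F u₀ u)
    (hv : IsEntropySolution G u₀ v) {ψ : ℝ × ℝ × ℝ → ℝ} (hψ : IsTestFunction ψ) :
    Integrable (fun p : ℝ × ℝ × ℝ => signedIndicator p.1 (planeGlue u v p.2) *
      (fderiv ℝ ψ p (0, (1, 0)) + p.1 * fderiv ℝ ψ p (0, (0, 1)))) := by
  have h1 := hψ.fderiv_apply ((0 : ℝ), ((1 : ℝ), (0 : ℝ)))
  have h2 := (hψ.fderiv_apply ((0 : ℝ), ((0 : ℝ), (1 : ℝ)))).mul_left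
    (ψ := fun p : ℝ × ℝ × ℝ => p.1) contDiff_fst
  refine ((h1.add h2).integrable volume).bdd_mul (c := 1) ?_
    (ae_of_all _ fun p => abs_signedIndicator_le _ _)
  exact (measurable_signedIndicator.comp (measurable_fst.prodMk
    ((measurable_planeGlue hu hv).comp measurable_snd))).aestronglyMeasurable

/-- The kinetic transport term of a glued function. -/
theorem integral_kinetic_planeGlue (hu : IsEntropySolution F u₀ u) (hv : IsEntropySolution G u₀ v)
    (heven : ∀ x, u₀ (-x) = u₀ x) {φ : ℝ × Pt 2 → ℝ} (hφ : IsTestFunction φ) :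
    ∫ p : ℝ × Pt 2, kineticFn (fun p => planeGlue u v (planeCoord p)) p.1 p.2 *
        fderiv ℝ φ p (0, deriv burgersFlux p.1) =
      kineticPairing u (fun p => φ (kineticCoord p)) -
        kineticPairing v (fun p => φ (kineticCoordNeg p)) := by
  set ψ := fun p => φ (kineticCoord p) with hψd
  have hψ : IsTestFunction ψ := hφ.comp_equiv _
  have hi := integrable_signedIndicator_planeGlue hu hv hψ
  have e0 : ∀ p : ℝ × ℝ × ℝ, kineticFn (fun p => planeGlue u v (planeCoord p)) (kineticCoord p).1
      (kineticCoord p).2 * fderiv ℝ φ (kineticCoord p) (0, deriv burgersFlux (kineticCoord p).1) =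
      signedIndicator p.1 (planeGlue u v p.2) *
        (fderiv ℝ ψ p (0, (1, 0)) + p.1 * fderiv ℝ ψ p (0, (0, 1))) := fun p => by
    rw [kineticFn_eq, (hasDerivAt_burgersFlux _).deriv, kineticCoord_apply]
    simp only [ContinuousLinearEquiv.apply_symm_apply]
    have : ((0 : ℝ), planeCoord.symm (1, p.1)) =
        kineticCoord ((0, (1, 0)) + p.1 • ((0 : ℝ), ((0 : ℝ), (1 : ℝ)))) := by
      rw [kineticCoord_apply]
      simp
    rw [this, ← kineticCoord_apply, ← kineticCoord.fderiv_comp_apply φ p, map_add, map_smul,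
      smul_eq_mul]
  rw [integral_kineticCoord]
  simp only [e0]
  have hi' := hi
  rw [Measure.volume_eq_prod] at hi'
  have e1 : ∫ p : ℝ × ℝ × ℝ, signedIndicator p.1 (planeGlue u v p.2) *
        (fderiv ℝ ψ p (0, (1, 0)) + p.1 * fderiv ℝ ψ p (0, (0, 1))) =
      ∫ z : ℝ × ℝ, ∫ w, signedIndicator w (planeGlue u v z) *
        (fderiv ℝ ψ (w, z) (0, (1, 0)) + w * fderiv ℝ ψ (w, z) (0, (0, 1))) :=
    integral_prod_symm _ hi'
  rw [e1, integral_eq_add_upper hi'.integral_prod_right]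
  unfold kineticPairing
  have ht : ∫ x, ∫ w, signedIndicator w (v 0 x) * φ (kineticCoordNeg (w, (0, x))) =
      ∫ x, ∫ w, signedIndicator w (u 0 x) * ψ (w, (0, x)) := by
    rw [← integral_trace_reflect hu hv heven
      (fun a x => ∫ w, signedIndicator w a * ψ (w, (0, x)))]
    simp [hψd, kineticCoord_apply, kineticCoordNeg_apply]
  rw [ht]
  have e2 : ∫ z in Ioi (0 : ℝ) ×ˢ (univ : Set ℝ), ∫ w, signedIndicator w (planeGlue u v z) *
        (fderiv ℝ ψ (w, z) (0, (1, 0)) + w * fderiv ℝ ψ (w, z) (0, (0, 1))) =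
      ∫ z in Ioi (0 : ℝ) ×ˢ (univ : Set ℝ), ∫ w, signedIndicator w (u z.1 z.2) *
        (fderiv ℝ ψ (w, z) (0, (1, 0)) + w * fderiv ℝ ψ (w, z) (0, (0, 1))) :=
    setIntegral_congr_fun measurableSet_upper fun z hz => by
      simp only [planeGlue_of_pos (mem_Ioi.1 hz.1)]
  have e3 : ∫ z in Ioi (0 : ℝ) ×ˢ (univ : Set ℝ), ∫ w, signedIndicator w (planeGlue u v (-z)) *
        (fderiv ℝ ψ (w, -z) (0, (1, 0)) + w * fderiv ℝ ψ (w, -z) (0, (0, 1))) =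
      -∫ z in Ioi (0 : ℝ) ×ˢ (univ : Set ℝ), ∫ w, signedIndicator w (v z.1 z.2) *
        (fderiv ℝ (fun p => φ (kineticCoordNeg p)) (w, z) (0, (1, 0)) +
          w * fderiv ℝ (fun p => φ (kineticCoordNeg p)) (w, z) (0, (0, 1))) := by
    rw [← integral_neg]
    refine setIntegral_congr_fun measurableSet_upper fun z hz => ?_
    simp only [planeGlue_neg_of_pos (mem_Ioi.1 hz.1)]
    rw [← integral_neg]
    refine integral_congr_ae (ae_of_all _ fun w => ?_)
    -- The reflection reverses the derivatives in `(t, x)` and leaves the kinetic variable alone,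
    -- hence the minus sign in front of the second part.
    have e : ∀ a : ℝ × ℝ, fderiv ℝ (fun p => φ (kineticCoordNeg p)) (w, z) (0, a) =
        -fderiv ℝ ψ (w, -z) (0, a) := fun a => by
      rw [kineticCoordNeg.fderiv_comp_apply, kineticCoord.fderiv_comp_apply, kineticCoordNeg_apply,
        kineticCoordNeg_apply, kineticCoord_apply, kineticCoord_apply, ← map_neg]
      simp
    simp only [e]
    ring
  rw [e2, e3]
  ring

theorem norm_planeCoord_le (p : Pt 2) : ‖planeCoord p‖ ≤ ‖p‖ := by
  rw [planeCoord_apply, Prod.norm_def]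
  exact max_le (PiLp.norm_apply_le p 0) (PiLp.norm_apply_le p 1)

/-- The oscillation of `u` around `c` in a ball, in the open half plane and on its boundary. -/
noncomputable def halfPlaneOscillation (u : ℝ → ℝ → ℝ) (p₀ : ℝ × ℝ) (c ρ r : ℝ) : ℝ :=
  (r⁻¹ * ∫ z in (Ioi (0 : ℝ) ×ˢ univ) ∩ Metric.closedBall p₀ ρ, |u z.1 z.2 - c|) +
    ∫ x in {x : ℝ | ((0 : ℝ), x) ∈ Metric.closedBall p₀ ρ}, |u 0 x - c|

theorem halfPlaneOscillation_nonneg (u : ℝ → ℝ → ℝ) (p₀ : ℝ × ℝ) (c ρ : ℝ) {r : ℝ} (hr : 0 < r) :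
    0 ≤ halfPlaneOscillation u p₀ c ρ r :=
  add_nonneg (mul_nonneg (inv_pos.2 hr).le (integral_nonneg fun _ => abs_nonneg _))
    (integral_nonneg fun _ => abs_nonneg _)

/-- The kinetic measure of a glued function, controlled by the oscillation of the parts. -/
theorem exists_isKineticMeasure_planeGlue (hu : IsEntropySolution (fun v => v ^ 2 / 2) u₀ u)
    (hv : IsEntropySolution (fun v => v ^ 2 / 2) u₀ v) (heven : ∀ x, u₀ (-x) = u₀ x) :
    ∃ μ : SignedRadonMeasure (ℝ × Pt 2),
      IsKineticMeasure burgersFlux (fun p => planeGlue u v (planeCoord p)) μ ∧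
      ∃ C₁ R₁ C₂ R₂, 0 < R₁ ∧ 0 < R₂ ∧ ∀ (p : Pt 2) (c c' r : ℝ), 0 < r →
        (dissipation μ).real (Metric.ball p r) ≤
          C₁ * halfPlaneOscillation u (planeCoord p) c (R₁ * r) r +
          C₂ * halfPlaneOscillation v (-planeCoord p) c' (R₂ * r) r := by
  obtain ⟨m₁, l1, h1⟩ := hu.exists_kinetic_measure
  obtain ⟨m₂, l2, h2⟩ := hv.exists_kinetic_measure
  obtain ⟨C₁, R₁, hC₁, hR₁, b1⟩ := hu.kinetic_measure_closedBall_le h1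
  obtain ⟨C₂, R₂, hC₂, hR₂, b2⟩ := hv.kinetic_measure_closedBall_le h2
  obtain ⟨μ, hμ, hpair⟩ := exists_signedRadonMeasure_map m₁ m₂ kineticCoord.toHomeomorph
    kineticCoordNeg.toHomeomorph
  -- A Euclidean ball lies in the sup-norm ball of the same radius, and the reflected measure sees
  -- the ball around `-p`.
  have hball : ∀ (p : Pt 2) (r : ℝ), dissipation μ (Metric.ball p r) ≤
      m₁ (univ ×ˢ Metric.closedBall (planeCoord p) r) +
      m₂ (univ ×ˢ Metric.closedBall (-planeCoord p) r) := fun p r => by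
    rw [dissipation, Measure.map_apply measurable_snd Metric.isOpen_ball.measurableSet]
    refine (hμ _).trans ?_
    rw [Measure.add_apply, kineticCoord.toHomeomorph.measurableEmbedding.map_apply,
      kineticCoordNeg.toHomeomorph.measurableEmbedding.map_apply]
    refine add_le_add (measure_mono fun z hz => ⟨mem_univ _, ?_⟩)
      (measure_mono fun z hz => ⟨mem_univ _, ?_⟩)
    · have hz' : planeCoord.symm z.2 ∈ Metric.ball p r := hz
      rw [mem_closedBall_iff_norm]
      have := norm_planeCoord_le (planeCoord.symm z.2 - p)
      rw [map_sub, ContinuousLinearEquiv.apply_symm_apply] at this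
      exact this.trans (mem_ball_iff_norm.1 hz').le
    · have hz' : planeCoord.symm (-z.2) ∈ Metric.ball p r := hz
      rw [mem_closedBall_iff_norm, ← norm_neg]
      have := norm_planeCoord_le (planeCoord.symm (-z.2) - p)
      rw [map_sub, ContinuousLinearEquiv.apply_symm_apply] at this
      refine (le_of_eq ?_).trans (this.trans (mem_ball_iff_norm.1 hz').le)
      congr 1
      abel
  have hlf : IsLocallyFiniteMeasure (dissipation μ) := ⟨fun p =>
    ⟨Metric.ball p 1, Metric.ball_mem_nhds p one_pos, (hball p 1).trans_lt
      (ENNReal.add_lt_top.2 ⟨(b1 _ 0 1 one_pos).trans_lt ENNReal.ofReal_lt_top,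
        (b2 _ 0 1 one_pos).trans_lt ENNReal.ofReal_lt_top⟩)⟩⟩
  refine ⟨μ, ⟨hlf, fun φ hφ => ?_⟩, C₁, R₁, C₂, R₂, hR₁, hR₂, fun p c c' r hr => ?_⟩
  · have hψ : IsTestFunction fun p => φ (kineticCoord p) := hφ.comp_equiv _
    have hψ' : IsTestFunction fun p => φ (kineticCoordNeg p) := hφ.comp_equiv _
    have hd := hφ.fderiv_apply (1, 0)
    rw [integral_kinetic_planeGlue hu hv heven hφ, hpair _ hd.continuous hd.2,
      ← hu.integral_kin_fderiv hψ, ← hv.integral_kin_fderiv hψ',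
      ← h1 _ (hψ.fderiv_apply ((1 : ℝ), (0 : ℝ × ℝ))),
      ← h2 _ (hψ'.fderiv_apply ((1 : ℝ), (0 : ℝ × ℝ)))]
    congr 1
    · refine integral_congr_ae (ae_of_all _ fun x => ?_)
      simp only [kineticCoord.fderiv_comp_apply]
      congr 1
      rw [kineticCoord_apply]
      simp
    · refine integral_congr_ae (ae_of_all _ fun x => ?_)
      simp only [kineticCoordNeg.fderiv_comp_apply]
      congr 1
      rw [kineticCoordNeg_apply]
      simp
  · refine ENNReal.toReal_le_of_le_ofReal ?_ ?_
    · exact add_nonneg (mul_nonneg hC₁ (halfPlaneOscillation_nonneg _ _ _ _ hr))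
        (mul_nonneg hC₂ (halfPlaneOscillation_nonneg _ _ _ _ hr))
    · rw [ENNReal.ofReal_add (mul_nonneg hC₁ (halfPlaneOscillation_nonneg _ _ _ _ hr))
        (mul_nonneg hC₂ (halfPlaneOscillation_nonneg _ _ _ _ hr))]
      exact (hball p r).trans (add_le_add (b1 _ c r hr) (b2 _ c' r hr))

end

/-! ### Oscillation at points of the axis and at Lebesgue points -/

theorem notMem_jumpSet_of_le {ν : Measure (Pt 2)} {p : Pt 2} {C₁ C₂ : ℝ} {a b : ℝ → ℝ}
    (h : ∀ r, 0 < r → ν.real (Metric.ball p r) ≤ C₁ * a r + C₂ * b r)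
    (ha : Tendsto (fun r => r⁻¹ * a r) (𝓝[>] 0) (𝓝 0))
    (hb : Tendsto (fun r => r⁻¹ * b r) (𝓝[>] 0) (𝓝 0)) : p ∉ jumpSet ν := by
  intro hp
  refine (mem_ofPred.1 hp) ?_
  have e : (fun r : ℝ => r ^ (((2 : ℕ) : ℤ) - 1)) = fun r => r := by
    funext r
    norm_num
  rw [e]
  refine isLittleO_of_tendsto' ?_ ?_
  · filter_upwards [self_mem_nhdsWithin] with r hr h0
    exact absurd h0 (ne_of_gt hr)
  · have hlim : Tendsto (fun r => C₁ * (r⁻¹ * a r) + C₂ * (r⁻¹ * b r)) (𝓝[>] 0) (𝓝 0) := by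
      simpa using (ha.const_mul C₁).add (hb.const_mul C₂)
    refine squeeze_zero' ?_ ?_ hlim
    · filter_upwards [self_mem_nhdsWithin] with r hr
      exact div_nonneg measureReal_nonneg (le_of_lt hr)
    · filter_upwards [self_mem_nhdsWithin] with r hr
      have hr0 : 0 < r := hr
      rw [div_le_iff₀ hr0]
      refine (h r hr0).trans_eq ?_
      field_simp

section

variable {u₀ : ℝ → ℝ} {u v : ℝ → ℝ → ℝ} {F G : ℝ → ℝ}

/-- The cone estimate at scale `R r` transfers the mean oscillation of the datum to the interior.
The reference constant may depend on `r`, which is decisive at the origin. -/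
theorem IsEntropySolution.tendsto_interior_oscillation
    (hu : IsEntropySolution (fun v => v ^ 2 / 2) u₀ u) {x₀ : ℝ} {c : ℝ → ℝ}
    (hc : ∀ r, |c r| ≤ 1)
    (h : ∀ R, 0 < R → Tendsto (fun r => r⁻¹ * ∫ x in Metric.closedBall x₀ (R * r), |u₀ x - c r|)
      (𝓝[>] 0) (𝓝 0)) {R : ℝ} (hR : 0 < R) :
    Tendsto (fun r => r⁻¹ * (r⁻¹ * ∫ z in (Ioi (0 : ℝ) ×ˢ univ) ∩
      Metric.closedBall (0, x₀) (R * r), |u z.1 z.2 - c r|)) (𝓝[>] 0) (𝓝 0) := by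
  obtain ⟨C, R', hC, hR', hcone⟩ := hu.cone_estimate
  have hlim := ((h (R' * R) (mul_pos hR' hR)).const_mul (R * C))
  rw [mul_zero] at hlim
  refine squeeze_zero' ?_ ?_ hlim
  · filter_upwards [self_mem_nhdsWithin] with r hr
    have : 0 < r⁻¹ := inv_pos.2 hr
    exact mul_nonneg this.le (mul_nonneg this.le (integral_nonneg fun _ => abs_nonneg _))
  · filter_upwards [self_mem_nhdsWithin] with r hr
    have hr0 : 0 < r := hr
    have h1 := hcone x₀ (c r) (R * r) (hc r) (mul_pos hR hr0)
    have e : ∫ x in Metric.closedBall x₀ (R' * (R * r)), |u 0 x - c r| =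
        ∫ x in Metric.closedBall x₀ (R' * R * r), |u₀ x - c r| := by
      rw [mul_assoc]
      refine integral_congr_ae (ae_restrict_of_ae ?_)
      filter_upwards [hu.initial] with x hx
      rw [hx]
    rw [e, mul_inv, mul_assoc, inv_mul_le_iff₀ hR] at h1
    refine (mul_le_mul_of_nonneg_left h1 (inv_pos.2 hr0).le).trans_eq ?_
    ring

theorem IsEntropySolution.tendsto_halfPlaneOscillation
    (hu : IsEntropySolution (fun v => v ^ 2 / 2) u₀ u) {x₀ : ℝ} {c : ℝ → ℝ}
    (hc : ∀ r, |c r| ≤ 1)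
    (h : ∀ R, 0 < R → Tendsto (fun r => r⁻¹ * ∫ x in Metric.closedBall x₀ (R * r), |u₀ x - c r|)
      (𝓝[>] 0) (𝓝 0)) {R : ℝ} (hR : 0 < R) :
    Tendsto (fun r => r⁻¹ * halfPlaneOscillation u (0, x₀) (c r) (R * r) r) (𝓝[>] 0) (𝓝 0) := by
  have h1 := (hu.tendsto_interior_oscillation hc h hR).add (h R hR)
  rw [add_zero] at h1
  refine h1.congr' ?_
  filter_upwards [self_mem_nhdsWithin] with r hr
  have hr0 : 0 < r := hr
  rw [halfPlaneOscillation, mul_add]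
  congr 2
  have es : {x : ℝ | ((0 : ℝ), x) ∈ Metric.closedBall ((0 : ℝ), x₀) (R * r)} =
      Metric.closedBall x₀ (R * r) := by
    ext x
    rw [mem_ofPred, Metric.mem_closedBall, Metric.mem_closedBall, Prod.dist_eq]
    simp only [dist_self]
    rw [max_eq_right dist_nonneg]
  rw [es]
  refine integral_congr_ae (ae_restrict_of_ae ?_)
  filter_upwards [hu.initial] with x hx
  rw [hx]

theorem norm_le_planeCoord (p : Pt 2) : ‖p‖ ≤ 3 / 2 * ‖planeCoord p‖ := by
  have h0 : |p 0| ≤ ‖planeCoord p‖ := by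
    rw [planeCoord_apply, Prod.norm_def]
    exact le_max_left _ _
  have h1 : |p 1| ≤ ‖planeCoord p‖ := by
    rw [planeCoord_apply, Prod.norm_def]
    exact le_max_right _ _
  rw [EuclideanSpace.norm_eq, Fin.sum_univ_two, Real.norm_eq_abs, Real.norm_eq_abs]
  refine Real.sqrt_le_iff.2 ⟨by positivity, ?_⟩
  nlinarith [abs_nonneg (p 0), abs_nonneg (p 1), norm_nonneg (planeCoord p)]

/-- Passes from means over Euclidean balls to integrals over sup-norm balls scaled by `r⁻²`. A
sup-norm ball of radius `R r` lies in the Euclidean ball of radius `2 R r`, whose area gives the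
factor `4 R² π`. -/
theorem tendsto_planeGlue_average (hu : IsEntropySolution F u₀ u) (hv : IsEntropySolution G u₀ v)
    {p : Pt 2} {c : ℝ}
    (h : Tendsto (fun r : ℝ => ⨍ y in Metric.ball p r, |planeGlue u v (planeCoord y) - c|)
      (𝓝[>] (0 : ℝ)) (𝓝 0)) {R : ℝ} (hR : 0 < R) :
    Tendsto (fun r => r⁻¹ * (r⁻¹ * ∫ z in Metric.closedBall (planeCoord p) (R * r),
      |planeGlue u v z - c|)) (𝓝[>] 0) (𝓝 0) := by
  have hs : Tendsto (fun r : ℝ => 2 * R * r) (𝓝[>] 0) (𝓝[>] 0) := by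
    refine tendsto_nhdsWithin_iff.2 ⟨?_, ?_⟩
    · have : Tendsto (fun r : ℝ => 2 * R * r) (𝓝 0) (𝓝 (2 * R * 0)) :=
        (continuous_const_mul (2 * R)).tendsto 0
      rw [mul_zero] at this
      exact this.mono_left nhdsWithin_le_nhds
    · filter_upwards [self_mem_nhdsWithin] with r hr
      exact mem_Ioi.2 (mul_pos (mul_pos two_pos hR) (mem_Ioi.1 hr))
  have hlim := (h.comp hs).const_mul (4 * R ^ 2 * Real.pi)
  rw [mul_zero] at hlim
  obtain ⟨M, hM⟩ := exists_bound_planeGlue hu hv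
  refine squeeze_zero' ?_ ?_ hlim
  · filter_upwards [self_mem_nhdsWithin] with r hr
    have : 0 < r⁻¹ := inv_pos.2 hr
    exact mul_nonneg this.le (mul_nonneg this.le (integral_nonneg fun _ => abs_nonneg _))
  · filter_upwards [self_mem_nhdsWithin] with r hr
    have hr0 : 0 < r := hr
    set B := Metric.ball p (2 * R * r) with hB
    have e1 : ∫ y in B, |planeGlue u v (planeCoord y) - c| =
        ∫ z in planeCoord.symm ⁻¹' B, |planeGlue u v z - c| := by
      have := measurePreserving_planeCoord_symm.setIntegral_preimage_emb
        planeCoord.symm.toHomeomorph.measurableEmbedding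
        (fun y => |planeGlue u v (planeCoord y) - c|) B
      simpa only [ContinuousLinearEquiv.apply_symm_apply] using this.symm
    have hfin : volume (planeCoord.symm ⁻¹' B) ≠ ⊤ := by
      rw [measurePreserving_planeCoord_symm.measure_preimage
        Metric.isOpen_ball.measurableSet.nullMeasurableSet]
      exact Metric.isBounded_ball.measure_lt_top.ne
    have e2 : ∫ z in Metric.closedBall (planeCoord p) (R * r), |planeGlue u v z - c| ≤
        ∫ z in planeCoord.symm ⁻¹' B, |planeGlue u v z - c| := by
      refine setIntegral_mono_set ?_ (ae_of_all _ fun _ => abs_nonneg _)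
        (Eventually.of_forall fun z hz => ?_)
      · refine Measure.integrableOn_of_bounded (M := M + |c|) hfin
          (((measurable_planeGlue hu hv).sub_const c).abs).aestronglyMeasurable
          (ae_of_all _ fun z => ?_)
        rw [Real.norm_eq_abs, abs_abs]
        exact (abs_sub _ _).trans (by linarith [hM z])
      · change planeCoord.symm z ∈ Metric.ball p (2 * R * r)
        rw [mem_ball_iff_norm]
        have h1 := norm_le_planeCoord (planeCoord.symm z - p)
        rw [map_sub, ContinuousLinearEquiv.apply_symm_apply] at h1
        have h2 := mem_closedBall_iff_norm.1 hz
        nlinarith [mul_pos hR hr0]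
    have e3 : volume.real B = 4 * R ^ 2 * Real.pi * r ^ 2 := by
      rw [measureReal_def, hB, EuclideanSpace.volume_ball_fin_two, ENNReal.toReal_mul,
        ENNReal.toReal_pow, ENNReal.toReal_ofReal (by positivity), ENNReal.toReal_ofReal Real.pi_pos.le]
      ring
    have e4 : ⨍ y in B, |planeGlue u v (planeCoord y) - c| =
        (4 * R ^ 2 * Real.pi * r ^ 2)⁻¹ * ∫ y in B, |planeGlue u v (planeCoord y) - c| := by
      rw [setAverage_eq, e3, smul_eq_mul]
    simp only [Function.comp_apply]
    rw [← hB, e4, e1]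
    have hpi := Real.pi_pos
    calc _ ≤ r⁻¹ * (r⁻¹ * ∫ z in planeCoord.symm ⁻¹' B, |planeGlue u v z - c|) := by gcongr
      _ = _ := by field_simp

theorem integral_upper_le_planeGlue (hu : IsEntropySolution F u₀ u)
    (hv : IsEntropySolution G u₀ v) (q : ℝ × ℝ) (c ρ : ℝ) :
    ∫ z in (Ioi (0 : ℝ) ×ˢ univ) ∩ Metric.closedBall q ρ, |u z.1 z.2 - c| ≤
      ∫ z in Metric.closedBall q ρ, |planeGlue u v z - c| := by
  obtain ⟨M, hM⟩ := exists_bound_planeGlue hu hv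
  have hm := measurableSet_upper.inter (Metric.isClosed_closedBall (x := q) (ε := ρ)).measurableSet
  have e : ∫ z in (Ioi (0 : ℝ) ×ˢ univ) ∩ Metric.closedBall q ρ, |u z.1 z.2 - c| =
      ∫ z in (Ioi (0 : ℝ) ×ˢ univ) ∩ Metric.closedBall q ρ, |planeGlue u v z - c| :=
    setIntegral_congr_fun hm fun z hz => by simp only [planeGlue_of_pos (mem_Ioi.1 hz.1.1)]
  rw [e]
  refine setIntegral_mono_set ?_ (ae_of_all _ fun _ => abs_nonneg _)
    (Eventually.of_forall fun z hz => hz.2)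
  refine Measure.integrableOn_of_bounded (M := M + |c|)
    (isCompact_closedBall q ρ).measure_lt_top.ne
    (((measurable_planeGlue hu hv).sub_const c).abs).aestronglyMeasurable
    (ae_of_all _ fun z => ?_)
  rw [Real.norm_eq_abs, abs_abs]
  exact (abs_sub _ _).trans (by linarith [hM z])

theorem planeGlue_swap_neg {z : ℝ × ℝ} (hz : z.1 ≠ 0) :
    planeGlue v u z = planeGlue u v (-z) := by
  rcases lt_or_gt_of_ne hz with h | h
  · simp [planeGlue, not_le.2 h, h.le]
  · simp [planeGlue, h.le, h]

/-- Exchanging the two parts is the point reflection, up to the null line `t = 0`; estimates for the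
upper part thus serve for the lower one too. -/
theorem integral_planeGlue_swap (q : ℝ × ℝ) (c ρ : ℝ) :
    ∫ z in Metric.closedBall (-q) ρ, |planeGlue v u z - c| =
      ∫ z in Metric.closedBall q ρ, |planeGlue u v z - c| := by
  rw [← (Measure.measurePreserving_neg (volume : Measure (ℝ × ℝ))).setIntegral_preimage_emb
    (MeasurableEquiv.neg (ℝ × ℝ)).measurableEmbedding _ (Metric.closedBall q ρ)]
  have es : Neg.neg ⁻¹' Metric.closedBall q ρ = Metric.closedBall (-q) ρ := by
    ext z
    rw [mem_preimage, mem_closedBall_iff_norm, mem_closedBall_iff_norm, ← norm_neg]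
    congr! 2
    abel
  rw [es]
  refine integral_congr_ae (ae_restrict_of_ae ?_)
  filter_upwards [ae_fst_ne_zero] with z hz
  rw [planeGlue_swap_neg hz]

end

section

variable {u₀ : ℝ → ℝ} {u v : ℝ → ℝ → ℝ} {F G : ℝ → ℝ}

/-- Away from the time axis the oscillation vanishes at Lebesgue points. -/
theorem tendsto_halfPlaneOscillation_of_ne (hu : IsEntropySolution F u₀ u)
    (hv : IsEntropySolution G u₀ v) {q : ℝ × ℝ} {c : ℝ} (hq : q.1 ≠ 0)
    (h : ∀ R, 0 < R → Tendsto (fun r => r⁻¹ * (r⁻¹ * ∫ z in Metric.closedBall q (R * r),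
      |planeGlue u v z - c|)) (𝓝[>] 0) (𝓝 0)) {R : ℝ} (hR : 0 < R) :
    Tendsto (fun r => r⁻¹ * halfPlaneOscillation u q c (R * r) r) (𝓝[>] 0) (𝓝 0) := by
  have hsmall : ∀ᶠ r in 𝓝[>] (0 : ℝ), r < |q.1| / R :=
    mem_nhdsWithin_of_mem_nhds (gt_mem_nhds (div_pos (abs_pos.2 hq) hR))
  refine squeeze_zero' ?_ ?_ (h R hR)
  · filter_upwards [self_mem_nhdsWithin] with r hr
    exact mul_nonneg (inv_pos.2 hr).le (halfPlaneOscillation_nonneg _ _ _ _ hr)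
  · filter_upwards [self_mem_nhdsWithin, hsmall] with r hr hr2
    have hr0 : 0 < r⁻¹ := inv_pos.2 hr
    rw [lt_div_iff₀ hR] at hr2
    have he : {x : ℝ | ((0 : ℝ), x) ∈ Metric.closedBall q (R * r)} = ∅ := by
      refine eq_empty_of_forall_notMem fun x hx => ?_
      have h1 := mem_closedBall_iff_norm.1 (mem_ofPred.1 hx)
      have h2 := (norm_fst_le _).trans h1
      rw [Prod.fst_sub, zero_sub, norm_neg, Real.norm_eq_abs] at h2
      linarith
    rw [halfPlaneOscillation, he, Measure.restrict_empty, integral_zero_measure, add_zero]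
    refine mul_le_mul_of_nonneg_left (mul_le_mul_of_nonneg_left ?_ hr0.le) hr0.le
    exact integral_upper_le_planeGlue hu hv q c _

/-- An average limit of the solution at a boundary point is a weak limit of the datum. -/
theorem IsEntropySolution.tendsto_weak_trace
    (hu : IsEntropySolution (fun v => v ^ 2 / 2) u₀ u) {s c : ℝ}
    (h : ∀ R, 0 < R → Tendsto (fun r => r⁻¹ * (r⁻¹ * ∫ z in (Ioi (0 : ℝ) ×ˢ univ) ∩
      Metric.closedBall (0, s) (R * r), |u z.1 z.2 - c|)) (𝓝[>] 0) (𝓝 0))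
    {β : ℝ → ℝ} (hβ : IsTestFunction β) :
    Tendsto (fun r => ∫ y, (u₀ (s + r * y) - c) * β y) (𝓝[>] 0) (𝓝 0) := by
  obtain ⟨M, hM1, hM⟩ := hu.exists_bound
  let γ : ContDiffBump (0 : ℝ) := ⟨1, 2, zero_lt_one, one_lt_two⟩
  have hγ : IsTestFunction γ := ⟨γ.contDiff, γ.hasCompactSupport⟩
  have hγ0 : γ 0 = 1 := γ.one_of_mem_closedBall (Metric.mem_closedBall_self zero_le_one)
  have hb : IsTestFunction fun p : ℝ × ℝ => γ p.1 * β p.2 := hγ.mul_prod hβ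
  obtain ⟨C, R, hC, hR, -, key⟩ := hu.abs_entropyFunctional_rescale_sub_le hM hb
  have hlim := (h R hR).const_mul ((1 + M + |c|) * C)
  rw [mul_zero] at hlim
  rw [tendsto_zero_iff_abs_tendsto_zero]
  refine squeeze_zero' (Eventually.of_forall fun r => abs_nonneg _) ?_ hlim
  filter_upwards [self_mem_nhdsWithin] with r hr
  have hr0 : 0 < r := hr
  -- For the linear entropy the production vanishes, so the oscillation bound controls the trace
  -- term alone. The cut-off in time equals one at `t = 0`, and the trace term becomes the rescaled
  -- datum tested with `β`.
  have h1 := key (fun v => v) (fun v => v ^ 2 / 2) c (1 + M + |c|) continuous_id (by fun_prop)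
    (by positivity)
    (fun v _ => le_mul_of_one_le_left (abs_nonneg _) (by linarith [abs_nonneg c]))
    (fun v hv => by
      have e : v ^ 2 / 2 - c ^ 2 / 2 = (v + c) / 2 * (v - c) := by ring
      rw [e, abs_mul]
      refine mul_le_mul_of_nonneg_right ?_ (abs_nonneg _)
      rw [abs_div, abs_two]
      linarith [abs_add_le v c, abs_nonneg (v + c), abs_nonneg c]) (0, s) r hr0
  have ht := (hb.rescale (0, s) hr0)
  rw [hu.entropyFunctional_id_eq_zero ht, zero_sub, abs_neg] at h1
  let g : ℝ → ℝ := fun x => (u₀ x - c) * β (r⁻¹ * (x - s))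
  have e1 : ∫ x, (u 0 x - c) * (γ (r⁻¹ • (((0 : ℝ), x) - (0, s))).1 *
      β (r⁻¹ • (((0 : ℝ), x) - (0, s))).2) = ∫ x, g x := by
    refine integral_congr_ae ?_
    filter_upwards [hu.initial] with x hx
    simp [g, hx, hγ0]
  have e2 : ∫ y, (u₀ (s + r * y) - c) * β y = r⁻¹ * ∫ x, g x := by
    have a1 : ∫ y, g (s + r * y) = |r⁻¹| • ∫ y, g (s + y) :=
      Measure.integral_comp_mul_left (fun y => g (s + y)) r
    rw [integral_add_left_eq_self g s, abs_of_pos (inv_pos.2 hr0), smul_eq_mul] at a1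
    rw [← a1]
    refine integral_congr_ae (ae_of_all _ fun y => ?_)
    simp only [g, add_sub_cancel_left, inv_mul_cancel_left₀ hr0.ne']
  rw [e1] at h1
  rw [Function.comp_apply, e2, abs_mul, abs_of_pos (inv_pos.2 hr0)]
  refine (mul_le_mul_of_nonneg_left h1 (inv_pos.2 hr0).le).trans_eq ?_
  ring

end

/-! ### The origin and the conclusion -/

/-- The solution with datum `oscDatum` has no average limit at the origin. -/
theorem IsEntropySolution.not_tendsto_average_zero {u : ℝ → ℝ → ℝ}
    (hu : IsEntropySolution (fun v => v ^ 2 / 2) oscDatum u) (c : ℝ) :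
    ¬ Tendsto (fun r => r⁻¹ * (r⁻¹ * ∫ z in (Ioi (0 : ℝ) ×ˢ univ) ∩
      Metric.closedBall (0, 0) (1 * r), |u z.1 z.2 - c|)) (𝓝[>] 0) (𝓝 0) := by
  intro h
  have h2 := hu.tendsto_interior_oscillation abs_oscValue_le oscDatum_average_tendsto one_pos
  have hlim := (h.add h2).const_mul (1 / 2)
  rw [add_zero, mul_zero] at hlim
  refine oscValue_not_tendsto c ?_
  rw [← tendsto_sub_nhds_zero_iff, tendsto_zero_iff_abs_tendsto_zero]
  refine squeeze_zero' (Eventually.of_forall fun r => abs_nonneg _) ?_ hlim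
  filter_upwards [self_mem_nhdsWithin] with r hr
  have hr0 : 0 < r := hr
  set A := (Ioi (0 : ℝ) ×ˢ (univ : Set ℝ)) ∩ Metric.closedBall ((0 : ℝ), (0 : ℝ)) (1 * r) with hA
  have hAe : A = Ioc 0 r ×ˢ Icc (-r) r := by
    ext ⟨a, b⟩
    rw [hA, one_mul, ← closedBall_prod_same, Real.closedBall_eq_Icc, zero_sub, zero_add]
    simp only [mem_inter_iff, mem_prod, mem_Ioi, mem_univ, mem_Icc, mem_Ioc, and_true]
    constructor
    · rintro ⟨h1, ⟨-, h2⟩, h3⟩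
      exact ⟨⟨h1, h2⟩, h3⟩
    · rintro ⟨⟨h1, h2⟩, h3⟩
      exact ⟨h1, ⟨by linarith, h2⟩, h3⟩
  have hv : volume.real A = 2 * r ^ 2 := by
    rw [hAe, Measure.volume_eq_prod, measureReal_prod_prod, Real.volume_real_Ioc_of_le hr0.le,
      Real.volume_real_Icc_of_le (by linarith)]
    ring
  have i1 := hu.integrableOn_abs_sub c (0, 0) (1 * r)
  have i2 := hu.integrableOn_abs_sub (oscValue r) (0, 0) (1 * r)
  -- The solution is close in mean both to `c` and to `oscValue r` on a half ball of area `2 r²`;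
  -- the triangle inequality would make `oscValue` converge to `c`.
  have hle : ∫ _ in A, |oscValue r - c| ≤ ∫ z in A, (|u z.1 z.2 - c| + |u z.1 z.2 - oscValue r|) := by
    refine integral_mono_of_nonneg (ae_of_all _ fun _ => abs_nonneg _) (i1.add i2)
      (ae_of_all _ fun z => ?_)
    have := abs_sub (u z.1 z.2 - c) (u z.1 z.2 - oscValue r)
    rwa [sub_sub_sub_cancel_left] at this
  rw [setIntegral_const, hv, smul_eq_mul, integral_add i1 i2] at hle
  have : |oscValue r - c| = 1 / 2 * (r⁻¹ * (r⁻¹ * (2 * r ^ 2 * |oscValue r - c|))) := by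
    field_simp
  rw [Function.comp_apply, this, ← mul_add, ← mul_add]
  gcongr

theorem mainTheorem6 :
    (∃ u₁ : ℝ → ℝ → ℝ, IsEntropySolution (fun v => v ^ 2 / 2) oscDatum u₁) ∧
    (∃ u₂ : ℝ → ℝ → ℝ, IsEntropySolution (fun v => -(v ^ 2 / 2)) oscDatum u₂) ∧
    ∀ u₁ u₂ : ℝ → ℝ → ℝ,
      IsEntropySolution (fun v => v ^ 2 / 2) oscDatum u₁ →
      IsEntropySolution (fun v => -(v ^ 2 / 2)) oscDatum u₂ →
      IsQuasiSolution burgersFlux (glue u₁ u₂) ∧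
      IsDivFree burgersFlux (glue u₁ u₂) ∧
      ∃ μ : SignedRadonMeasure (ℝ × Pt 2),
        IsKineticMeasure burgersFlux (glue u₁ u₂) μ ∧
        (0 : Pt 2) ∉ jumpSet (dissipation μ) ∧
        (0 : Pt 2) ∉ lebesguePoints (glue u₁ u₂) ∧
        lebesguePoints (glue u₁ u₂) ⊂ (jumpSet (dissipation μ))ᶜ := by
  obtain ⟨w, hw⟩ := exists_isEntropySolution measurable_oscDatum abs_oscDatum_le
  refine ⟨⟨w, hw⟩, ⟨_, hw.reflect (fun v => by simp) oscDatum_neg⟩, fun u u₂ hu hu₂ => ?_⟩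
  have hv : IsEntropySolution (fun v => v ^ 2 / 2) oscDatum fun t x => u₂ t (-x) :=
    hu₂.reflect (fun v => by simp) oscDatum_neg
  have hg : glue u u₂ = fun p => planeGlue u (fun t x => u₂ t (-x)) (planeCoord p) :=
    funext fun p => glue_eq u u₂ p
  rw [hg]
  set v : ℝ → ℝ → ℝ := fun t x => u₂ t (-x)
  obtain ⟨μ, hμ, C₁, R₁, C₂, R₂, hR₁, hR₂, hball⟩ :=
    exists_isKineticMeasure_planeGlue hu hv oscDatum_neg
  refine ⟨isQuasiSolution_planeGlue hu hv oscDatum_neg, isDivFree_planeGlue hu hv oscDatum_neg,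
    μ, hμ, ?_⟩
  have hint : ∀ {p : Pt 2} {c : ℝ}, Tendsto (fun r : ℝ => ⨍ y in Metric.ball p r,
      |planeGlue u v (planeCoord y) - c|) (𝓝[>] (0 : ℝ)) (𝓝 0) → ∀ R, 0 < R →
      Tendsto (fun r => r⁻¹ * (r⁻¹ * ∫ z in (Ioi (0 : ℝ) ×ˢ univ) ∩
      Metric.closedBall (planeCoord p) (R * r), |u z.1 z.2 - c|)) (𝓝[>] 0) (𝓝 0) := by
    intro p c hc R hR
    refine squeeze_zero' ?_ ?_ (tendsto_planeGlue_average hu hv hc hR)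
    · filter_upwards [self_mem_nhdsWithin] with r hr
      have : 0 < r⁻¹ := inv_pos.2 hr
      exact mul_nonneg this.le (mul_nonneg this.le (integral_nonneg fun _ => abs_nonneg _))
    · filter_upwards [self_mem_nhdsWithin] with r hr
      have : 0 < r⁻¹ := inv_pos.2 hr
      exact mul_le_mul_of_nonneg_left (mul_le_mul_of_nonneg_left
        (integral_upper_le_planeGlue hu hv _ c _) this.le) this.le
  have haxis : ∀ p : Pt 2, p 0 = 0 → p 1 ≠ 1 → p 1 ≠ -1 → p ∉ jumpSet (dissipation μ) := by
    intro p h0 h1 h2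
    obtain ⟨c, hc, hc'⟩ := exists_oscDatum_average_tendsto h1 h2
    -- The second part is seen from the reflected point, so its datum is approximated by constants
    -- near `-p 1`.
    obtain ⟨d, hd, hd'⟩ := exists_oscDatum_average_tendsto (x₀ := -p 1)
      (fun h => h2 (by linarith)) (fun h => h1 (by linarith))
    have e1 : planeCoord p = (0, p 1) := by rw [planeCoord_apply, h0]
    have e2 : -planeCoord p = (0, -p 1) := by simp [e1]
    have l1 := hu.tendsto_halfPlaneOscillation hc hc' hR₁
    have l2 := hv.tendsto_halfPlaneOscillation hd hd' hR₂
    rw [← e1] at l1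
    rw [← e2] at l2
    exact notMem_jumpSet_of_le (fun r hr => hball p (c r) (d r) r hr) l1 l2
  have h0J : (0 : Pt 2) ∉ jumpSet (dissipation μ) := haxis 0 (by simp) (by simp) (by simp)
  have h0L : (0 : Pt 2) ∉ lebesguePoints fun p => planeGlue u v (planeCoord p) := by
    intro h
    obtain ⟨c, hc⟩ := mem_ofPred.1 h
    have := hint hc 1 one_pos
    rw [map_zero] at this
    exact hu.not_tendsto_average_zero c this
  refine ⟨h0J, h0L, ⟨fun p hp => ?_, fun hsub => h0L (hsub h0J)⟩⟩
  obtain ⟨c, hc⟩ := mem_ofPred.1 hp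
  by_cases hp0 : p 0 = 0
  · have e1 : planeCoord p = (0, p 1) := by rw [planeCoord_apply, hp0]
    -- The points `(0, ±1)` escape the oscillation argument, but they are not Lebesgue points: the
    -- mean limit would give the rescaled datum a constant weak limit.
    have hs : |p 1| ≠ 1 := by
      intro hs
      have := hint hc
      rw [e1] at this
      exact oscDatum_not_weakly_tendsto hs c fun β hβ => hu.tendsto_weak_trace this hβ
    exact haxis p hp0 (fun h => hs (by simp [h])) (fun h => hs (by simp [h]))
  · have hq : (planeCoord p).1 ≠ 0 := hp0
    have hq' : (-planeCoord p).1 ≠ 0 := neg_ne_zero.2 hq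
    have l1 := tendsto_halfPlaneOscillation_of_ne hu hv hq
      (fun R hR => tendsto_planeGlue_average hu hv hc hR) hR₁
    -- The roles of the two parts are exchanged at the reflected point, with the same constant `c`.
    have l2 := tendsto_halfPlaneOscillation_of_ne hv hu hq' (c := c) (fun R hR => by
      simp only [integral_planeGlue_swap]
      exact tendsto_planeGlue_average hu hv hc hR) hR₂
    exact notMem_jumpSet_of_le (fun r hr => hball p c c r hr) l1 l2
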